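/- **Setting.** A *shifted dyadic interval* is an interval $2^j\big(k+(0,1)+(-1)^j\alpha\big)$ with $j,k\in\mathbb Z$, $\alpha\in\{0,\tfrac13,\tfrac23\}$. For $A\ge 1$, a *quasi-cube* of dimension $d$ with constant $A$ is a product $Q=Q_1\times\dots\times Q_d$ of shifted dyadic intervals with $|Q_i|\le A|Q_j|$ for all $i,j$; we write $l(Q)\sim_A 2^k$ if $A^{-1}2^k\le |Q_i|\le A2^k$ for all $i$; $cQ_i$ and $cQ$ denote the concentric dilates. For $a\in(0,\infty)^d$, $Q$ is *adapted to $R_a$* (with constant $A$) if for $j=1,\dots,d-1$ the box $Q^j=Q_j\times Q_{j+1}$ lies in $\{a_jx<a_{j+1}y\}$ and $A^{-1}\operatorname{diam}Q^j\le \operatorname{dist}(Q^j,\Gamma^j)\le A\operatorname{diam}Q^j$, where $\Gamma^j=\{a_jx=a_{j+1}y\}$. A family of quasi-cubes is *$c$-sparse* if for any two distinct members, $|Q|<|Q'|$ implies $|cQ|<|Q'|$, and $|Q|=|Q'|$ implies $cQ\cap cQ'=\emptyset$. A smooth $\varphi:\mathbb R\to\mathbb C$ is a *bump adapted to an interval $J$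 with bounds $(B_l)_{l\ge 0}$* if it vanishes off $J$ and $|\varphi^{(l)}|\le B_l|J|^{-l}$ for all $l$. Let $\mathcal G_n$ be the (finite) set of plane rooted trees with exactly $n$ leaves, labelled $1,\dots,n$ from left to right, in which every vertex that is not a leaf has at least two sons. Let $V_G$ be the set of the vertices of $G$ that are not leaves, and $\mathcal I_u$ the set of the labels of the leaves descending from $u$ ($\mathcal I_u=\{i\}$ if $u$ is the leaf $i$). Let $\kappa:\mathbb R\to\mathbb N$ and $c\in\mathbb R$. A function $m:\mathbb R^n\to\mathbb C$ is a *standard symbol of type $G\in\mathcal G_n$* (with separation $\kappa$ and sparseness $c$) if there are $A\ge1$, an integer $K\ge\kappa(A)$, bounds $(B_l)$ and a rapidly decreasing sequence $(C_\nu)_{\nu\in\mathbb N}$ such that for every $\xi\in\mathbb R^n$ $$m(\xi)=\sum_{\nu}C_\nu\sum_{(k_u)\in S_G}\ \prod_{u\in V_G}m_{u,\nu}^{k_u}(\xi),\qquad S_G=\{(k_u)_{u\in V_G}\in\mathbb Z^{V_G}:\ k_u\ge k_v+K\ \text{ whenever } v\in V_G \text{ is a son of } u\},$$ where for each $u\in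 V_G$ with sons $u_1,\dots,u_d$ (from left to right) $$m_{u,\nu}^{k}(\xi)=\sum_{Q\in\mathbf Q_{u,\nu}^{k}}\ \prod_{i=1}^{d}\Phi_{u,\nu,Q,i}\Big(\sum_{l\in\mathcal I_{u_i}}\xi_l\Big).$$ Here, for each $u$ and $\nu$, the sets $\mathbf Q^k_{u,\nu}$ $(k\in\mathbb Z)$ are pairwise disjoint, their union is $c$-sparse, each $Q\in\mathbf Q^k_{u,\nu}$ is a quasi-cube with constant $A$ such that $l(Q)\sim_A2^k$ and $Q$ is adapted with constant $A$ to $R_a$ for $a=(|\mathcal I_{u_1}|^{-1},\dots,|\mathcal I_{u_d}|^{-1})$, and $\Phi_{u,\nu,Q,i}$ is a bump adapted to $\tfrac9{10}Q_i$ with bounds $(B_l)$. Thus $A$ is the constant in all relations "$\sim$", $2^K$ is the constant in "$\gg$", and $K\ge\kappa(A)$ expresses that the latter is large compared with the former. **Proposition.** Let $n\ge1$ and let $\kappa':\mathbb R\to\mathbb N$ be arbitrary. 1. There is $\kappa:\mathbb R\to\mathbb N$ such that for all $c\in\mathbb R$, all $G_1,G_2\in\mathcal G_n$ and all standard symbols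 $m_{G_1},m_{G_2}$ of types $G_1,G_2$ with separation $\kappa$ and sparseness $c$, there is a tree $G\in\mathcal G_n$ such that $m_{G_1}\cdot m_{G_2}$ is a standard symbol of type $G$ with separation $\kappa'$ and sparseness $c$. 2. For every $c\in\mathbb R$ there are standard symbols $m_G$ of type $G$, one for each $G\in\mathcal G_n$, with separation $\kappa'$ and sparseness $c$, such that $$\chi_{\xi_1<\dots<\xi_n}(\xi)=\sum_{G\in\mathcal G_n}m_G(\xi)\qquad\text{for every }\xi\in\mathbb R^n .$$ -/

import Mathlib

open scoped ContDiff

noncomputable section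

/-! Rooted trees with `n` leaves -/

/-- The class `𝒢_n` of rooted trees with exactly `n` leaves, numbered from left to right, in which
every vertex that is not a leaf has at least two sons. Such a tree is recorded by its vertices, a
vertex `u` being identified with the set `I_u` of the leaves that descend from it (`I_u = {i}` if
`u` is the leaf number `i`). Distinct vertices have distinct sets because there are no vertices with
exactly one son. The leaves are numbered by `Fin n`. -/
@[ext]
structure PlaneTree (n : ℕ) where
  /-- all vertices, leaves included -/
  verts : Finset (Finset (Fin n))
  /-- the descendants of a vertex form a non-empty interval `{l_u, …, r_u}` -/
  interval : ∀ u ∈ verts, ∃ l r : Fin n, l ≤ r ∧ u = Finset.Icc l r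
  /-- the root -/
  root_mem : Finset.univ ∈ verts
  /-- the leaves -/
  leaf_mem : ∀ i : Fin n, {i} ∈ verts
  /-- of two vertices, either one descends from the other or they have no common descendants -/
  laminar : ∀ u ∈ verts, ∀ v ∈ verts, u ⊆ v ∨ v ⊆ u ∨ Disjoint u v

namespace PlaneTree

variable {n : ℕ}

instance : Fintype (PlaneTree n) :=
  Fintype.ofInjective PlaneTree.verts fun _ _ h => PlaneTree.ext h

/-- `V_G`: the vertices that are not leaves. -/
def inner (G : PlaneTree n) : Finset (Finset (Fin n)) := G.verts.filter fun u => 1 < u.card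

open Classical in
/-- The sons of `u`: the maximal vertices strictly below `u`. -/
def sons (G : PlaneTree n) (u : Finset (Fin n)) : Finset (Finset (Fin n)) :=
  G.verts.filter fun w => w ⊂ u ∧ ∀ w' ∈ G.verts, w ⊂ w' → ¬ w' ⊂ u

/-- The sons of `u` as a type; it is ordered from left to right, see below. -/
def Son (G : PlaneTree n) (u : Finset (Fin n)) : Type := {w : Finset (Fin n) // w ∈ G.sons u}

instance (G : PlaneTree n) (u : Finset (Fin n)) : Fintype (G.Son u) :=
  inferInstanceAs (Fintype {w : Finset (Fin n) // w ∈ G.sons u})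

theorem Son.nonempty {G : PlaneTree n} {u : Finset (Fin n)} (w : G.Son u) : w.1.Nonempty := by
  obtain ⟨l, r, hlr, h⟩ := G.interval w.1 (Finset.mem_filter.1 w.2).1
  rw [h]
  exact Finset.nonempty_Icc.2 hlr

/-- The leftmost leaf below a son. -/
def Son.left {G : PlaneTree n} {u : Finset (Fin n)} (w : G.Son u) : Fin n :=
  w.1.min' w.nonempty

theorem Son.left_injective {G : PlaneTree n} {u : Finset (Fin n)} :
    Function.Injective (Son.left : G.Son u → Fin n) := by
  intro w w' h
  have hw := (Finset.mem_filter.1 w.2)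
  have hw' := (Finset.mem_filter.1 w'.2)
  have h1 : w.left ∈ w.1 := Finset.min'_mem _ _
  have h2 : w.left ∈ w'.1 := h ▸ Finset.min'_mem _ _
  apply Subtype.ext
  by_contra hne
  rcases G.laminar w.1 hw.1 w'.1 hw'.1 with hs | hs | hs
  · exact hw.2.2 _ hw'.1 (lt_of_le_of_ne hs hne) hw'.2.1
  · exact hw'.2.2 _ hw.1 (lt_of_le_of_ne hs (Ne.symm hne)) hw.2.1
  · exact Finset.disjoint_left.1 hs h1 h2

/-- The sons of a vertex, ordered from left to right. -/
instance (G : PlaneTree n) (u : Finset (Fin n)) : LinearOrder (G.Son u) :=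
  LinearOrder.lift' Son.left Son.left_injective

end PlaneTree

/-! Shifted dyadic intervals and quasi-cubes -/

/-- The data `j, k, α = shift / 3` of the shifted dyadic interval `2^j (k + (0,1) + (-1)^j α)`. -/
structure ShiftedDyadic where
  scale : ℤ
  pos : ℤ
  shift : Fin 3

namespace ShiftedDyadic

/-- The length `2^j`. -/
def length (I : ShiftedDyadic) : ℝ := (2 : ℝ) ^ I.scale

/-- The left endpoint. -/
def left (I : ShiftedDyadic) : ℝ :=
  (2 : ℝ) ^ I.scale * ((I.pos : ℝ) + (-1 : ℝ) ^ I.scale * ((I.shift : ℕ) / 3 : ℝ))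

/-- The midpoint. -/
def center (I : ShiftedDyadic) : ℝ := I.left + I.length / 2

/-- The open interval itself. -/
def toSet (I : ShiftedDyadic) : Set ℝ := Set.Ioo I.left (I.left + I.length)

/-- `c I`: the open interval with the same center and `c` times the length. -/
def dilate (c : ℝ) (I : ShiftedDyadic) : Set ℝ :=
  Set.Ioo (I.center - c * I.length / 2) (I.center + c * I.length / 2)

end ShiftedDyadic

/-- Products `Q = ∏ Q_i` of shifted dyadic intervals. In dimension `d`, the index type is a linearly
ordered set with `d` elements. -/
abbrev DyadicBox (ι : Type) : Type := ι → ShiftedDyadic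

namespace DyadicBox

variable {ι : Type}

/-- `Q` is a quasi-cube: `|Q_i| ∼ |Q_j|`, with constant `A`. -/
def IsQuasiCube (A : ℝ) (Q : DyadicBox ι) : Prop :=
  ∀ i j, (Q i).length ≤ A * (Q j).length

/-- `l(Q) ∼ 2^k`, with constant `A`. -/
def HasScale (A : ℝ) (k : ℤ) (Q : DyadicBox ι) : Prop :=
  ∀ i, A⁻¹ * (2 : ℝ) ^ k ≤ (Q i).length ∧ (Q i).length ≤ A * (2 : ℝ) ^ k

/-- The planar box `I × J`, with the Euclidean metric. -/
def planeBox (I J : ShiftedDyadic) : Set (EuclideanSpace ℝ (Fin 2)) :=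
  {p | p 0 ∈ I.toSet ∧ p 1 ∈ J.toSet}

/-- The line `a x = b y`. -/
def planeLine (a b : ℝ) : Set (EuclideanSpace ℝ (Fin 2)) := {p | a * p 0 = b * p 1}

/-- `I × J` lies in `{a x < b y}` and its distance to the line `a x = b y` is comparable, with
constant `A`, to its diameter. -/
def PairAdapted (A a b : ℝ) (I J : ShiftedDyadic) : Prop :=
  (∀ p ∈ planeBox I J, a * p 0 < b * p 1) ∧
  (∀ p ∈ planeBox I J, ∀ q ∈ planeLine a b, A⁻¹ * Metric.diam (planeBox I J) ≤ dist p q) ∧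
  (∃ p ∈ planeBox I J, ∃ q ∈ planeLine a b, dist p q ≤ A * Metric.diam (planeBox I J))

/-- `Q` is adapted to the region `R_a` given by `a_1 x_1 < … < a_d x_d` and
`|a_1 x_1 - a_2 x_2| ∼ … ∼ |a_{d-1} x_{d-1} - a_d x_d|`: this is a condition on the pairs
`(Q_j, Q_{j+1})` of consecutive factors. -/
def Adapted [LinearOrder ι] (A : ℝ) (a : ι → ℝ) (Q : DyadicBox ι) : Prop :=
  ∀ i j, i ⋖ j → PairAdapted A (a i) (a j) (Q i) (Q j)

/-- The volume of `c Q`. -/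
def volume [Fintype ι] (c : ℝ) (Q : DyadicBox ι) : ℝ := ∏ i, c * (Q i).length

/-- The set `c Q`. -/
def dilate (c : ℝ) (Q : DyadicBox ι) : Set (ι → ℝ) := {x | ∀ i, x i ∈ (Q i).dilate c}

/-- Sparse families of quasi-cubes, with constant `c`. -/
def Sparse [Fintype ι] (c : ℝ) (F : Set (DyadicBox ι)) : Prop :=
  ∀ Q ∈ F, ∀ Q' ∈ F, Q ≠ Q' →
    (Q.volume 1 < Q'.volume 1 → Q.volume c < Q'.volume 1) ∧
    (Q.volume 1 = Q'.volume 1 → Disjoint (Q.dilate c) (Q'.dilate c))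

end DyadicBox

/-! Bumps and symbols -/

/-- `φ` is a bump function adapted to `c I`: it is smooth, vanishes off `c I`, and its `l`-th
derivative is at most `B l * |c I|⁻ˡ`. -/
def IsBump (B : ℕ → ℝ) (c : ℝ) (I : ShiftedDyadic) (φ : ℝ → ℂ) : Prop :=
  ContDiff ℝ ∞ φ ∧ (∀ x, x ∉ I.dilate c → φ x = 0) ∧
    ∀ (l : ℕ) (x : ℝ), ‖iteratedDeriv l φ x‖ ≤ B l * ((c * I.length) ^ l)⁻¹

/-- Rapidly decreasing sequences: smaller than every power. (A countable index set is enumerated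
by `ℕ`, and a finite one is completed by zeros.) -/
def RapidlyDecreasing (C : ℕ → ℂ) : Prop :=
  ∀ N : ℕ, ∃ D : ℝ, ∀ ν : ℕ, ‖C ν‖ * ((ν : ℝ) + 1) ^ N ≤ D

/-- The expression `∑_Q ∏_i Φ_{Q,i}(x_i)`, the sum being over the members `Q` of the family `F` to
which `scale` gives the value `k`. -/
def vertexSymbol {ι : Type} [Fintype ι] (F : Set (DyadicBox ι)) (scale : DyadicBox ι → ℤ)
    (Φ : DyadicBox ι → ι → ℝ → ℂ) (k : ℤ) (x : ι → ℝ) : ℂ :=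
  ∑ᶠ Q ∈ {Q | Q ∈ F ∧ scale Q = k}, ∏ i, Φ Q i (x i)

namespace PlaneTree

variable {n : ℕ}

/-- `S_G`: one integer for each non-leaf vertex, such that `k_u ≫ k_v` (that is, `k_u ≥ k_v + K`)
if `v` is a son of `u`. -/
def scaleTuples (G : PlaneTree n) (K : ℕ) : Set (G.inner → ℤ) :=
  {k | ∀ u v : G.inner, v.1 ∈ G.sons u.1 → k v + (K : ℤ) ≤ k u}

/-- The vector `(1 / |I_{u_1}|, …, 1 / |I_{u_#}|)`. -/
def weight (G : PlaneTree n) (u : Finset (Fin n)) (w : G.Son u) : ℝ := 1 / (w.1.card : ℝ)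

/-- The vector `(∑_{l ∈ I_{u_1}} ξ_l, …, ∑_{l ∈ I_{u_#}} ξ_l)`. -/
def sonSums (G : PlaneTree n) (u : Finset (Fin n)) (ξ : Fin n → ℝ) (w : G.Son u) : ℝ :=
  ∑ l ∈ w.1, ξ l

/-- `m` is a standard symbol of type `G`:
`m = ∑_ν C_ν ∑_{k ∈ S_G} ∏_{u ∈ V_G} m_{u,ν}^{k_u}`, where `C` is rapidly decreasing and
`m_{u,ν}^k` is a sum of tensor products of bumps over quasi-cubes `Q` with `l(Q) ∼ 2^k` that are
adapted to the region of the vertex `u`.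

`A` is the constant in all relations `∼` and `2^K` is the constant in `≫`; they, and the bounds `B`
for the bumps, are the same for all `ν`, `u`, `k`, `Q`. The constant in `≫` is large compared to the
one in `∼`: the function `κ` says how large. The families of quasi-cubes are sparse with
constant `c` (this is no condition if `c = 0`). -/
def IsStandardSymbol (G : PlaneTree n) (κ : ℝ → ℕ) (c : ℝ) (m : (Fin n → ℝ) → ℂ) : Prop :=
  ∃ (A : ℝ) (K : ℕ) (B : ℕ → ℝ) (C : ℕ → ℂ)
    (F : ℕ → (u : G.inner) → Set (DyadicBox (G.Son u.1)))
    (scale : ℕ → (u : G.inner) → DyadicBox (G.Son u.1) → ℤ)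
    (Φ : ℕ → (u : G.inner) → DyadicBox (G.Son u.1) → G.Son u.1 → ℝ → ℂ),
    1 ≤ A ∧ κ A ≤ K ∧ RapidlyDecreasing C ∧
    (∀ ν u, DyadicBox.Sparse c (F ν u)) ∧
    (∀ ν u, ∀ Q ∈ F ν u, Q.IsQuasiCube A ∧ Q.Adapted A (G.weight u.1) ∧
      Q.HasScale A (scale ν u Q) ∧ ∀ i, IsBump B (9 / 10) (Q i) (Φ ν u Q i)) ∧
    ∀ ξ : Fin n → ℝ,
      HasSum (fun ν => C ν * ∑ᶠ k ∈ G.scaleTuples K,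
        ∏ u, vertexSymbol (F ν u) (scale ν u) (Φ ν u) (k u) (G.sonSums u.1 ξ)) (m ξ)

end PlaneTree

end

/-! Everything rests on one estimate, `Located.pairEst`. At a point where a summand of a symbol of
type G with scales (k_u) does not vanish, |ξ_i - ξ_j| is comparable to 2^{k_u} whenever i and j lie
below different sons of u. Indeed the bumps separate the averages over the sons of u by about
2^{k_u}, and the separation of scales makes the cluster below each son much narrower than that. So
the tree describes the clusters of the coordinates of ξ, and the scales are their diameters.

Products. Let A₁ ≤ A₂. Where both symbols are active, both trees describe the same point. As 2^{K₂}
is large compared with A₂, and hence with A₁, every vertex of G₂ is a vertex of G₁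
(`verts_subset_of_pairEst`); otherwise the product vanishes. It has type G₂. The scale of a vertex
of G₁ differs by a bounded amount δ from the scale of its hull in G₂ (`scales_close`), so there are
finitely many δ to consider. For each of them the conditions on both tuples of scales either are
contradictory or say that a boundedly shifted tuple is admissible for G₂ with separation max(K₁, K₂)
(`exists_scale_shift`). On a box of G₂ the factors coming from G₁ are smooth at the scale of the
box. A Fourier series turns them into a rapidly convergent sum of tensor products
(`UnifExp.comp_linear`), which the bumps absorb (`std_of_unifExp`). The new constant depends on n
and A₂ but not on K₁, K₂, and therefore κ can be chosen in advance.

The indicator function. For each G there is a model symbol X_G which is 1 where the vertices of G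
are well separated clusters (`model_eq_one`) and which vanishes unless the coordinates increase
(`Std.strictMono_of_ne_zero`). A pigeonhole argument over a sequence of thresholds shows that at
each increasing point some X_G equals 1 (`exists_clustered`). Hence the indicator function is 1 -
∏(1 - X_G) = ∑_G X_G ∏_{G' < G} (1 - X_{G'}). The trees are ordered so that the constants A do not
decrease. In each term X_G then has the largest constant, and by the rule for products the term has
type G (`Std.mul_prod_one_sub`). -/

noncomputable section

/-! ### Combinatorics of trees: sons, hulls, parents -/

namespace PlaneTree

variable {n : ℕ}

theorem mem_sons {G : PlaneTree n} {u w : Finset (Fin n)} :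
    w ∈ G.sons u ↔ w ∈ G.verts ∧ w ⊂ u ∧ ∀ w' ∈ G.verts, w ⊂ w' → ¬ w' ⊂ u := by
  simp [sons]

theorem mem_inner {G : PlaneTree n} {u : Finset (Fin n)} :
    u ∈ G.inner ↔ u ∈ G.verts ∧ 1 < u.card := by
  simp [inner]

theorem inner_mem_verts {G : PlaneTree n} (u : G.inner) : u.1 ∈ G.verts := (mem_inner.1 u.2).1

theorem nonempty_of_mem {G : PlaneTree n} {u : Finset (Fin n)} (hu : u ∈ G.verts) :
    u.Nonempty := by
  obtain ⟨l, r, hlr, rfl⟩ := G.interval u hu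
  exact Finset.nonempty_Icc.2 hlr

theorem exists_son_of_ssubset {G : PlaneTree n} {u v : Finset (Fin n)} (hv : v ∈ G.verts)
    (h : v ⊂ u) : ∃ w ∈ G.sons u, v ⊆ w := by
  classical
  obtain ⟨w, hvw, hw⟩ := Finset.exists_le_maximal (G.verts.filter fun w => w ⊂ u)
    (Finset.mem_filter.2 ⟨hv, h⟩)
  have hw1 := Finset.mem_filter.1 hw.1
  refine ⟨w, mem_sons.2 ⟨hw1.1, hw1.2, fun w' hw' hlt hu => ?_⟩, hvw⟩
  exact hlt.2 (hw.2 (Finset.mem_filter.2 ⟨hw', hu⟩) hlt.1)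

theorem exists_son_of_mem {G : PlaneTree n} {u : Finset (Fin n)} (hu : u ∈ G.inner) {i : Fin n}
    (hi : i ∈ u) : ∃ w : G.Son u, i ∈ w.1 := by
  have h : {i} ⊂ u := by
    refine Finset.ssubset_iff_subset_ne.2 ⟨by simpa using hi, fun h => ?_⟩
    have := (mem_inner.1 hu).2
    rw [← h] at this
    simp at this
  obtain ⟨w, hw, hiw⟩ := exists_son_of_ssubset (G.leaf_mem i) h
  exact ⟨⟨w, hw⟩, by simpa using hiw⟩

theorem Son.mem_verts {G : PlaneTree n} {u : Finset (Fin n)} (w : G.Son u) : w.1 ∈ G.verts :=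
  (mem_sons.1 w.2).1

theorem Son.ssubset {G : PlaneTree n} {u : Finset (Fin n)} (w : G.Son u) : w.1 ⊂ u :=
  (mem_sons.1 w.2).2.1

theorem Son.eq_of_mem {G : PlaneTree n} {u : Finset (Fin n)} {w w' : G.Son u} {i : Fin n}
    (h : i ∈ w.1) (h' : i ∈ w'.1) : w = w' := by
  by_contra hne
  have hne' : w.1 ≠ w'.1 := fun h => hne (Subtype.ext h)
  rcases G.laminar w.1 w.mem_verts w'.1 w'.mem_verts with hs | hs | hs
  · exact (mem_sons.1 w.2).2.2 _ w'.mem_verts (hs.ssubset_of_ne hne') w'.ssubset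
  · exact (mem_sons.1 w'.2).2.2 _ w.mem_verts (hs.ssubset_of_ne hne'.symm) w.ssubset
  · exact Finset.disjoint_left.1 hs h h'

theorem Son.lt_def {G : PlaneTree n} {u : Finset (Fin n)} {w w' : G.Son u} :
    w < w' ↔ w.left < w'.left := Iff.rfl

theorem Son.left_le {G : PlaneTree n} {u : Finset (Fin n)} {w : G.Son u} {i : Fin n}
    (h : i ∈ w.1) : w.left ≤ i := Finset.min'_le _ _ h

theorem Son.left_mem {G : PlaneTree n} {u : Finset (Fin n)} (w : G.Son u) : w.left ∈ w.1 :=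
  Finset.min'_mem _ _

/-- Vertices are intervals. If j ≤ i, the leftmost leaf of w' would lie between the leftmost leaf of
w and i, hence in w, but distinct sons are disjoint. -/
theorem Son.lt_of_lt {G : PlaneTree n} {u : Finset (Fin n)} {w w' : G.Son u} (h : w < w')
    {i j : Fin n} (hi : i ∈ w.1) (hj : j ∈ w'.1) : i < j := by
  by_contra hij
  push Not at hij
  obtain ⟨l, r, hlr, hw⟩ := G.interval w.1 w.mem_verts
  have h1 : w'.left ∈ w.1 := by
    have hi' := hi
    have hl := w.left_mem
    rw [hw, Finset.mem_Icc] at hi' hl ⊢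
    exact ⟨hl.1.trans (Son.lt_def.1 h).le, ((Son.left_le hj).trans hij).trans hi'.2⟩
  exact h.ne (Son.eq_of_mem h1 w'.left_mem)

theorem Son.lt_of_mem_lt {G : PlaneTree n} {u : Finset (Fin n)} {w w' : G.Son u} (hne : w ≠ w')
    {i j : Fin n} (hi : i ∈ w.1) (hj : j ∈ w'.1) (h : i < j) : w < w' := by
  rcases lt_trichotomy w w' with h1 | h1 | h1
  · exact h1
  · exact absurd h1 hne
  · exact absurd (Son.lt_of_lt h1 hj hi) h.not_gt

theorem card_son_le (G : PlaneTree n) (u : Finset (Fin n)) : Fintype.card (G.Son u) ≤ n := by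
  simpa using Fintype.card_le_of_injective _ (Son.left_injective (G := G) (u := u))

theorem son_nontrivial {G : PlaneTree n} {u : Finset (Fin n)} (hu : u ∈ G.inner) :
    Nontrivial (G.Son u) := by
  obtain ⟨i, hi⟩ := nonempty_of_mem (mem_inner.1 hu).1
  obtain ⟨w, hw⟩ := exists_son_of_mem hu hi
  obtain ⟨j, hj, hjw⟩ := Finset.exists_of_ssubset w.ssubset
  obtain ⟨w', hw'⟩ := exists_son_of_mem hu hj
  exact ⟨w, w', fun h => hjw (h ▸ hw')⟩

instance (G : PlaneTree n) (u : G.inner) : Nontrivial (G.Son u.1) := son_nontrivial u.2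

instance (G : PlaneTree n) (u : Finset (Fin n)) : DecidableEq (G.Son u) := Classical.decEq _

theorem exists_lt_of_inner {G : PlaneTree n} (u : G.inner) :
    ∃ (w w' : G.Son u.1) (i j : Fin n), w < w' ∧ i ∈ w.1 ∧ j ∈ w'.1 ∧ i < j := by
  obtain ⟨w, w', h⟩ := exists_pair_lt (G.Son u.1)
  exact ⟨w, w', _, _, h, w.left_mem, w'.left_mem, Son.lt_def.1 h⟩

/-- Two vertices with a common descendant are comparable. -/
theorem comparable {G : PlaneTree n} {u v : Finset (Fin n)} (hu : u ∈ G.verts) (hv : v ∈ G.verts)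
    {i : Fin n} (hiu : i ∈ u) (hiv : i ∈ v) : u ⊆ v ∨ v ⊆ u := by
  rcases G.laminar u hu v hv with h | h | h
  · exact Or.inl h
  · exact Or.inr h
  · exact absurd hiv (Finset.disjoint_left.1 h hiu)

/-- The vertices above S share a leaf, so laminarity makes them a chain; one of minimal cardinality
is the least. -/
theorem exists_least (G : PlaneTree n) {S : Finset (Fin n)} (hS : S.Nonempty) :
    ∃ v ∈ G.verts, S ⊆ v ∧ ∀ v' ∈ G.verts, S ⊆ v' → v ⊆ v' := by
  classical
  obtain ⟨v, hv, hmin⟩ := Finset.exists_min_image (G.verts.filter fun v => S ⊆ v) Finset.card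
    ⟨Finset.univ, Finset.mem_filter.2 ⟨G.root_mem, Finset.subset_univ _⟩⟩
  obtain ⟨hv1, hv2⟩ := Finset.mem_filter.1 hv
  obtain ⟨i, hi⟩ := hS
  refine ⟨v, hv1, hv2, fun v' hv' h => ?_⟩
  rcases comparable hv1 hv' (hv2 hi) (h hi) with h1 | h1
  · exact h1
  · exact (Finset.eq_of_subset_of_card_le h1 (hmin v' (Finset.mem_filter.2 ⟨hv', h⟩))).symm.subset

/-- The smallest vertex of `G` above a set of leaves. -/
def hull (G : PlaneTree n) (S : Finset (Fin n)) : Finset (Fin n) :=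
  if h : S.Nonempty then (G.exists_least h).choose else ∅

theorem hull_spec (G : PlaneTree n) {S : Finset (Fin n)} (hS : S.Nonempty) :
    G.hull S ∈ G.verts ∧ S ⊆ G.hull S ∧ ∀ v' ∈ G.verts, S ⊆ v' → G.hull S ⊆ v' := by
  rw [hull, dif_pos hS]
  exact (G.exists_least hS).choose_spec

theorem hull_mem_inner (G : PlaneTree n) {S : Finset (Fin n)} (hS : 1 < S.card) :
    G.hull S ∈ G.inner := by
  have h := G.hull_spec (S := S) (Finset.card_pos.1 (by omega))
  exact mem_inner.2 ⟨h.1, hS.trans_le (Finset.card_le_card h.2.1)⟩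

/-- A set of leaves is not below a single son of its hull. -/
theorem exists_sons_of_hull (G : PlaneTree n) {S : Finset (Fin n)} (hS : 1 < S.card) :
    ∃ (w w' : G.Son (G.hull S)) (i j : Fin n), w < w' ∧ i ∈ w.1 ∧ j ∈ w'.1 ∧ i ∈ S ∧ j ∈ S
      ∧ i < j := by
  have hne : S.Nonempty := Finset.card_pos.1 (by omega)
  have h := G.hull_spec hne
  have hin := G.hull_mem_inner hS
  obtain ⟨i, hi⟩ := hne
  obtain ⟨w, hw⟩ := exists_son_of_mem hin (h.2.1 hi)
  have : ¬ S ⊆ w.1 := fun hs => w.ssubset.2 (h.2.2 _ w.mem_verts hs)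
  obtain ⟨j, hj, hjw⟩ := Finset.not_subset.1 this
  obtain ⟨w', hw'⟩ := exists_son_of_mem hin (h.2.1 hj)
  have hww : w ≠ w' := fun e => hjw (e ▸ hw')
  rcases lt_trichotomy i j with hij | hij | hij
  · exact ⟨w, w', i, j, Son.lt_of_mem_lt hww hw hw' hij, hw, hw', hi, hj, hij⟩
  · exact absurd (hij ▸ hw) hjw
  · exact ⟨w', w, j, i, Son.lt_of_mem_lt hww.symm hw' hw hij, hw', hw, hj, hi, hij⟩

/-- Two vertices with a common son are equal. -/
theorem eq_of_common_son {G : PlaneTree n} {u u' v : Finset (Fin n)} (hu : u ∈ G.verts)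
    (hu' : u' ∈ G.verts) (h : v ∈ G.sons u) (h' : v ∈ G.sons u') : u = u' := by
  by_contra hne
  have hv := mem_sons.1 h
  have hv' := mem_sons.1 h'
  obtain ⟨i, hi⟩ := nonempty_of_mem hv.1
  rcases comparable hu hu' (hv.2.1.1 hi) (hv'.2.1.1 hi) with h1 | h1
  · exact hv'.2.2 u hu hv.2.1 (h1.ssubset_of_ne hne)
  · exact hv.2.2 u' hu' hv'.2.1 (h1.ssubset_of_ne (Ne.symm hne))

theorem exists_parent {G : PlaneTree n} {v : Finset (Fin n)} (hv : v ∈ G.verts)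
    (h : v ≠ Finset.univ) : ∃ u : G.inner, v ∈ G.sons u.1 := by
  classical
  obtain ⟨u, hu, hmin⟩ := Finset.exists_min_image (G.verts.filter fun u => v ⊂ u) Finset.card
    ⟨Finset.univ, Finset.mem_filter.2 ⟨G.root_mem, (Finset.subset_univ _).ssubset_of_ne h⟩⟩
  obtain ⟨hu1, hu2⟩ := Finset.mem_filter.1 hu
  have hc := Finset.card_lt_card hu2
  have hp := (nonempty_of_mem hv).card_pos
  refine ⟨⟨u, mem_inner.2 ⟨hu1, by omega⟩⟩, mem_sons.2 ⟨hv, hu2, fun w hw hvw hwu => ?_⟩⟩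
  exact absurd (hmin w (Finset.mem_filter.2 ⟨hw, hvw⟩)) (not_le.2 (Finset.card_lt_card hwu))

theorem son_ne_univ {G : PlaneTree n} {u v : Finset (Fin n)} (h : v ∈ G.sons u) :
    v ≠ Finset.univ := by
  rintro rfl
  exact (mem_sons.1 h).2.1.2 (Finset.subset_univ _)

open Classical in
/-- The vertex of which `v` is a son. -/
def parent (G : PlaneTree n) (v : G.inner) : G.inner :=
  -- The root is not a son of anything and gets itself as a default value.
  if h : ∃ u : G.inner, v.1 ∈ G.sons u.1 then h.choose else v

theorem parent_eq {G : PlaneTree n} {u v : G.inner} (h : v.1 ∈ G.sons u.1) : G.parent v = u := by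
  have hex : ∃ u : G.inner, v.1 ∈ G.sons u.1 := ⟨u, h⟩
  rw [parent, dif_pos hex]
  exact Subtype.ext (eq_of_common_son (inner_mem_verts _) (inner_mem_verts _) hex.choose_spec h)

theorem mem_sons_parent {G : PlaneTree n} {v : G.inner} (h : v.1 ≠ Finset.univ) :
    v.1 ∈ G.sons (G.parent v).1 := by
  obtain ⟨u, hu⟩ := exists_parent (inner_mem_verts v) h
  rwa [parent_eq hu]

/-- The scales of an admissible tuple increase by at least `K` from a vertex to any ancestor. -/
theorem scaleTuples_of_ssubset {G : PlaneTree n} {K : ℕ} {k : G.inner → ℤ}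
    (hk : k ∈ G.scaleTuples K) (u v : G.inner) (h : u.1 ⊂ v.1) : k u + K ≤ k v := by
  obtain ⟨m, hm⟩ : ∃ m, v.1.card = m := ⟨_, rfl⟩
  induction m using Nat.strong_induction_on generalizing v with
  | _ m ih =>
    obtain ⟨w, hw, huw⟩ := exists_son_of_ssubset (inner_mem_verts u) h
    have hws := mem_sons.1 hw
    have hwi : w ∈ G.inner :=
      mem_inner.2 ⟨hws.1, (mem_inner.1 u.2).2.trans_le (Finset.card_le_card huw)⟩
    have h1 := hk v ⟨w, hwi⟩ hw
    by_cases he : u.1 = w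
    · have : u = ⟨w, hwi⟩ := Subtype.ext he
      rwa [this]
    · have := ih w.card (hm ▸ Finset.card_lt_card hws.2.1) ⟨w, hwi⟩ (huw.ssubset_of_ne he) rfl
      have : (0 : ℤ) ≤ K := by positivity
      omega

/-! Refinements: `G₂` arises from `G₁` by removing vertices -/

section Refine

variable {G₁ G₂ : PlaneTree n}

/-- The smallest vertex of a coarser tree above a vertex of a finer tree. -/
def coarsen (G₁ G₂ : PlaneTree n) (u : G₁.inner) : G₂.inner :=
  ⟨G₂.hull u.1, G₂.hull_mem_inner (mem_inner.1 u.2).2⟩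

theorem coarsen_spec (u : G₁.inner) : u.1 ⊆ (coarsen G₁ G₂ u).1 ∧
    ∀ v ∈ G₂.verts, u.1 ⊆ v → (coarsen G₁ G₂ u).1 ⊆ v :=
  (G₂.hull_spec (nonempty_of_mem (inner_mem_verts u))).2

theorem coarsen_of_mem {u : G₁.inner} (h : u.1 ∈ G₂.verts) : (coarsen G₁ G₂ u).1 = u.1 :=
  (coarsen_spec u).2 _ h subset_rfl |>.antisymm (coarsen_spec u).1

/-- Under passage to the coarser tree an edge of the finer one is either contracted or mapped to an
edge. The second case occurs exactly when the lower end survives: a missing v has the same hull as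
its parent, because a hull strictly between them would be a vertex of the finer tree. -/
theorem coarsen_eq_or_mem (hG : G₂.verts ⊆ G₁.verts) {u v : G₁.inner} (h : v.1 ∈ G₁.sons u.1) :
    coarsen G₁ G₂ v = coarsen G₁ G₂ u ∨
      v.1 ∈ G₂.verts ∧ (coarsen G₁ G₂ v).1 = v.1 ∧ v.1 ∈ G₂.sons (coarsen G₁ G₂ u).1 := by
  have hs := mem_sons.1 h
  obtain ⟨i, hi⟩ := nonempty_of_mem hs.1
  by_cases hv : v.1 ∈ G₂.verts
  · refine Or.inr ⟨hv, coarsen_of_mem hv, mem_sons.2 ⟨hv, ?_, fun w hw hvw hwu => ?_⟩⟩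
    · exact hs.2.1.trans_subset (coarsen_spec u).1
    · rcases comparable (inner_mem_verts u) (hG hw) (hs.2.1.1 hi) (hvw.1 hi) with h1 | h1
      · exact hwu.2 ((coarsen_spec u).2 _ hw h1)
      · refine hs.2.2 w (hG hw) hvw (h1.ssubset_of_ne ?_)
        rintro rfl
        exact hwu.2 ((coarsen_spec u).2 _ hw subset_rfl)
  · left
    apply Subtype.ext
    have hp := inner_mem_verts (coarsen G₁ G₂ v)
    apply subset_antisymm
    · exact (coarsen_spec v).2 _ (inner_mem_verts _) (hs.2.1.1.trans (coarsen_spec u).1)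
    · apply (coarsen_spec u).2 _ hp
      have h2 := (coarsen_spec (G₂ := G₂) v).1
      rcases comparable (inner_mem_verts u) (hG hp) (hs.2.1.1 hi) (h2 hi) with h1 | h1
      · exact h1
      · by_cases he : (coarsen G₁ G₂ v).1 = u.1
        · exact he.symm.subset
        · refine absurd (h1.ssubset_of_ne he) (hs.2.2 _ (hG hp) (h2.ssubset_of_ne ?_))
          intro h3
          exact hv (h3 ▸ hp)

/-- The sons of a vertex of the finer tree are unions of sons of its hull in the coarser tree. -/
theorem son_subset_of_mem (hG : G₂.verts ⊆ G₁.verts) {u : G₁.inner} {i : G₁.Son u.1}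
    {s : G₂.Son (coarsen G₁ G₂ u).1} {l : Fin n} (hi : l ∈ i.1) (hs : l ∈ s.1) : s.1 ⊆ i.1 := by
  have hu : l ∈ u.1 := i.ssubset.1 hi
  rcases comparable (hG s.mem_verts) i.mem_verts hs hi with h | h
  · exact h
  · by_cases he : i.1 = s.1
    · exact he.symm.subset
    have hlt := h.ssubset_of_ne he
    rcases comparable (hG s.mem_verts) (inner_mem_verts u) hs hu with h1 | h1
    · by_cases hsu : s.1 = u.1
      · have := (coarsen_spec u).2 _ s.mem_verts hsu.symm.subset
        exact absurd this s.ssubset.2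
      · exact absurd (h1.ssubset_of_ne hsu) ((mem_sons.1 i.2).2.2 _ (hG s.mem_verts) hlt)
    · exact absurd ((coarsen_spec u).2 _ s.mem_verts h1) s.ssubset.2

open Classical in
/-- The coefficients that express the sums over the sons of a vertex of the finer tree by those
over the sons of its hull. -/
def groupCoeff (G₁ G₂ : PlaneTree n) (u : G₁.inner) (w : G₂.inner) (i : G₁.Son u.1)
    (s : G₂.Son w.1) : ℝ := if s.1 ⊆ i.1 then 1 else 0

/-- This makes the arguments of the bumps of the finer tree linear forms, with coefficients 0 and 1,
in the variables of a single vertex of the coarser tree. -/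
theorem sonSums_coarsen (hG : G₂.verts ⊆ G₁.verts) (u : G₁.inner) (ξ : Fin n → ℝ)
    (i : G₁.Son u.1) : G₁.sonSums u.1 ξ i =
      ∑ s, groupCoeff G₁ G₂ u (coarsen G₁ G₂ u) i s * G₂.sonSums (coarsen G₁ G₂ u).1 ξ s := by
  classical
  simp only [groupCoeff, sonSums, ite_mul, one_mul, zero_mul]
  rw [← Finset.sum_filter, ← Finset.sum_biUnion]
  · refine Finset.sum_congr (Finset.ext fun l => ?_) fun _ _ => rfl
    simp only [Finset.mem_biUnion, Finset.mem_filter, Finset.mem_univ, true_and]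
    constructor
    · intro hl
      obtain ⟨s, hs⟩ := exists_son_of_mem (coarsen G₁ G₂ u).2
        ((coarsen_spec u).1 (i.ssubset.1 hl))
      exact ⟨s, son_subset_of_mem hG hl hs, hs⟩
    · rintro ⟨s, hs, hl⟩
      exact hs hl
  · intro w _ w' _ hne
    exact Finset.disjoint_left.2 fun i hi hi' => hne (Son.eq_of_mem hi hi')

end Refine

end PlaneTree
end

/-! ### Smooth functions of a given scale and their Fourier expansion -/

noncomputable section

/-- `f` is smooth and its `l`-th derivative is at most `B l * T⁻ˡ`. -/
def SmoothBdd (B : ℕ → ℝ) (T : ℝ) (f : ℝ → ℂ) : Prop :=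
  ContDiff ℝ ∞ f ∧ ∀ (l : ℕ) (x : ℝ), ‖iteratedDeriv l f x‖ ≤ B l * (T ^ l)⁻¹

namespace SmoothBdd

variable {B B' : ℕ → ℝ} {T T' : ℝ} {f g : ℝ → ℂ}

theorem mono (hf : SmoothBdd B T f) (hT : 0 ≤ T) (h : ∀ l, B l ≤ B' l) : SmoothBdd B' T f :=
  ⟨hf.1, fun l x => (hf.2 l x).trans (mul_le_mul_of_nonneg_right (h l) (by positivity))⟩

/-- The loss `r ^ l` does not depend on the function, so comparable scales can be exchanged
uniformly in a whole family. -/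
theorem rescale (hf : SmoothBdd B T f) (hT : 0 < T) (hT' : 0 < T') {r : ℝ} (h : T' ≤ r * T) :
    SmoothBdd (fun l => |B l| * r ^ l) T' f := by
  refine ⟨hf.1, fun l x => (hf.2 l x).trans ?_⟩
  rw [mul_assoc]
  refine (mul_le_mul_of_nonneg_right (le_abs_self _) (by positivity)).trans ?_
  refine mul_le_mul_of_nonneg_left ?_ (abs_nonneg _)
  rw [← div_eq_mul_inv, inv_eq_one_div, div_le_div_iff₀ (by positivity) (by positivity), one_mul,
    ← mul_pow]
  exact pow_le_pow_left₀ hT'.le h l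

theorem mul (hf : SmoothBdd B T f) (hg : SmoothBdd B' T g) (hT : 0 < T) :
    SmoothBdd (fun l => ∑ i ∈ Finset.range (l + 1), l.choose i * B i * B' (l - i)) T
      (fun x => f x * g x) := by
  refine ⟨hf.1.mul hg.1, fun l x => ?_⟩
  rw [iteratedDeriv_fun_mul (hf.1.of_le (mod_cast le_top)).contDiffAt
    (hg.1.of_le (mod_cast le_top)).contDiffAt, Finset.sum_mul]
  refine (norm_sum_le _ _).trans (Finset.sum_le_sum fun i hi => ?_)
  have hi' : i ≤ l := Nat.lt_succ_iff.1 (Finset.mem_range.1 hi)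
  rw [norm_mul, norm_mul, Complex.norm_natCast]
  have h1 := hf.2 i x
  have h2 := hg.2 (l - i) x
  have h3 : 0 ≤ B i * (T ^ i)⁻¹ := (norm_nonneg _).trans h1
  calc (l.choose i : ℝ) * ‖iteratedDeriv i f x‖ * ‖iteratedDeriv (l - i) g x‖
      ≤ (l.choose i : ℝ) * (B i * (T ^ i)⁻¹) * (B' (l - i) * (T ^ (l - i))⁻¹) := by gcongr
    _ = l.choose i * B i * B' (l - i) * (T ^ l)⁻¹ := by
      rw [← Nat.add_sub_cancel' hi', pow_add, Nat.add_sub_cancel' hi']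
      field_simp

theorem const (a : ℂ) (T : ℝ) : SmoothBdd (fun l => if l = 0 then ‖a‖ else 0) T (fun _ => a) := by
  refine ⟨contDiff_const, fun l x => ?_⟩
  rw [iteratedDeriv_const]
  by_cases h : l = 0 <;> simp [h]

theorem const_mul (hf : SmoothBdd B T f) (a : ℂ) :
    SmoothBdd (fun l => ‖a‖ * B l) T (fun x => a * f x) := by
  refine ⟨contDiff_const.mul hf.1, fun l x => ?_⟩
  rw [iteratedDeriv_const_mul_field, norm_mul, mul_assoc]
  exact mul_le_mul_of_nonneg_left (hf.2 l x) (norm_nonneg _)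

theorem comp_affine (hf : SmoothBdd B T f) (hT : 0 < T) (p : ℝ) {a : ℝ} (ha : 0 < a) :
    SmoothBdd B (T / a) (fun x => f (p + a * x)) := by
  have hg : ContDiff ℝ ∞ fun x => f (p + x) := hf.1.comp (contDiff_const.add contDiff_id)
  refine ⟨hg.comp (contDiff_const.mul contDiff_id), fun l x => ?_⟩
  have := congrFun (iteratedDeriv_comp_const_smul (n := l) (f := fun x => f (p + x))
    (hg.of_le (mod_cast le_top)) a) x
  rw [this, iteratedDeriv_comp_const_add, norm_smul, Real.norm_of_nonneg (by positivity)]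
  calc a ^ l * ‖iteratedDeriv l f (p + a * x)‖ ≤ a ^ l * (B l * (T ^ l)⁻¹) := by
        gcongr; exact hf.2 _ _
    _ = B l * ((T / a) ^ l)⁻¹ := by rw [div_pow]; field_simp

theorem exp (θ : ℝ) : SmoothBdd (fun l => |θ| ^ l) 1
    (fun x : ℝ => Complex.exp (Complex.I * θ * x)) := by
  have h : ∀ l : ℕ, iteratedDeriv l (fun x : ℝ => Complex.exp (Complex.I * θ * x)) =
      fun x : ℝ => (Complex.I * θ) ^ l * Complex.exp (Complex.I * θ * x) := by
    intro l
    induction l with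
    | zero => simp
    | succ l ih =>
      rw [iteratedDeriv_succ, ih]
      funext x
      have h1 : HasDerivAt (fun x : ℝ => Complex.I * θ * (x : ℂ)) (Complex.I * θ) x := by
        simpa using (Complex.ofRealCLM.hasDerivAt (x := x)).const_mul (Complex.I * (θ : ℂ))
      rw [(h1.cexp.const_mul _).deriv]
      ring
  refine ⟨?_, fun l x => ?_⟩
  · exact (contDiff_const.mul Complex.ofRealCLM.contDiff).cexp
  · rw [h, norm_mul, norm_pow, norm_mul, Complex.norm_I, one_mul, Complex.norm_real]
    have : Complex.I * θ * x = ((θ * x : ℝ) : ℂ) * Complex.I := by push_cast; ring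
    rw [this, Complex.norm_exp_ofReal_mul_I]
    simp

/-- Compactly supported smooth functions. -/
theorem exists_of_hasCompactSupport (hf : ContDiff ℝ ∞ f) (hc : HasCompactSupport f) :
    ∃ B, SmoothBdd B 1 f := by
  have : ∀ l : ℕ, ∃ b : ℝ, ∀ x, ‖iteratedDeriv l f x‖ ≤ b := by
    intro l
    obtain ⟨b, hb⟩ := (hc.iteratedFDeriv (𝕜 := ℝ) l).exists_bound_of_continuous
      (hf.continuous_iteratedFDeriv (by exact_mod_cast le_top))
    exact ⟨b, fun x => by rw [← norm_iteratedFDeriv_eq_norm_iteratedDeriv]; exact hb x⟩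
  choose B hB using this
  exact ⟨B, hf, fun l x => by simpa using hB l x⟩

end SmoothBdd

open FourierTransform in
/-- Fourier expansion of a smooth function on a window. -/
theorem exists_fourier_window (B : ℕ → ℝ) : ∃ D : ℕ → ℝ, ∀ f : ℝ → ℂ, SmoothBdd B 1 f →
    ∃ c : ℤ → ℂ, (∀ (m : ℤ) (N : ℕ), ‖c m‖ * (|(m : ℝ)| + 1) ^ N ≤ D N) ∧
      ∀ t : ℝ, |t| ≤ 1 / 4 →
        HasSum (fun m : ℤ => c m * Complex.exp (2 * Real.pi * Complex.I * m * t)) (f t) := by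
  -- The cut-off is 1 on the window |t| ≤ 1/4 and vanishes for |t| ≥ 3/8. Since 1 - 1/4 ≥ 3/8, its
  -- translates by non-zero integers do not reach the window.
  let cut : ContDiffBump (0 : ℝ) := ⟨1 / 4, 3 / 8, by norm_num, by norm_num⟩
  let w : ℝ → ℂ := fun x => (cut x : ℂ)
  have hw : ContDiff ℝ ∞ w := Complex.ofRealCLM.contDiff.comp cut.contDiff
  have hw0 : ∀ x, 3 / 8 ≤ |x| → w x = 0 := fun x hx => by
    have : cut x = 0 := cut.zero_of_le_dist (by simpa [Real.dist_eq, cut] using hx)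
    simp [w, this]
  have hw1 : ∀ x, |x| ≤ 1 / 4 → w x = 1 := fun x hx => by
    have : cut x = 1 := cut.one_of_mem_closedBall (by simpa [Real.dist_eq, cut] using hx)
    simp [w, this]
  have hwc : HasCompactSupport w := by
    refine HasCompactSupport.intro (K := Set.Icc (-1) 1) isCompact_Icc fun x hx => hw0 x ?_
    by_contra hlt
    rw [not_le, abs_lt] at hlt
    exact hx ⟨by linarith, by linarith⟩
  obtain ⟨Bw, hBw⟩ := SmoothBdd.exists_of_hasCompactSupport hw hwc
  let B' : ℕ → ℝ := fun l => ∑ i ∈ Finset.range (l + 1), l.choose i * B i * Bw (l - i)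
  -- The bound involves only `B` and the fixed cut-off: `B' 0` and `B' N` control the L¹ norms of `f
  -- w` and of its `N`-th derivative, and (|m| + 1)^N ≤ 2^N (1 + |2πm|^N).
  refine ⟨fun N => 2 ^ N * (B' 0 + B' N), fun f hf => ?_⟩
  let h : ℝ → ℂ := fun x => f x * w x
  have hh : SmoothBdd B' 1 h := hf.mul hBw one_pos
  have hsup : Function.support h ⊆ Set.Icc (-(1 / 2)) (1 / 2) := by
    intro x hx
    by_contra hcon
    apply hx
    change f x * w x = 0
    rw [hw0 x, mul_zero]
    by_contra hlt
    rw [not_le, abs_lt] at hlt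
    exact hcon ⟨by linarith, by linarith⟩
  have htsup : tsupport h ⊆ Set.Icc (-(1 / 2)) (1 / 2) := closure_minimal hsup isClosed_Icc
  have hhc : HasCompactSupport h := HasCompactSupport.of_support_subset_isCompact isCompact_Icc hsup
  have hd0 : ∀ (l : ℕ) (x : ℝ), x ∉ Set.Icc (-(1 / 2) : ℝ) (1 / 2) → iteratedDeriv l h x = 0 := by
    intro l x hx
    rw [← norm_eq_zero, ← norm_iteratedFDeriv_eq_norm_iteratedDeriv, norm_eq_zero]
    by_contra hne
    exact hx (htsup (support_iteratedFDeriv_subset l hne))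
  have hint : ∀ l : ℕ, MeasureTheory.Integrable (iteratedDeriv l h) := by
    intro l
    refine Continuous.integrable_of_hasCompactSupport
      (hh.1.continuous_iteratedDeriv l (by exact_mod_cast le_top)) ?_
    exact HasCompactSupport.intro isCompact_Icc (hd0 l)
  have hI : ∀ l : ℕ, ∫ x, ‖iteratedDeriv l h x‖ ≤ B' l := by
    intro l
    rw [← MeasureTheory.setIntegral_eq_integral_of_forall_compl_eq_zero
      (s := Set.Icc (-(1 / 2) : ℝ) (1 / 2)) (fun x hx => by rw [hd0 l x hx, norm_zero])]
    have := MeasureTheory.norm_setIntegral_le_of_norm_le_const (μ := MeasureTheory.volume)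
      (s := Set.Icc (-(1 / 2) : ℝ) (1 / 2)) (f := fun x => ‖iteratedDeriv l h x‖) (C := B' l)
      (by simp) (fun x _ => by simpa using hh.2 l x)
    refine (le_abs_self _).trans (this.trans ?_)
    rw [Real.volume_real_Icc]
    norm_num
  have hF : ∀ (l : ℕ) (m : ℝ), |2 * Real.pi * m| ^ l * ‖𝓕 h m‖ ≤ B' l := by
    intro l m
    have h1 := congrFun (Real.fourier_iteratedDeriv (f := h) (N := ⊤) (n := l)
      (by simpa using hh.1) (fun l _ => hint l) le_top) m
    have h2 : ‖𝓕 (iteratedDeriv l h) m‖ ≤ ∫ x, ‖iteratedDeriv l h x‖ :=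
      VectorFourier.norm_fourierIntegral_le_integral_norm _ _ _ _ _
    rw [h1, norm_smul, norm_pow] at h2
    refine le_trans (le_of_eq ?_) (h2.trans (hI l))
    congr 2
    simp [abs_mul]
  have hdec : ∀ (m : ℤ) (N : ℕ), ‖𝓕 h (m : ℝ)‖ * (|(m : ℝ)| + 1) ^ N ≤ 2 ^ N * (B' 0 + B' N) := by
    intro m N
    have h0 := hF 0 m
    have hN := hF N m
    rw [pow_zero, one_mul] at h0
    have hpi : |(m : ℝ)| ≤ |2 * Real.pi * m| := by
      rw [abs_mul]
      refine le_mul_of_one_le_left (abs_nonneg _) ?_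
      rw [abs_of_pos (by positivity)]
      linarith [Real.pi_gt_three]
    have h3 : (|(m : ℝ)| + 1) ^ N ≤ 2 ^ N * (1 + |2 * Real.pi * m| ^ N) := by
      have hx := abs_nonneg (2 * Real.pi * (m : ℝ))
      rcases le_total (|(m : ℝ)|) 1 with h1 | h1
      · calc (|(m : ℝ)| + 1) ^ N ≤ 2 ^ N := by gcongr; linarith
          _ ≤ _ := le_mul_of_one_le_right (by positivity) (by linarith [pow_nonneg hx N])
      · calc (|(m : ℝ)| + 1) ^ N ≤ (2 * |2 * Real.pi * m|) ^ N := by gcongr; linarith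
          _ = 2 ^ N * |2 * Real.pi * m| ^ N := mul_pow _ _ _
          _ ≤ _ := by gcongr; linarith
    calc ‖𝓕 h (m : ℝ)‖ * (|(m : ℝ)| + 1) ^ N
        ≤ ‖𝓕 h (m : ℝ)‖ * (2 ^ N * (1 + |2 * Real.pi * m| ^ N)) := by gcongr
      _ = 2 ^ N * (‖𝓕 h (m : ℝ)‖ + |2 * Real.pi * m| ^ N * ‖𝓕 h (m : ℝ)‖) := by ring
      _ ≤ _ := by gcongr
  refine ⟨fun m => 𝓕 h (m : ℝ), hdec, fun t ht => ?_⟩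
  have hsum : Summable fun m : ℤ => 𝓕 h (m : ℝ) * Complex.exp (2 * Real.pi * Complex.I * m * t) := by
    refine Summable.of_norm_bounded_eventually
      (g := fun m : ℤ => (2 ^ 2 * (B' 0 + B' 2)) * |(m : ℝ)| ^ (-2 : ℝ)) ?_ ?_
    · exact (Real.summable_abs_int_rpow (by norm_num)).mul_left _
    · have : ({0} : Set ℤ)ᶜ ∈ Filter.cofinite := (Set.finite_singleton 0).compl_mem_cofinite
      filter_upwards [this] with m hm
      have hm' : 0 < |(m : ℝ)| := abs_pos.2 (by exact_mod_cast hm)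
      have : (2 * Real.pi * Complex.I * m * t : ℂ) = ((2 * Real.pi * m * t : ℝ) : ℂ) * Complex.I := by
        push_cast; ring
      rw [norm_mul, this, Complex.norm_exp_ofReal_mul_I, mul_one, Real.rpow_neg hm'.le,
        ← div_eq_mul_inv, le_div_iff₀ (by positivity)]
      refine le_trans ?_ (hdec m 2)
      gcongr
      rw [show (2 : ℝ) = ((2 : ℕ) : ℝ) by norm_num, Real.rpow_natCast]
      gcongr
      linarith
  -- Poisson summation; on the window only the translate by 0 contributes to the periodization.
  have hP := SchwartzMap.tsum_eq_tsum_fourier (hhc.toSchwartzMap hh.1) t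
  have hl : ∑' n : ℤ, (hhc.toSchwartzMap hh.1) (t + n) = f t := by
    rw [tsum_eq_single 0]
    · change f (t + (0 : ℤ)) * w (t + (0 : ℤ)) = f t
      simp [hw1 t ht]
    · intro n hn
      change f (t + n) * w (t + n) = 0
      rw [hw0, mul_zero]
      have h1 : (1 : ℝ) ≤ |(n : ℝ)| := by exact_mod_cast Int.one_le_abs hn
      have h2 : |(n : ℝ)| ≤ |t + n| + |t| := by
        calc |(n : ℝ)| = |(t + n) - t| := by ring_nf
          _ ≤ _ := abs_sub _ _
      linarith
  rw [hl] at hP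
  rw [hP]
  convert hsum.hasSum using 1
  refine tsum_congr fun m => ?_
  rw [fourier_coe_apply]
  have : (𝓕 (hhc.toSchwartzMap hh.1)) (m : ℝ) = 𝓕 h (m : ℝ) := by
    rw [SchwartzMap.fourier_coe]; rfl
  rw [this]
  simp
end

/-! ### Rapidly decreasing coefficients and uniform expansions into tensor products -/

noncomputable section

namespace RapidlyDecreasing

variable {C C' : ℕ → ℂ}

theorem summable_norm (h : RapidlyDecreasing C) : Summable fun ν => ‖C ν‖ := by
  obtain ⟨D, hD⟩ := h 2
  refine Summable.of_nonneg_of_le (fun ν => norm_nonneg _) (fun ν => ?_)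
    (((summable_nat_add_iff 1).2 (Real.summable_one_div_nat_pow.2 one_lt_two)).mul_left D)
  have := hD ν
  push_cast
  rw [mul_one_div, le_div_iff₀ (by positivity)]
  exact this

/-- The common form of the constructions below. -/
theorem of_le {ι : Type*} {E : ι → ℕ → ℝ} (F : Finset ι) (e : ι → ℕ → ℕ) {P : ℕ}
    (hE : ∀ i ∈ F, ∀ N, ∃ D, ∀ ν, E i ν * ((ν : ℝ) + 1) ^ N ≤ D) (hE0 : ∀ i ν, 0 ≤ E i ν)
    (h : ∀ ν, ∃ i ∈ F, ‖C ν‖ ≤ E i (e i ν) ∧ (ν : ℝ) + 1 ≤ (2 * ((e i ν : ℝ) + 1)) ^ P) :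
    RapidlyDecreasing C := by
  classical
  intro N
  choose! D hD using hE
  refine ⟨∑ i ∈ F, 2 ^ (P * N) * |D i (P * N)|, fun ν => ?_⟩
  obtain ⟨i, hi, h1, h2⟩ := h ν
  have h3 := hD i hi (P * N) (e i ν)
  calc ‖C ν‖ * ((ν : ℝ) + 1) ^ N ≤ E i (e i ν) * ((2 * ((e i ν : ℝ) + 1)) ^ P) ^ N := by
        gcongr
        exact hE0 _ _
    _ = 2 ^ (P * N) * (E i (e i ν) * ((e i ν : ℝ) + 1) ^ (P * N)) := by
        rw [← pow_mul, mul_pow]; ring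
    _ ≤ 2 ^ (P * N) * |D i (P * N)| := by
        gcongr
        exact h3.trans (le_abs_self _)
    _ ≤ _ := Finset.single_le_sum (f := fun i => (2 : ℝ) ^ (P * N) * |D i (P * N)|)
        (fun i _ => by positivity) hi

theorem zero : RapidlyDecreasing fun _ => 0 := fun N => ⟨0, fun ν => by simp⟩

theorem const_mul (h : RapidlyDecreasing C) (a : ℂ) : RapidlyDecreasing fun ν => a * C ν := by
  intro N
  obtain ⟨D, hD⟩ := h N
  refine ⟨‖a‖ * D, fun ν => ?_⟩
  rw [norm_mul, mul_assoc]
  exact mul_le_mul_of_nonneg_left (hD ν) (norm_nonneg _)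

theorem single : RapidlyDecreasing fun ν => if ν = 0 then 1 else 0 := by
  intro N
  refine ⟨1, fun ν => ?_⟩
  by_cases h : ν = 0 <;> simp [h]

/-- The code ν of a pair (a, b) satisfies ν + 1 ≤ ((a + 1)(b + 1))², so decay of order 2N in each
index gives decay of order N in ν. -/
theorem pair (h : RapidlyDecreasing C) (h' : RapidlyDecreasing C') :
    RapidlyDecreasing fun ν => C ν.unpair.1 * C' ν.unpair.2 := by
  intro N
  obtain ⟨D, hD⟩ := h (2 * N)
  obtain ⟨D', hD'⟩ := h' (2 * N)
  refine ⟨D * D', fun ν => ?_⟩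
  have h1 := hD ν.unpair.1
  have h2 := hD' ν.unpair.2
  set a := ν.unpair.1
  set b := ν.unpair.2
  have h3 : (ν : ℝ) + 1 ≤ (((a : ℝ) + 1) * ((b : ℝ) + 1)) ^ 2 := by
    have : ν + 1 ≤ ((a + 1) * (b + 1)) ^ 2 := by
      have h4 := Nat.pair_lt_max_add_one_sq a b
      rw [Nat.pair_unpair] at h4
      refine h4.trans_le (Nat.pow_le_pow_left ?_ 2)
      rcases max_cases a b with ⟨h, _⟩ | ⟨h, _⟩ <;> rw [h] <;> nlinarith
    exact_mod_cast this
  have h5 : 0 ≤ ‖C a‖ * ((a : ℝ) + 1) ^ (2 * N) := by positivity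
  calc ‖C a * C' b‖ * ((ν : ℝ) + 1) ^ N
      ≤ ‖C a * C' b‖ * ((((a : ℝ) + 1) * ((b : ℝ) + 1)) ^ 2) ^ N := by gcongr
    _ = (‖C a‖ * ((a : ℝ) + 1) ^ (2 * N)) * (‖C' b‖ * ((b : ℝ) + 1) ^ (2 * N)) := by
        rw [norm_mul, ← pow_mul, mul_pow]; ring
    _ ≤ D * D' := mul_le_mul h1 h2 (by positivity) (h5.trans h1)

/-- Interleaving two sequences. -/
theorem interleave (h : RapidlyDecreasing C) (h' : RapidlyDecreasing C') :
    RapidlyDecreasing fun ν => if ν % 2 = 0 then C (ν / 2) else C' (ν / 2) := by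
  refine of_le (P := 1) (E := fun (b : Bool) ν => if b then ‖C ν‖ else ‖C' ν‖) Finset.univ
    (fun _ ν => ν / 2) ?_ ?_ fun ν => ?_
  · intro b _ N
    cases b
    · simpa using h' N
    · simpa using h N
  · intro b ν
    cases b <;> simp
  · have h1 : (ν : ℝ) + 1 ≤ 2 * (((ν / 2 : ℕ) : ℝ) + 1) := by
      have : ν + 1 ≤ 2 * (ν / 2 + 1) := by omega
      exact_mod_cast this
    by_cases h : ν % 2 = 0
    · exact ⟨true, Finset.mem_univ _, by simp [h], by simpa using h1⟩
    · exact ⟨false, Finset.mem_univ _, by simp [h], by simpa using h1⟩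

end RapidlyDecreasing

/-- A majorant for all sequences that satisfy given decay estimates. -/
theorem exists_rapid_majorant (D : ℕ → ℝ) {p : ℕ} (hp : 0 < p) : ∃ ρ : ℤ → ℝ, (∀ m, 0 ≤ ρ m) ∧
    (∀ N : ℕ, ∃ E, ∀ m : ℤ, ρ m * (|(m : ℝ)| + 1) ^ N ≤ E) ∧
    ∀ (m : ℤ) (z : ℂ), (∀ N : ℕ, ‖z‖ * (|(m : ℝ)| + 1) ^ N ≤ D N) → ‖z‖ ≤ ρ m ^ p := by
  -- The infimum is the best bound that all the `D N` give together. Its `p`-th root still decays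
  -- faster than any power; the root is taken so that the majorant can later be distributed over `p`
  -- factors.
  let b : ℤ → ℝ := fun m => ⨅ N : ℕ, |D N| / (|(m : ℝ)| + 1) ^ N
  have hb0 : ∀ m, 0 ≤ b m := fun m => Real.iInf_nonneg fun N => by positivity
  have hb : ∀ m (N : ℕ), b m ≤ |D N| / (|(m : ℝ)| + 1) ^ N := fun m N =>
    ciInf_le ⟨0, by rintro _ ⟨N, rfl⟩; positivity⟩ N
  have hρ : ∀ m, (b m ^ (1 / p : ℝ)) ^ p = b m := fun m => by
    rw [one_div, Real.rpow_inv_natCast_pow (hb0 m) hp.ne']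
  refine ⟨fun m => b m ^ (1 / p : ℝ), fun m => Real.rpow_nonneg (hb0 m) _, fun N => ?_, ?_⟩
  · refine ⟨max 1 |D (N * p)|, fun m => ?_⟩
    set y := b m ^ (1 / p : ℝ) * (|(m : ℝ)| + 1) ^ N
    rcases le_total y 1 with h | h
    · exact h.trans (le_max_left _ _)
    · refine le_trans (le_self_pow₀ h hp.ne') (le_trans ?_ (le_max_right _ _))
      rw [mul_pow, hρ, ← pow_mul]
      have := hb m (N * p)
      rwa [le_div_iff₀ (by positivity)] at this
  · intro m z hz
    rw [hρ]
    refine le_ciInf fun N => ?_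
    rw [le_div_iff₀ (by positivity)]
    exact (hz N).trans (le_abs_self _)

theorem hasSum_unpair_mul {f g : ℕ → ℂ} {a b : ℂ} (hf : HasSum f a) (hg : HasSum g b) :
    HasSum (fun ν : ℕ => f ν.unpair.1 * g ν.unpair.2) (a * b) := by
  have h := hf.mul hg (summable_mul_of_summable_norm hf.summable.norm hg.summable.norm)
  rw [← Nat.pairEquiv.symm.hasSum_iff] at h
  exact h

/-- A family `H_q` of functions of several variables that can be expanded, on the sets `R_q`, into a
rapidly converging series of tensor products of functions that are smooth at the scale `T_q`,
uniformly in `q`. -/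
def UnifExp {S 𝓠 : Type} [Fintype S] (T : 𝓠 → ℝ) (R : 𝓠 → Set (S → ℝ)) (H : 𝓠 → (S → ℝ) → ℂ) :
    Prop :=
  ∃ (B : ℕ → ℝ) (C : ℕ → ℂ) (e : 𝓠 → ℕ → S → ℝ → ℂ), RapidlyDecreasing C ∧
    (∀ q ν s, SmoothBdd B (T q) (e q ν s)) ∧
    ∀ q, ∀ x ∈ R q, HasSum (fun ν => C ν * ∏ s, e q ν s (x s)) (H q x)

namespace UnifExp

variable {S 𝓠 𝓠' : Type} [Fintype S] {T : 𝓠 → ℝ} {R : 𝓠 → Set (S → ℝ)}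
  {H H' : 𝓠 → (S → ℝ) → ℂ}

theorem congr (h : UnifExp T R H) (h' : ∀ q, ∀ x ∈ R q, H q x = H' q x) : UnifExp T R H' := by
  obtain ⟨B, C, e, hC, he, hs⟩ := h
  exact ⟨B, C, e, hC, he, fun q x hx => h' q x hx ▸ hs q x hx⟩

theorem comap (h : UnifExp T R H) (g : 𝓠' → 𝓠) :
    UnifExp (fun q => T (g q)) (fun q => R (g q)) (fun q => H (g q)) := by
  obtain ⟨B, C, e, hC, he, hs⟩ := h
  exact ⟨B, C, fun q => e (g q), hC, fun q => he (g q), fun q => hs (g q)⟩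

theorem zero (T : 𝓠 → ℝ) (R : 𝓠 → Set (S → ℝ)) : UnifExp T R fun _ _ => 0 :=
  ⟨_, fun _ => 0, fun _ _ _ _ => 0, RapidlyDecreasing.zero, fun q _ _ => SmoothBdd.const 0 (T q),
    fun q x _ => by simp⟩

theorem one (T : 𝓠 → ℝ) (R : 𝓠 → Set (S → ℝ)) : UnifExp T R fun _ _ => 1 := by
  refine ⟨_, fun ν => if ν = 0 then 1 else 0, fun _ _ _ _ => 1, RapidlyDecreasing.single,
    fun q _ _ => SmoothBdd.const 1 (T q), fun q x _ => ?_⟩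
  simpa using hasSum_ite_eq (0 : ℕ) (1 : ℂ)

theorem mul (hT : ∀ q, 0 < T q) (h : UnifExp T R H) (h' : UnifExp T R H') :
    UnifExp T R fun q x => H q x * H' q x := by
  obtain ⟨B, C, e, hC, he, hs⟩ := h
  obtain ⟨B', C', e', hC', he', hs'⟩ := h'
  refine ⟨fun l => ∑ i ∈ Finset.range (l + 1), l.choose i * B i * B' (l - i),
    fun ν => C ν.unpair.1 * C' ν.unpair.2,
    fun q ν s y => e q ν.unpair.1 s y * e' q ν.unpair.2 s y, hC.pair hC', ?_, ?_⟩
  · intro q ν s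
    exact (he q ν.unpair.1 s).mul (he' q ν.unpair.2 s) (hT q)
  · intro q x hx
    have h1 := hasSum_unpair_mul (hs q x hx) (hs' q x hx)
    simp only [Finset.prod_mul_distrib]
    simpa only [mul_mul_mul_comm] using h1

theorem prod {ι : Type*} (F : Finset ι) {H : ι → 𝓠 → (S → ℝ) → ℂ} (hT : ∀ q, 0 < T q)
    (h : ∀ i ∈ F, UnifExp T R (H i)) : UnifExp T R fun q x => ∏ i ∈ F, H i q x := by
  classical
  induction F using Finset.induction_on with
  | empty => simpa using one T R
  | insert a F ha ih =>
    simp only [Finset.prod_insert ha]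
    exact mul hT (h a (Finset.mem_insert_self _ _))
      (ih fun i hi => h i (Finset.mem_insert_of_mem hi))

theorem add (hT : ∀ q, 0 < T q) (h : UnifExp T R H) (h' : UnifExp T R H') :
    UnifExp T R fun q x => H q x + H' q x := by
  obtain ⟨B, C, e, hC, he, hs⟩ := h
  obtain ⟨B', C', e', hC', he', hs'⟩ := h'
  refine ⟨fun l => max (B l) (B' l), _,
    fun q ν => if ν % 2 = 0 then e q (ν / 2) else e' q (ν / 2),
    hC.interleave hC', fun q ν s => ?_, fun q x hx => ?_⟩
  · by_cases hν : ν % 2 = 0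
    · simpa [hν] using (he q (ν / 2) s).mono (hT q).le fun l => le_max_left _ _
    · simpa [hν] using (he' q (ν / 2) s).mono (hT q).le fun l => le_max_right _ _
  · refine HasSum.even_add_odd ?_ ?_
    · simpa using hs q x hx
    · have h1 : ∀ k : ℕ, (2 * k + 1) / 2 = k := fun k => by omega
      have h2 : ∀ k : ℕ, (2 * k + 1) % 2 = 1 := fun k => by omega
      simpa [h1, h2] using hs' q x hx

theorem sum {ι : Type*} (F : Finset ι) {H : ι → 𝓠 → (S → ℝ) → ℂ} (hT : ∀ q, 0 < T q)
    (h : ∀ i ∈ F, UnifExp T R (H i)) : UnifExp T R fun q x => ∑ i ∈ F, H i q x := by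
  classical
  induction F using Finset.induction_on with
  | empty => simpa using zero T R
  | insert a F ha ih =>
    simp only [Finset.sum_insert ha]
    exact add hT (h a (Finset.mem_insert_self _ _))
      (ih fun i hi => h i (Finset.mem_insert_of_mem hi))

/-- A function of one linear form has a Fourier series on the window |y - p| ≤ r T, and the
exponential of a linear form is a product of exponentials in the single variables. The `l`-th
derivative of such an exponential costs |m|^l. To keep the bounds uniform in m, the coefficient is
dominated by `ρ m ^ (card S + 1)`: every variable receives one factor `ρ m`, which absorbs the
powers of m, and the last one serves as the coefficient of the series. -/
theorem comp_linear [Nonempty S] (hT : ∀ q, 0 < T q) {f : 𝓠 → ℝ → ℂ} {B : ℕ → ℝ}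
    (hf : ∀ q, SmoothBdd B (T q) (f q)) (a : S → ℝ) (p : 𝓠 → ℝ) {r : ℝ} (hr : 0 < r)
    (hR : ∀ q, ∀ x ∈ R q, |∑ s, a s * x s - p q| ≤ r * T q) :
    UnifExp T R fun q x => f q (∑ s, a s * x s) := by
  classical
  obtain ⟨s₀⟩ := ‹Nonempty S›
  obtain ⟨D, hD⟩ := exists_fourier_window (fun l => |B l| * (4 * r) ^ l)
  have hg : ∀ q, SmoothBdd (fun l => |B l| * (4 * r) ^ l) 1
      (fun t => f q (p q + 4 * r * T q * t)) := fun q => by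
    have hpos : 0 < 4 * r * T q := by have := hT q; positivity
    refine ((hf q).comp_affine (hT q) (p q) hpos).rescale (by have := hT q; positivity) one_pos
      (le_of_eq ?_)
    have := (hT q).ne'
    field_simp
  choose c hc hs using fun q => hD _ (hg q)
  obtain ⟨ρ, hρ0, hρ, hρc⟩ := exists_rapid_majorant D (p := Fintype.card S + 1) (Nat.succ_pos _)
  have hcρ : ∀ q m, ‖c q m‖ ≤ ρ m ^ (Fintype.card S + 1) := fun q m => hρc m _ (hc q m)
  let θ : 𝓠 → ℤ → ℝ → ℝ := fun q m y => 2 * Real.pi * m * y / (4 * r * T q)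
  -- The Fourier coefficients depend on `q`, whereas those of the final expansion must not. The
  -- quotient, of modulus at most 1, and the phase coming from the centre go into the factor of one
  -- chosen variable `s₀`. If `ρ m = 0`, the coefficient vanishes too and division by zero does no
  -- harm.
  let κ : 𝓠 → ℤ → ℂ := fun q m =>
    c q m / (ρ m : ℂ) ^ (Fintype.card S + 1) * Complex.exp (Complex.I * θ q m (-p q))
  have hκ : ∀ q m, ‖κ q m‖ ≤ 1 := fun q m => by
    have h1 : Complex.I * (θ q m (-p q) : ℂ) = (θ q m (-p q) : ℂ) * Complex.I := mul_comm _ _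
    rw [norm_mul, h1, Complex.norm_exp_ofReal_mul_I, mul_one, norm_div, norm_pow,
      Complex.norm_real, Real.norm_of_nonneg (hρ0 m)]
    exact div_le_one_of_le₀ (hcρ q m) (pow_nonneg (hρ0 m) _)
  let e : 𝓠 → ℤ → S → ℝ → ℂ := fun q m s y =>
    ((if s = s₀ then κ q m else 1) * ρ m) * Complex.exp (Complex.I * (θ q m (a s)) * y)
  choose E hE using hρ
  have hA : ∀ s, |a s| ≤ ∑ s, |a s| := fun s =>
    Finset.single_le_sum (f := fun s => |a s|) (fun _ _ => abs_nonneg _) (Finset.mem_univ s)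
  have he : ∀ q m s, SmoothBdd (fun l => |E l| * (2 * Real.pi * (∑ s, |a s|) / (4 * r)) ^ l)
      (T q) (e q m s) := by
    intro q m s
    have hTq := hT q
    have h1 := (SmoothBdd.exp (θ q m (a s))).const_mul ((if s = s₀ then κ q m else 1) * ρ m)
    refine ⟨h1.1, fun l x => (h1.2 l x).trans ?_⟩
    rw [one_pow, inv_one, mul_one, norm_mul, Complex.norm_real, Real.norm_of_nonneg (hρ0 m)]
    have h2 : ‖(if s = s₀ then κ q m else 1 : ℂ)‖ ≤ 1 := by
      split_ifs
      · exact hκ q m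
      · simp
    have h3 : |θ q m (a s)| ≤ (|(m : ℝ)| + 1) * (2 * Real.pi * (∑ s, |a s|) / (4 * r)) * (T q)⁻¹ := by
      have : |θ q m (a s)| = |(m : ℝ)| * (2 * Real.pi * |a s| / (4 * r)) * (T q)⁻¹ := by
        simp only [θ]
        rw [abs_div, abs_mul, abs_mul, abs_of_pos (show 0 < 2 * Real.pi by positivity),
          abs_of_pos (show 0 < 4 * r * T q by positivity)]
        field_simp
      rw [this]
      gcongr
      · linarith
      · exact hA s
    calc ‖(if s = s₀ then κ q m else 1 : ℂ)‖ * ρ m * |θ q m (a s)| ^ l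
        ≤ 1 * ρ m * ((|(m : ℝ)| + 1) * (2 * Real.pi * (∑ s, |a s|) / (4 * r)) * (T q)⁻¹) ^ l := by
          have := hρ0 m
          gcongr
      _ = (ρ m * (|(m : ℝ)| + 1) ^ l) * (2 * Real.pi * (∑ s, |a s|) / (4 * r)) ^ l * (T q ^ l)⁻¹ := by
          rw [mul_pow, mul_pow, inv_pow]; ring
      _ ≤ _ := by
          refine mul_le_mul_of_nonneg_right (mul_le_mul_of_nonneg_right ?_ ?_) (by positivity)
          · exact (hE l m).trans (le_abs_self _)
          · have : 0 ≤ ∑ s, |a s| := Finset.sum_nonneg fun _ _ => abs_nonneg _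
            positivity
  have hsum : ∀ q, ∀ x ∈ R q, HasSum (fun m : ℤ => (ρ m : ℂ) * ∏ s, e q m s (x s))
      (f q (∑ s, a s * x s)) := by
    intro q x hx
    have hTq := hT q
    have h4 : 0 < 4 * r * T q := by positivity
    have h1 := hs q ((∑ s, a s * x s - p q) / (4 * r * T q)) (by
      rw [abs_div, abs_of_pos h4, div_le_div_iff₀ h4 (by norm_num)]
      linarith [hR q x hx])
    have h2 : p q + 4 * r * T q * ((∑ s, a s * x s - p q) / (4 * r * T q)) = ∑ s, a s * x s := by
      rw [mul_div_cancel₀ _ h4.ne']; ring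
    rw [h2] at h1
    convert h1 using 1
    funext m
    simp only [e]
    rw [Finset.prod_mul_distrib, Finset.prod_mul_distrib, Finset.prod_ite_eq',
      if_pos (Finset.mem_univ _), Finset.prod_const, Finset.card_univ, ← Complex.exp_sum]
    simp only [κ]
    have h5 : (ρ m : ℂ) * (c q m / (ρ m : ℂ) ^ (Fintype.card S + 1) *
        Complex.exp (Complex.I * θ q m (-p q)) * (ρ m : ℂ) ^ (Fintype.card S) *
        Complex.exp (∑ s, Complex.I * θ q m (a s) * x s)) =
        (c q m / (ρ m : ℂ) ^ (Fintype.card S + 1) * (ρ m : ℂ) ^ (Fintype.card S + 1)) *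
        Complex.exp (Complex.I * θ q m (-p q) + ∑ s, Complex.I * θ q m (a s) * x s) := by
      rw [Complex.exp_add]; ring
    rw [h5]
    congr 1
    · by_cases h0 : ρ m = 0
      · have := hcρ q m
        rw [h0, zero_pow (Nat.succ_ne_zero _), norm_le_zero_iff] at this
        simp [this]
      · rw [div_mul_cancel₀]
        exact pow_ne_zero _ (by exact_mod_cast h0)
    · congr 1
      have h6 : ∑ s, Complex.I * θ q m (a s) * x s = Complex.I * θ q m (∑ s, a s * x s) := by
        simp only [θ]
        push_cast
        rw [Finset.mul_sum, Finset.sum_div, Finset.mul_sum]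
        exact Finset.sum_congr rfl fun s _ => by ring
      rw [h6]
      simp only [θ]
      push_cast
      ring
  -- The enumeration of ℤ gives m a number ν with ν + 1 ≤ 2(|m| + 1), so rapid decrease in m carries
  -- over to ν.
  refine ⟨_, fun ν => (ρ (Equiv.intEquivNat.symm ν) : ℂ),
    fun q ν => e q (Equiv.intEquivNat.symm ν), ?_, fun q ν s => he q _ s, fun q x hx => ?_⟩
  · refine RapidlyDecreasing.of_le (P := 1) (E := fun (_ : Unit) k => ρ (k : ℤ) + ρ (-(k : ℤ)))
      Finset.univ (fun _ ν => (Equiv.intEquivNat.symm ν).natAbs) ?_ ?_ fun ν =>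
      ⟨(), Finset.mem_univ _, ?_, ?_⟩
    · intro _ _ N
      refine ⟨E N + E N, fun ν => ?_⟩
      have h1 := hE N (ν : ℤ)
      have h2 := hE N (-(ν : ℤ))
      push_cast at h1 h2
      rw [abs_neg] at h2
      rw [abs_of_nonneg (Nat.cast_nonneg _)] at h1 h2
      rw [add_mul]
      exact add_le_add h1 h2
    · exact fun _ ν => add_nonneg (hρ0 _) (hρ0 _)
    · rw [Complex.norm_real, Real.norm_of_nonneg (hρ0 _)]
      rcases Int.natAbs_eq (Equiv.intEquivNat.symm ν) with h | h
      · rw [← h]; linarith [hρ0 (-(Equiv.intEquivNat.symm ν))]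
      · rw [← h]
        linarith [hρ0 ((Equiv.intEquivNat.symm ν).natAbs : ℤ)]
    · obtain ⟨m, rfl⟩ := Equiv.intEquivNat.surjective ν
      rw [Equiv.symm_apply_apply, pow_one]
      have : Equiv.intEquivNat m + 1 ≤ 2 * (m.natAbs + 1) := by
        rcases m with m | m
        · change 2 * m + 1 ≤ 2 * (m + 1); omega
        · change 2 * m + 1 + 1 ≤ 2 * ((m + 1) + 1); omega
      exact_mod_cast this
  · have := hsum q x hx
    rw [← Equiv.intEquivNat.symm.hasSum_iff] at this
    exact this

/-- The sums of the series are uniformly bounded. -/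
theorem bounded (h : UnifExp T R H) : ∃ b : ℝ, ∀ q, ∀ x ∈ R q, ‖H q x‖ ≤ b := by
  obtain ⟨B, C, e, hC, he, hs⟩ := h
  refine ⟨∑' ν, ‖C ν‖ * ∏ _s : S, B 0, fun q x hx => ?_⟩
  rw [← (hs q x hx).tsum_eq]
  refine tsum_of_norm_bounded (hC.summable_norm.mul_right _).hasSum fun ν => ?_
  rw [norm_mul, norm_prod]
  refine mul_le_mul_of_nonneg_left ?_ (norm_nonneg _)
  exact Finset.prod_le_prod (fun _ _ => norm_nonneg _) fun s _ => by simpa using (he q ν s).2 0 (x s)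

end UnifExp
end

/-! ### Geometry of shifted dyadic intervals and adapted boxes -/

noncomputable section

namespace ShiftedDyadic

theorem length_pos (I : ShiftedDyadic) : 0 < I.length := by
  unfold length; positivity

theorem dilate_subset (I : ShiftedDyadic) : I.dilate (9 / 10) ⊆ I.toSet := by
  intro x hx
  have := I.length_pos
  simp only [dilate, center, Set.mem_Ioo, toSet] at hx ⊢
  constructor <;> linarith [hx.1, hx.2]

theorem abs_sub_le {I : ShiftedDyadic} {x y : ℝ} (hx : x ∈ I.toSet) (hy : y ∈ I.toSet) :
    |x - y| ≤ I.length := by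
  simp only [toSet, Set.mem_Ioo] at hx hy
  rw [abs_le]
  constructor <;> linarith [hx.1, hx.2, hy.1, hy.2]

theorem abs_pos_sub_le {I : ShiftedDyadic} {y : ℝ} (hy : y ∈ I.toSet) :
    |(I.pos : ℝ) - y / (2 : ℝ) ^ I.scale| ≤ 2 := by
  have h0 : (0 : ℝ) < 2 ^ I.scale := by positivity
  have hs : |(-1 : ℝ) ^ I.scale * ((I.shift : ℕ) / 3 : ℝ)| ≤ 2 / 3 := by
    rw [abs_mul, abs_neg_one_zpow, one_mul, abs_of_nonneg (by positivity)]
    have : ((I.shift : ℕ) : ℝ) ≤ 2 := by exact_mod_cast Nat.lt_succ_iff.1 I.shift.2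
    linarith
  simp only [toSet, left, length, Set.mem_Ioo] at hy
  rw [abs_le] at hs ⊢
  have h1 : (I.pos : ℝ) + (-1 : ℝ) ^ I.scale * ((I.shift : ℕ) / 3 : ℝ) < y / 2 ^ I.scale := by
    rw [lt_div_iff₀ h0, mul_comm]; exact hy.1
  have h2 : y / 2 ^ I.scale < (I.pos : ℝ) + (-1 : ℝ) ^ I.scale * ((I.shift : ℕ) / 3 : ℝ) + 1 := by
    rw [div_lt_iff₀ h0]; linarith [hy.2]
  constructor <;> linarith [hs.1, hs.2]

theorem ext' {I J : ShiftedDyadic} (h1 : I.scale = J.scale) (h2 : I.pos = J.pos)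
    (h3 : I.shift = J.shift) : I = J := by
  cases I; cases J; simp_all

/-- The bounds for the length leave finitely many scales; for each scale the position is within 2 of
y divided by the length. -/
theorem finite_of_mem {l₀ : ℝ} (h₀ : 0 < l₀) (l₁ y : ℝ) :
    {I : ShiftedDyadic | l₀ ≤ I.length ∧ I.length ≤ l₁ ∧ y ∈ I.toSet}.Finite := by
  obtain ⟨s₀, hs₀⟩ := exists_nat_gt (l₀⁻¹)
  obtain ⟨s₁, hs₁⟩ := exists_nat_gt l₁
  obtain ⟨t, ht⟩ := exists_nat_gt (|y| / l₀ + 2)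
  refine ((Set.finite_Icc (-(s₀ : ℤ)) s₁).prod ((Set.finite_Icc (-(t : ℤ)) t).prod
    (Set.finite_univ (α := Fin 3))) |>.image
    fun z : ℤ × ℤ × Fin 3 => (⟨z.1, z.2.1, z.2.2⟩ : ShiftedDyadic)).subset ?_
  rintro I ⟨h1, h2, h3⟩
  refine ⟨(I.scale, I.pos, I.shift), ⟨⟨?_, ?_⟩, ⟨?_, ?_⟩, trivial⟩, rfl⟩
  · by_contra hcon
    push Not at hcon
    have h4 : I.length ≤ (2 : ℝ) ^ (-(s₀ : ℤ)) := zpow_le_zpow_right₀ (by norm_num) hcon.le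
    rw [zpow_neg, zpow_natCast] at h4
    have h5 : (s₀ : ℝ) < 2 ^ s₀ := by exact_mod_cast Nat.lt_two_pow_self
    have h6 : ((2 : ℝ) ^ s₀)⁻¹ < l₀ := by
      rw [inv_lt_comm₀ (by positivity) h₀]; linarith
    linarith
  · by_contra hcon
    push Not at hcon
    have h4 : (2 : ℝ) ^ (s₁ : ℤ) ≤ I.length := zpow_le_zpow_right₀ (by norm_num) hcon.le
    rw [zpow_natCast] at h4
    have h5 : (s₁ : ℝ) < 2 ^ s₁ := by exact_mod_cast Nat.lt_two_pow_self
    linarith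
  all_goals
    have h4 := abs_pos_sub_le h3
    have h5 : |y / 2 ^ I.scale| ≤ |y| / l₀ := by
      rw [abs_div, abs_of_pos (show (0 : ℝ) < 2 ^ I.scale by positivity)]
      exact div_le_div_of_nonneg_left (abs_nonneg _) h₀ h1
    have h6 : |(I.pos : ℝ)| < t := by
      have := abs_sub_abs_le_abs_sub (I.pos : ℝ) (y / 2 ^ I.scale)
      linarith
    rw [abs_lt] at h6
  · exact_mod_cast h6.1.le
  · exact_mod_cast h6.2.le

/-- Boundedly many shifted dyadic intervals of a given size meet a given interval of comparable
size. -/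
theorem exists_relative_bound {A : ℝ} (hA : 1 ≤ A) {r : ℝ} (hr : 0 ≤ r) : ∃ t : ℕ,
    ∀ (I : ShiftedDyadic) (k : ℤ) (p y : ℝ), A⁻¹ * 2 ^ k ≤ I.length → I.length ≤ A * 2 ^ k →
      y ∈ I.toSet → |y - p| ≤ r * 2 ^ k →
      I.scale - k ∈ Finset.Icc (-(t : ℤ)) t ∧
        I.pos - ⌊p / 2 ^ I.scale⌋ ∈ Finset.Icc (-(t : ℤ)) t := by
  -- `A` controls the offset of the scale because `A < 2 ^ t`. For the position, `r * A` accounts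
  -- for the distance from y to p in units of the length, 2 for the shift and the place of y in the
  -- interval, and 1 for rounding down.
  obtain ⟨t, ht⟩ := exists_nat_gt (3 + r * A + A)
  have hA0 : 0 < A := by linarith
  have hrA : 0 ≤ r * A := by positivity
  have h2t : (t : ℝ) < 2 ^ t := by exact_mod_cast Nat.lt_two_pow_self
  refine ⟨t, fun I k p y h1 h2 h3 h4 => ?_⟩
  have hk : (0 : ℝ) < 2 ^ k := by positivity
  have h5 : A⁻¹ ≤ (2 : ℝ) ^ (I.scale - k) := by
    rw [zpow_sub₀ (by norm_num), le_div_iff₀ hk]; exact h1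
  have h6 : (2 : ℝ) ^ (I.scale - k) ≤ A := by
    rw [zpow_sub₀ (by norm_num), div_le_iff₀ hk]; exact h2
  refine ⟨Finset.mem_Icc.2 ⟨?_, ?_⟩, ?_⟩
  · by_contra hcon
    push Not at hcon
    have h7 : (2 : ℝ) ^ (I.scale - k) ≤ (2 : ℝ) ^ (-(t : ℤ)) :=
      zpow_le_zpow_right₀ (by norm_num) hcon.le
    rw [zpow_neg, zpow_natCast] at h7
    have h8 : ((2 : ℝ) ^ t)⁻¹ < A⁻¹ := (inv_lt_inv₀ (by positivity) hA0).2 (by linarith)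
    linarith
  · by_contra hcon
    push Not at hcon
    have h7 : (2 : ℝ) ^ (t : ℤ) ≤ (2 : ℝ) ^ (I.scale - k) :=
      zpow_le_zpow_right₀ (by norm_num) hcon.le
    rw [zpow_natCast] at h7
    linarith
  · have h7 := abs_pos_sub_le h3
    have hs : (0 : ℝ) < 2 ^ I.scale := by positivity
    have h8 : |y / 2 ^ I.scale - p / 2 ^ I.scale| ≤ r * A := by
      rw [← sub_div, abs_div, abs_of_pos hs, div_le_iff₀ hs]
      refine h4.trans ?_
      rw [mul_assoc]
      refine mul_le_mul_of_nonneg_left ?_ hr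
      rw [inv_mul_le_iff₀ hA0] at h1
      exact h1
    have h9 := Int.floor_le (p / 2 ^ I.scale)
    have h10 := (Int.lt_floor_add_one (p / 2 ^ I.scale)).le
    have h11 : |((I.pos - ⌊p / 2 ^ I.scale⌋ : ℤ) : ℝ)| < t := by
      push_cast
      rw [abs_le] at h7 h8
      rw [abs_lt]
      constructor <;> linarith [h7.1, h7.2, h8.1, h8.2]
    rw [abs_lt] at h11
    rw [Finset.mem_Icc]
    exact ⟨by exact_mod_cast h11.1.le, by exact_mod_cast h11.2.le⟩

end ShiftedDyadic

namespace DyadicBox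

theorem abs_sub_le_dist (p q : EuclideanSpace ℝ (Fin 2)) (i : Fin 2) : |p i - q i| ≤ dist p q := by
  rw [dist_eq_norm]
  simpa using PiLp.norm_apply_le (p - q) i

theorem dist_le_add (p q : EuclideanSpace ℝ (Fin 2)) : dist p q ≤ |p 0 - q 0| + |p 1 - q 1| := by
  rw [EuclideanSpace.dist_eq, Fin.sum_univ_two, Real.dist_eq, Real.dist_eq]
  refine Real.sqrt_le_iff.2 ⟨by positivity, ?_⟩
  have h0 := abs_nonneg (p 0 - q 0)
  have h1 := abs_nonneg (p 1 - q 1)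
  nlinarith

variable {I J : ShiftedDyadic} {a b A : ℝ}

theorem dist_planeBox_le {p q : EuclideanSpace ℝ (Fin 2)} (hp : p ∈ planeBox I J)
    (hq : q ∈ planeBox I J) : dist p q ≤ I.length + J.length :=
  (dist_le_add p q).trans
    (add_le_add (ShiftedDyadic.abs_sub_le hp.1 hq.1) (ShiftedDyadic.abs_sub_le hp.2 hq.2))

theorem diam_planeBox_le : Metric.diam (planeBox I J) ≤ I.length + J.length :=
  Metric.diam_le_of_forall_dist_le (add_pos I.length_pos J.length_pos).le
    fun _ hp _ hq => dist_planeBox_le hp hq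

theorem le_diam_planeBox : I.length / 2 ≤ Metric.diam (planeBox I J) := by
  have hI := I.length_pos
  have hJ := J.length_pos
  have hb : Bornology.IsBounded (planeBox I J) :=
    Metric.isBounded_iff.2 ⟨_, fun _ hp _ hq => dist_planeBox_le hp hq⟩
  let p : EuclideanSpace ℝ (Fin 2) := !₂[I.left + I.length / 4, J.left + J.length / 2]
  let q : EuclideanSpace ℝ (Fin 2) := !₂[I.left + 3 * I.length / 4, J.left + J.length / 2]
  have hp : p ∈ planeBox I J := by
    simp only [planeBox, ShiftedDyadic.toSet, Set.mem_Ioo, Set.mem_ofPred_eq, p]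
    refine ⟨⟨?_, ?_⟩, ?_, ?_⟩ <;> simp <;> linarith
  have hq : q ∈ planeBox I J := by
    simp only [planeBox, ShiftedDyadic.toSet, Set.mem_Ioo, Set.mem_ofPred_eq, q]
    refine ⟨⟨?_, ?_⟩, ?_, ?_⟩ <;> simp <;> linarith
  refine le_trans ?_ (Metric.dist_le_diam_of_mem hb hq hp)
  refine le_trans ?_ (abs_sub_le_dist q p 0)
  have : q 0 - p 0 = I.length / 2 := by
    simp only [p, q]; simp; ring
  rw [this]
  exact le_abs_self _

/-- For an adapted pair, `b y - a x` is comparable to the size. -/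
theorem PairAdapted.gap (h : PairAdapted A a b I J) (hA : 0 < A) (ha : 0 < a) (ha1 : a ≤ 1)
    (hb : 0 < b) (hb1 : b ≤ 1) {x y : ℝ} (hx : x ∈ I.toSet) (hy : y ∈ J.toSet) :
    b * A⁻¹ * I.length / 2 ≤ b * y - a * x ∧
      b * y - a * x ≤ (2 * A + 1) * (I.length + J.length) := by
  obtain ⟨h1, h2, p, hp, q, hq, h3⟩ := h
  let z : EuclideanSpace ℝ (Fin 2) := !₂[x, y]
  have hz : z ∈ planeBox I J := by
    simp only [planeBox, Set.mem_ofPred_eq, z]; simpa using ⟨hx, hy⟩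
  constructor
  -- Moving only the second coordinate reaches the line after the distance (b y - a x) / b, which
  -- bounds the distance to the line from above.
  · let w : EuclideanSpace ℝ (Fin 2) := !₂[x, a * x / b]
    have hw : w ∈ planeLine a b := by
      simp only [planeLine, Set.mem_ofPred_eq, w]; simp; field_simp
    have h4 := (h2 z hz w hw).trans (dist_le_add z w)
    have h5 : a * x < b * y := by simpa [z] using h1 z hz
    have h6 : |z 0 - w 0| + |z 1 - w 1| = (b * y - a * x) / b := by
      have : y - a * x / b = (b * y - a * x) / b := by field_simp
      simp only [z, w]
      simp only [Matrix.cons_val_zero, sub_self, abs_zero, Matrix.cons_val_one,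
        zero_add, this]
      exact abs_of_pos (div_pos (by linarith) hb)
    rw [h6, le_div_iff₀ hb] at h4
    have h7 : A⁻¹ * (I.length / 2) * b ≤ A⁻¹ * Metric.diam (planeBox I J) * b := by
      gcongr
      exact le_diam_planeBox
    calc b * A⁻¹ * I.length / 2 = A⁻¹ * (I.length / 2) * b := by ring
      _ ≤ _ := h7.trans h4
  · have h4 := h3.trans (mul_le_mul_of_nonneg_left (diam_planeBox_le (I := I) (J := J)) hA.le)
    have h5 := (abs_le.1 ((abs_sub_le_dist p q 0).trans h4)).1
    have h6 := (abs_le.1 ((abs_sub_le_dist p q 1).trans h4)).2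
    have h7 : a * q 0 = b * q 1 := hq
    have h8 := (abs_le.1 (ShiftedDyadic.abs_sub_le hx hp.1)).1
    have h9 := (abs_le.1 (ShiftedDyadic.abs_sub_le hy hp.2)).2
    have hD : 0 ≤ A * (I.length + J.length) :=
      mul_nonneg hA.le (add_pos I.length_pos J.length_pos).le
    have e1 : b * (y - p 1) ≤ J.length := by
      calc b * (y - p 1) ≤ b * J.length := by gcongr
        _ ≤ J.length := mul_le_of_le_one_left J.length_pos.le hb1
    have e2 : a * (p 0 - x) ≤ I.length := by
      calc a * (p 0 - x) ≤ a * I.length := by gcongr; linarith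
        _ ≤ I.length := mul_le_of_le_one_left I.length_pos.le ha1
    have e3 : b * (p 1 - q 1) ≤ A * (I.length + J.length) := by
      calc b * (p 1 - q 1) ≤ b * (A * (I.length + J.length)) := by gcongr
        _ ≤ _ := mul_le_of_le_one_left hD hb1
    have e4 : a * (q 0 - p 0) ≤ A * (I.length + J.length) := by
      calc a * (q 0 - p 0) ≤ a * (A * (I.length + J.length)) := by gcongr; linarith
        _ ≤ _ := mul_le_of_le_one_left hD ha1
    linarith

/-- Small squares about a point that is not too close to the line are adapted. -/
theorem pairAdapted_of_gap {δ g g' : ℝ} (hδ : 0 < δ) (ha : δ ≤ a) (ha1 : a ≤ 1)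
    (hb : δ ≤ b) (hb1 : b ≤ 1) (hIJ : I.length = J.length) (hg : 4 * I.length ≤ g)
    (hA : 2 ≤ A) (hA' : 2 * g' ≤ A * (δ * I.length)) {x y : ℝ} (hx : x ∈ I.toSet)
    (hy : y ∈ J.toSet) (h1 : g ≤ b * y - a * x) (h2 : b * y - a * x ≤ g') :
    PairAdapted A a b I J := by
  have hI := I.length_pos
  have ha0 : 0 < a := hδ.trans_le ha
  have hb0 : 0 < b := hδ.trans_le hb
  have key : ∀ p ∈ planeBox I J, 2 * I.length ≤ b * p 1 - a * p 0 := by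
    intro p hp
    have h8 := (abs_le.1 (ShiftedDyadic.abs_sub_le hp.1 hx)).2
    have h9 := (abs_le.1 (ShiftedDyadic.abs_sub_le hp.2 hy)).1
    have e1 : b * (y - p 1) ≤ I.length := by
      calc b * (y - p 1) ≤ b * I.length := by gcongr; linarith
        _ ≤ I.length := mul_le_of_le_one_left hI.le hb1
    have e2 : a * (p 0 - x) ≤ I.length := by
      calc a * (p 0 - x) ≤ a * I.length := by gcongr
        _ ≤ I.length := mul_le_of_le_one_left hI.le ha1
    linarith
  refine ⟨fun p hp => by linarith [key p hp], fun p hp q hq => ?_, ?_⟩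
  · have h5 := abs_sub_le_dist p q 0
    have h6 := abs_sub_le_dist p q 1
    have h7 : a * q 0 = b * q 1 := hq
    have e1 : b * (p 1 - q 1) ≤ dist p q := by
      calc b * (p 1 - q 1) ≤ b * dist p q := by gcongr; exact (le_abs_self _).trans h6
        _ ≤ _ := mul_le_of_le_one_left dist_nonneg hb1
    have e2 : a * (q 0 - p 0) ≤ dist p q := by
      calc a * (q 0 - p 0) ≤ a * dist p q := by
            gcongr; linarith [neg_abs_le (p 0 - q 0)]
        _ ≤ _ := mul_le_of_le_one_left dist_nonneg ha1
    have h8 : I.length ≤ dist p q := by linarith [key p hp]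
    have h9 : Metric.diam (planeBox I J) ≤ A * I.length := by
      refine diam_planeBox_le.trans ?_
      rw [← hIJ]
      nlinarith
    rw [inv_mul_le_iff₀ (by linarith)]
    exact h9.trans (by gcongr)
  · let z : EuclideanSpace ℝ (Fin 2) := !₂[x, y]
    let w : EuclideanSpace ℝ (Fin 2) := !₂[x, a * x / b]
    have hz : z ∈ planeBox I J := by
      simp only [planeBox, Set.mem_ofPred_eq, z]; simpa using ⟨hx, hy⟩
    have hw : w ∈ planeLine a b := by
      simp only [planeLine, Set.mem_ofPred_eq, w]; simp; field_simp
    refine ⟨z, hz, w, hw, (dist_le_add z w).trans ?_⟩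
    have h6 : |z 0 - w 0| + |z 1 - w 1| = (b * y - a * x) / b := by
      have : y - a * x / b = (b * y - a * x) / b := by field_simp
      simp only [z, w]
      simp only [Matrix.cons_val_zero, sub_self, abs_zero, Matrix.cons_val_one,
        zero_add, this]
      exact abs_of_pos (div_pos (by linarith) hb0)
    rw [h6, div_le_iff₀ hb0]
    have h7 : A * (I.length / 2) * δ ≤ A * Metric.diam (planeBox I J) * b := by
      have hA0 : 0 ≤ A := by linarith
      have hd := Metric.diam_nonneg (s := planeBox I J)
      gcongr
      exact le_diam_planeBox
    linarith

end DyadicBox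

namespace PlaneTree

variable {n : ℕ} {G : PlaneTree n}

theorem weight_pos (u : Finset (Fin n)) (i : G.Son u) : 0 < G.weight u i := by
  have := i.nonempty.card_pos
  unfold weight; positivity

theorem weight_le_one (u : Finset (Fin n)) (i : G.Son u) : G.weight u i ≤ 1 := by
  have : (1 : ℝ) ≤ i.1.card := by exact_mod_cast i.nonempty.card_pos
  unfold weight
  rw [div_le_one (by linarith)]
  exact this

theorem pos_of_son {u : Finset (Fin n)} (i : G.Son u) : 0 < n := i.left.pos

theorem le_weight (u : Finset (Fin n)) (i : G.Son u) : 1 / (n : ℝ) ≤ G.weight u i := by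
  have h1 : (0 : ℝ) < i.1.card := by exact_mod_cast i.nonempty.card_pos
  have h2 : (i.1.card : ℝ) ≤ n := by
    have := Finset.card_le_univ i.1
    rw [Fintype.card_fin] at this
    exact_mod_cast this
  unfold weight
  gcongr

theorem exists_covBy (u : G.inner) : ∃ i j : G.Son u.1, i ⋖ j := by
  obtain ⟨w, w', h⟩ := exists_pair_lt (G.Son u.1)
  obtain ⟨x, hx⟩ := exists_covBy_of_wellFoundedLT (not_isMax_of_lt h)
  exact ⟨_, _, hx⟩

/-- Only finitely many adapted quasi-cubes contain a given point. -/
theorem finite_boxes (u : G.inner) {A : ℝ} (hA : 1 ≤ A) (x : G.Son u.1 → ℝ) :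
    {Q : DyadicBox (G.Son u.1) | Q.IsQuasiCube A ∧ Q.Adapted A (G.weight u.1) ∧
      ∀ i, x i ∈ (Q i).toSet}.Finite := by
  obtain ⟨i, j, hij⟩ := exists_covBy u
  have hA0 : 0 < A := by linarith
  -- The gap between two neighbouring coordinates of the point determines the size of every adapted
  -- box around it, up to constants. If the gap is not positive, there is no such box.
  set g := G.weight u.1 j * x j - G.weight u.1 i * x i with hg
  by_cases hpos : 0 < g
  · have hw := weight_pos u.1 j
    set l₀ := A⁻¹ * (g / ((2 * A + 1) * (1 + A)))
    set l₁ := A * (2 * A * g / G.weight u.1 j)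
    have hl₀ : 0 < l₀ := by positivity
    refine (Set.Finite.pi' fun s => ShiftedDyadic.finite_of_mem hl₀ l₁ (x s)).subset ?_
    rintro Q ⟨h1, h2, h3⟩ s
    obtain ⟨h4, h5⟩ := (h2 i j hij).gap hA0 (weight_pos _ _) (weight_le_one _ _) hw
      (weight_le_one _ _) (h3 i) (h3 j)
    rw [← hg] at h4 h5
    have hI := (Q i).length_pos
    refine ⟨?_, ?_, h3 s⟩
    · have h6 : g / ((2 * A + 1) * (1 + A)) ≤ (Q i).length := by
        rw [div_le_iff₀ (by positivity)]
        calc g ≤ _ := h5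
          _ ≤ (2 * A + 1) * ((Q i).length + A * (Q i).length) := by gcongr; exact h1 j i
          _ = _ := by ring
      simp only [l₀]
      rw [inv_mul_le_iff₀ hA0]
      exact h6.trans (h1 i s)
    · refine (h1 s i).trans (mul_le_mul_of_nonneg_left ?_ hA0.le)
      rw [le_div_iff₀ hw]
      have : G.weight u.1 j * A⁻¹ * (Q i).length / 2 * (2 * A) =
          (Q i).length * G.weight u.1 j := by field_simp
      rw [← this]
      nlinarith
  · refine Set.Finite.subset Set.finite_empty ?_
    rintro Q ⟨-, h2, h3⟩
    obtain ⟨h4, -⟩ := (h2 i j hij).gap hA0 (weight_pos _ _) (weight_le_one _ _) (weight_pos _ _)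
      (weight_le_one _ _) (h3 i) (h3 j)
    have hI := (Q i).length_pos
    have hw := weight_pos u.1 j
    refine absurd (lt_of_lt_of_le ?_ h4) hpos
    positivity

end PlaneTree
end

/-! ### Tree sums, and symbols with fixed constants -/

noncomputable section

theorem hasSum_of_eq {f g : ℕ → ℂ} {a : ℂ} (h : HasSum f a) (e : ∀ ν, g ν = f ν) : HasSum g a := by
  rwa [funext e]

theorem isBump_iff {B : ℕ → ℝ} {c : ℝ} {I : ShiftedDyadic} {φ : ℝ → ℂ} :
    IsBump B c I φ ↔ SmoothBdd B (c * I.length) φ ∧ ∀ x, x ∉ I.dilate c → φ x = 0 :=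
  ⟨fun h => ⟨⟨h.1, h.2.2⟩, h.2.1⟩, fun h => ⟨h.1.1, h.2, h.1.2⟩⟩

theorem IsBump.mono {B B' : ℕ → ℝ} {c : ℝ} {I : ShiftedDyadic} {φ : ℝ → ℂ} (h : IsBump B c I φ)
    (hc : 0 ≤ c) (hB : ∀ l, B l ≤ B' l) : IsBump B' c I φ :=
  isBump_iff.2 ⟨(isBump_iff.1 h).1.mono (mul_nonneg hc I.length_pos.le) hB, h.2.1⟩

/-- The sum over the boxes of a given scale. -/
def levelSum {ι : Type} (F : Set (DyadicBox ι)) (scale : DyadicBox ι → ℤ) (Ψ : DyadicBox ι → ℂ)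
    (k : ℤ) : ℂ :=
  ∑ᶠ Q ∈ {Q | Q ∈ F ∧ scale Q = k}, Ψ Q

open Classical in
theorem levelSum_eq {ι : Type} {F : Set (DyadicBox ι)} {scale : DyadicBox ι → ℤ}
    {Ψ : DyadicBox ι → ℂ} {𝒬 : Finset (DyadicBox ι)} {k : ℤ}
    (h : ∀ Q ∈ F, scale Q = k → Ψ Q ≠ 0 → Q ∈ 𝒬) :
    levelSum F scale Ψ k = ∑ Q ∈ 𝒬, if Q ∈ F ∧ scale Q = k then Ψ Q else 0 := by
  rw [levelSum, ← Finset.sum_filter]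
  refine finsum_mem_eq_sum_of_inter_support_eq _ (Set.ext fun Q => ?_)
  simp only [Set.mem_inter_iff, Set.mem_ofPred_eq, Function.mem_support, Finset.coe_filter]
  exact ⟨fun ⟨h1, h2⟩ => ⟨⟨h Q h1.1 h1.2 h2, h1⟩, h2⟩, fun ⟨h1, h2⟩ => ⟨h1.2, h2⟩⟩

namespace PlaneTree

variable {n : ℕ} {G : PlaneTree n}

/-- The sum over the admissible scales of the products of sums over boxes. -/
def treeSum (S : Set (G.inner → ℤ)) (F : (u : G.inner) → Set (DyadicBox (G.Son u.1)))
    (scale : (u : G.inner) → DyadicBox (G.Son u.1) → ℤ)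
    (Ψ : (u : G.inner) → DyadicBox (G.Son u.1) → ℂ) : ℂ :=
  ∑ᶠ k ∈ S, ∏ u, levelSum (F u) (scale u) (Ψ u) (k u)

-- Multiplying out the product over the vertices turns the sum over scales into a sum over choices
-- of one box for each vertex. A choice of boxes determines its tuple of scales, so membership in
-- `S` becomes a condition on the choice. All later manipulations at a fixed point take place in
-- this finite sum.
open Classical in
theorem treeSum_eq {S : Set (G.inner → ℤ)} {F : (u : G.inner) → Set (DyadicBox (G.Son u.1))}
    {scale : (u : G.inner) → DyadicBox (G.Son u.1) → ℤ}
    {Ψ : (u : G.inner) → DyadicBox (G.Son u.1) → ℂ}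
    {𝒬 : (u : G.inner) → Finset (DyadicBox (G.Son u.1))}
    (h : ∀ u, ∀ Q ∈ F u, Ψ u Q ≠ 0 → Q ∈ 𝒬 u) :
    treeSum S F scale Ψ = ∑ P ∈ Fintype.piFinset 𝒬,
      if (∀ u, P u ∈ F u) ∧ (fun u => scale u (P u)) ∈ S then ∏ u, Ψ u (P u) else 0 := by
  have h1 : ∀ k : G.inner → ℤ, ∏ u, levelSum (F u) (scale u) (Ψ u) (k u) =
      ∑ P ∈ Fintype.piFinset 𝒬, if (∀ u, P u ∈ F u) ∧ (fun u => scale u (P u)) = k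
        then ∏ u, Ψ u (P u) else 0 := by
    intro k
    simp only [fun u => levelSum_eq (scale := scale u) (k := k u)
      fun Q hQ (_ : scale u Q = k u) => h u Q hQ]
    rw [Finset.prod_univ_sum]
    refine Finset.sum_congr rfl fun P _ => ?_
    rw [Finset.prod_ite_zero]
    congr 1
    simp only [Finset.mem_univ, true_imp_iff, forall_and, funext_iff]
  simp only [treeSum, h1]
  set f : (G.inner → ℤ) → ℂ := fun k => ∑ P ∈ Fintype.piFinset 𝒬,
    if (∀ u, P u ∈ F u) ∧ (fun u => scale u (P u)) = k then ∏ u, Ψ u (P u) else 0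
  set K : Finset (G.inner → ℤ) :=
    (Fintype.piFinset 𝒬).image fun P => fun u => scale u (P u)
  have h2 : ∑ᶠ k ∈ S, f k = ∑ k ∈ K with k ∈ S, f k := by
    refine finsum_mem_eq_sum_of_inter_support_eq _ (Set.ext fun k => ?_)
    simp only [Set.mem_inter_iff, Function.mem_support, Finset.coe_filter, Set.mem_ofPred_eq]
    refine ⟨fun ⟨h3, h4⟩ => ⟨⟨?_, h3⟩, h4⟩, fun ⟨h3, h4⟩ => ⟨h3.2, h4⟩⟩
    obtain ⟨P, hP, h5⟩ := Finset.exists_ne_zero_of_sum_ne_zero h4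
    rw [ne_eq, ite_eq_right_iff, not_forall] at h5
    obtain ⟨h5, -⟩ := h5
    exact Finset.mem_image.2 ⟨P, hP, h5.2⟩
  rw [h2, Finset.sum_comm]
  refine Finset.sum_congr rfl fun P hP => ?_
  by_cases hF : ∀ u, P u ∈ F u
  · simp only [hF, implies_true, true_and]
    rw [Finset.sum_ite_eq]
    have : (fun u => scale u (P u)) ∈ K := Finset.mem_image_of_mem _ hP
    simp [this]
  · simp only [hF, false_and, if_false, Finset.sum_const_zero]

theorem norm_treeSum_le {S : Set (G.inner → ℤ)}
    {F : (u : G.inner) → Set (DyadicBox (G.Son u.1))}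
    {scale : (u : G.inner) → DyadicBox (G.Son u.1) → ℤ}
    {Ψ : (u : G.inner) → DyadicBox (G.Son u.1) → ℂ}
    {𝒬 : (u : G.inner) → Finset (DyadicBox (G.Son u.1))}
    (h : ∀ u, ∀ Q ∈ F u, Ψ u Q ≠ 0 → Q ∈ 𝒬 u) {b : G.inner → ℝ}
    (hb0 : ∀ u, 0 ≤ b u) (hb : ∀ u, ∀ Q ∈ F u, Q ∈ 𝒬 u → ‖Ψ u Q‖ ≤ b u) :
    ‖treeSum S F scale Ψ‖ ≤ ∑ _P ∈ Fintype.piFinset 𝒬, ∏ u, b u := by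
  classical
  rw [treeSum_eq h]
  refine (norm_sum_le _ _).trans (Finset.sum_le_sum fun P hP => ?_)
  split_ifs with h
  · rw [norm_prod]
    exact Finset.prod_le_prod (fun _ _ => norm_nonneg _) fun u _ =>
      hb u _ (h.1 u) (Fintype.mem_piFinset.1 hP u)
  · rw [norm_zero]
    exact Finset.prod_nonneg fun u _ => hb0 u

/-- Expansion of the factor that belongs to one vertex. -/
theorem hasSum_treeSum {S : Set (G.inner → ℤ)}
    {F : (u : G.inner) → Set (DyadicBox (G.Son u.1))}
    {scale : (u : G.inner) → DyadicBox (G.Son u.1) → ℤ}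
    {Ψ : (u : G.inner) → DyadicBox (G.Son u.1) → ℂ}
    {Ψ' : ℕ → (u : G.inner) → DyadicBox (G.Son u.1) → ℂ} {a : ℕ → ℂ}
    {𝒬 : (u : G.inner) → Finset (DyadicBox (G.Son u.1))}
    (h : ∀ u, ∀ Q ∈ F u, Ψ u Q ≠ 0 → Q ∈ 𝒬 u)
    (h' : ∀ μ u, ∀ Q ∈ F u, Ψ' μ u Q ≠ 0 → Q ∈ 𝒬 u) (u₀ : G.inner)
    (hne : ∀ μ u, u ≠ u₀ → ∀ Q ∈ F u, Ψ' μ u Q = Ψ u Q)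
    (hs : ∀ Q ∈ F u₀, Q ∈ 𝒬 u₀ → HasSum (fun μ => a μ * Ψ' μ u₀ Q) (Ψ u₀ Q)) :
    HasSum (fun μ => a μ * treeSum S F scale (Ψ' μ)) (treeSum S F scale Ψ) := by
  classical
  rw [treeSum_eq h]
  simp only [fun μ => treeSum_eq (S := S) (scale := scale) (h' μ), Finset.mul_sum]
  refine hasSum_sum fun P hP => ?_
  by_cases hc : (∀ u, P u ∈ F u) ∧ (fun u => scale u (P u)) ∈ S
  · simp only [if_pos hc]
    have h2 := (hs (P u₀) (hc.1 u₀) (Fintype.mem_piFinset.1 hP u₀)).mul_right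
      (∏ u ∈ {u₀}ᶜ, Ψ u (P u))
    rw [Fintype.prod_eq_mul_prod_compl u₀]
    refine hasSum_of_eq h2 fun μ => ?_
    rw [Fintype.prod_eq_mul_prod_compl u₀, mul_assoc]
    congr 2
    refine Finset.prod_congr rfl fun u hu => hne μ u (by simpa using hu) _ (hc.1 u)
  · simp only [if_neg hc, mul_zero]
    exact hasSum_zero

/-- The conditions on the boxes and bumps in a standard symbol. -/
structure IsData (A c : ℝ) (B : ℕ → ℝ) (F : ℕ → (u : G.inner) → Set (DyadicBox (G.Son u.1)))
    (scale : ℕ → (u : G.inner) → DyadicBox (G.Son u.1) → ℤ)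
    (Φ : ℕ → (u : G.inner) → DyadicBox (G.Son u.1) → G.Son u.1 → ℝ → ℂ) : Prop where
  sparse : ∀ ν u, DyadicBox.Sparse c (F ν u)
  cond : ∀ ν u, ∀ Q ∈ F ν u, Q.IsQuasiCube A ∧ Q.Adapted A (G.weight u.1) ∧
      Q.HasScale A (scale ν u Q) ∧ ∀ i, IsBump B (9 / 10) (Q i) (Φ ν u Q i)

/-- Standard symbols with given constants in `∼` and `≫`. -/
def Std (G : PlaneTree n) (A : ℝ) (K : ℕ) (c : ℝ) (m : (Fin n → ℝ) → ℂ) : Prop :=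
  ∃ (B : ℕ → ℝ) (C : ℕ → ℂ)
    (F : ℕ → (u : G.inner) → Set (DyadicBox (G.Son u.1)))
    (scale : ℕ → (u : G.inner) → DyadicBox (G.Son u.1) → ℤ)
    (Φ : ℕ → (u : G.inner) → DyadicBox (G.Son u.1) → G.Son u.1 → ℝ → ℂ),
    RapidlyDecreasing C ∧ IsData A c B F scale Φ ∧
    ∀ ξ : Fin n → ℝ, HasSum (fun ν => C ν * treeSum (G.scaleTuples K) (F ν) (scale ν)
      fun u Q => ∏ i, Φ ν u Q i (G.sonSums u.1 ξ i)) (m ξ)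

theorem isStandardSymbol_iff {κ : ℝ → ℕ} {c : ℝ} {m : (Fin n → ℝ) → ℂ} :
    G.IsStandardSymbol κ c m ↔ ∃ (A : ℝ) (K : ℕ), 1 ≤ A ∧ κ A ≤ K ∧ G.Std A K c m := by
  constructor
  · rintro ⟨A, K, B, C, F, scale, Φ, hA, hK, hC, hs, hc, hm⟩
    exact ⟨A, K, hA, hK, B, C, F, scale, Φ, hC, ⟨hs, hc⟩, hm⟩
  · rintro ⟨A, K, hA, hK, B, C, F, scale, Φ, hC, ⟨hs, hc⟩, hm⟩
    exact ⟨A, K, B, C, F, scale, Φ, hA, hK, hC, hs, hc, hm⟩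

namespace Std

variable {A A' c : ℝ} {K : ℕ} {m m' : (Fin n → ℝ) → ℂ}

theorem zero (G : PlaneTree n) (A : ℝ) (K : ℕ) (c : ℝ) : G.Std A K c fun _ => 0 :=
  ⟨fun _ => 0, fun _ => 0, fun _ _ => ∅, fun _ _ _ => 0, fun _ _ _ _ _ => 0,
    RapidlyDecreasing.zero, ⟨fun _ _ Q hQ => hQ.elim, fun _ _ Q hQ => hQ.elim⟩,
    fun ξ => by simp⟩

theorem const_mul (h : G.Std A K c m) (a : ℂ) : G.Std A K c fun ξ => a * m ξ := by
  obtain ⟨B, C, F, scale, Φ, hC, hD, hm⟩ := h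
  refine ⟨B, fun ν => a * C ν, F, scale, Φ, hC.const_mul a, hD, fun ξ => ?_⟩
  simpa only [mul_assoc] using (hm ξ).mul_left a

theorem congr (h : G.Std A K c m) (hm : ∀ ξ, m ξ = m' ξ) : G.Std A K c m' := by
  rwa [← funext hm]

theorem mono (h : G.Std A K c m) (hA : 0 < A) (hA' : A ≤ A') : G.Std A' K c m := by
  obtain ⟨B, C, F, scale, Φ, hC, hD, hm⟩ := h
  have hinv : A'⁻¹ ≤ A⁻¹ := inv_anti₀ hA hA'
  refine ⟨B, C, F, scale, Φ, hC, ⟨hD.sparse, fun ν u Q hQ => ?_⟩, hm⟩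
  obtain ⟨h1, h2, h3, h4⟩ := hD.cond ν u Q hQ
  refine ⟨fun i j => (h1 i j).trans ?_, fun i j hij => ?_, fun i => ⟨?_, ?_⟩, h4⟩
  · have := (Q j).length_pos
    gcongr
  · obtain ⟨h5, h6, p, hp, q, hq, h7⟩ := h2 i j hij
    have hd := Metric.diam_nonneg (s := DyadicBox.planeBox (Q i) (Q j))
    refine ⟨h5, fun p hp q hq => le_trans (by gcongr) (h6 p hp q hq), p, hp, q, hq,
      h7.trans (by gcongr)⟩
  · exact le_trans (by gcongr) (h3 i).1
  · exact (h3 i).2.trans (by gcongr)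

theorem add (h : G.Std A K c m) (h' : G.Std A K c m') : G.Std A K c fun ξ => m ξ + m' ξ := by
  obtain ⟨B, C, F, scale, Φ, hC, hD, hm⟩ := h
  obtain ⟨B', C', F', scale', Φ', hC', hD', hm'⟩ := h'
  refine ⟨fun l => max (B l) (B' l), _,
    fun ν => if ν % 2 = 0 then F (ν / 2) else F' (ν / 2),
    fun ν => if ν % 2 = 0 then scale (ν / 2) else scale' (ν / 2),
    fun ν => if ν % 2 = 0 then Φ (ν / 2) else Φ' (ν / 2),
    hC.interleave hC', ⟨fun ν u => ?_, fun ν u Q hQ => ?_⟩, fun ξ => ?_⟩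
  · by_cases hν : ν % 2 = 0
    · simpa only [hν, if_true] using hD.sparse (ν / 2) u
    · simpa only [hν, if_false] using hD'.sparse (ν / 2) u
  · by_cases hν : ν % 2 = 0
    · simp only [hν, if_true] at hQ ⊢
      obtain ⟨h1, h2, h3, h4⟩ := hD.cond (ν / 2) u Q hQ
      exact ⟨h1, h2, h3, fun i => (h4 i).mono (by norm_num) fun l => le_max_left _ _⟩
    · simp only [hν, if_false] at hQ ⊢
      obtain ⟨h1, h2, h3, h4⟩ := hD'.cond (ν / 2) u Q hQ
      exact ⟨h1, h2, h3, fun i => (h4 i).mono (by norm_num) fun l => le_max_right _ _⟩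
  · have h1 : ∀ k : ℕ, (2 * k + 1) / 2 = k := fun k => by omega
    have h2 : ∀ k : ℕ, (2 * k + 1) % 2 = 1 := fun k => by omega
    refine HasSum.even_add_odd ?_ ?_
    · simpa using hm ξ
    · simpa [h1, h2] using hm' ξ

theorem sum {ι : Type*} (s : Finset ι) {m : ι → (Fin n → ℝ) → ℂ}
    (h : ∀ i ∈ s, G.Std A K c (m i)) : G.Std A K c fun ξ => ∑ i ∈ s, m i ξ := by
  classical
  induction s using Finset.induction_on with
  | empty => simpa using zero G A K c
  | insert a s ha ih =>
    simp only [Finset.sum_insert ha]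
    exact add (h a (Finset.mem_insert_self _ _)) (ih fun i hi => h i (Finset.mem_insert_of_mem hi))

end Std

/-- The bounds for the product of two functions. -/
theorem IsBump.mul_smooth {B B' : ℕ → ℝ} {I : ShiftedDyadic} {φ e : ℝ → ℂ} {A T : ℝ}
    (h : IsBump B (9 / 10) I φ) (he : SmoothBdd B' T e) (hT : 0 < T) (hI : I.length ≤ A * T) :
    IsBump (fun l => ∑ i ∈ Finset.range (l + 1),
      l.choose i * B i * (|B' (l - i)| * A ^ (l - i))) (9 / 10) I fun x => φ x * e x := by
  have hI0 := I.length_pos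
  refine isBump_iff.2 ⟨?_, fun x hx => by rw [h.2.1 x hx, zero_mul]⟩
  exact (isBump_iff.1 h).1.mul (he.rescale hT (by positivity) (by linarith)) (by positivity)

section Expansion

variable {A c : ℝ} {B : ℕ → ℝ} {K : ℕ} {C : ℕ → ℂ}
  {F : ℕ → (u : G.inner) → Set (DyadicBox (G.Son u.1))}
  {scale : ℕ → (u : G.inner) → DyadicBox (G.Son u.1) → ℤ}
  {Φ : ℕ → (u : G.inner) → DyadicBox (G.Son u.1) → G.Son u.1 → ℝ → ℂ}

/-- The finite set of the boxes that can contribute at a given point. -/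
def boxesAt (u : G.inner) (hA : 1 ≤ A) (x : G.Son u.1 → ℝ) : Finset (DyadicBox (G.Son u.1)) :=
  (finite_boxes u hA x).toFinset

theorem mem_of_mem_boxesAt {u : G.inner} {hA : 1 ≤ A} {x : G.Son u.1 → ℝ}
    {Q : DyadicBox (G.Son u.1)} (h : Q ∈ boxesAt u hA x) (i : G.Son u.1) : x i ∈ (Q i).toSet :=
  ((finite_boxes u hA x).mem_toFinset.1 h).2.2 i

theorem IsData.mem_toSet (hD : IsData A c B F scale Φ) {ν : ℕ} {u : G.inner}
    {Q : DyadicBox (G.Son u.1)} (hQ : Q ∈ F ν u) {x : G.Son u.1 → ℝ}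
    (h : ∏ i, Φ ν u Q i (x i) ≠ 0) (i : G.Son u.1) : x i ∈ (Q i).toSet := by
  refine ShiftedDyadic.dilate_subset _ ?_
  by_contra hx
  exact h (Finset.prod_eq_zero (Finset.mem_univ i) (((hD.cond ν u Q hQ).2.2.2 i).2.1 _ hx))

theorem IsData.mem_boxesAt (hD : IsData A c B F scale Φ) (hA : 1 ≤ A) {ν : ℕ} {u : G.inner}
    {Q : DyadicBox (G.Son u.1)} (hQ : Q ∈ F ν u) {x : G.Son u.1 → ℝ}
    (h : ∏ i, Φ ν u Q i (x i) ≠ 0) : Q ∈ boxesAt u hA x :=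
  (finite_boxes u hA x).mem_toFinset.2
    ⟨(hD.cond ν u Q hQ).1, (hD.cond ν u Q hQ).2.1, hD.mem_toSet hQ h⟩

-- Induction on the set of vertices that still carry an extra factor. At each step the expansion at
-- one vertex `u₀` is multiplied into the bumps there, and the summation index becomes the code of a
-- pair (old index, index of the expansion).
open Classical in
theorem std_of_unifExp_aux (hA : 1 ≤ A) {m : (Fin n → ℝ) → ℂ} (s : Finset G.inner)
    (hC : RapidlyDecreasing C) (hD : IsData A c B F scale Φ)
    (H : (u : G.inner) → ℕ → DyadicBox (G.Son u.1) → (G.Son u.1 → ℝ) → ℂ)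
    (hH : ∀ u, UnifExp (𝓠 := {q : ℕ × DyadicBox (G.Son u.1) // q.2 ∈ F q.1 u})
      (fun q => (2 : ℝ) ^ scale q.1.1 u q.1.2) (fun q => {x | ∀ i, x i ∈ (q.1.2 i).toSet})
      (fun q => H u q.1.1 q.1.2))
    (hm : ∀ ξ, HasSum (fun ν => C ν * treeSum (G.scaleTuples K) (F ν) (scale ν)
      fun u Q => (∏ i, Φ ν u Q i (G.sonSums u.1 ξ i)) *
        if u ∈ s then H u ν Q (G.sonSums u.1 ξ) else 1) (m ξ)) : G.Std A K c m := by
  have hA0 : 0 < A := by linarith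
  induction s using Finset.induction_on generalizing B C F scale Φ H with
  | empty => exact ⟨B, C, F, scale, Φ, hC, hD, by simpa using hm⟩
  | insert u₀ s hu₀ ih =>
  choose Be Ce e hCe hSe hse using hH
  -- The expansion exists only for boxes of the family; the value 1 elsewhere is irrelevant, as
  -- other boxes never enter the sums.
  set Φ' : ℕ → (u : G.inner) → DyadicBox (G.Son u.1) → G.Son u.1 → ℝ → ℂ :=
    fun ν u Q i y => Φ ν.unpair.1 u Q i y *
      if h : Q ∈ F ν.unpair.1 u ∧ u = u₀ then e u ⟨(ν.unpair.1, Q), h.1⟩ ν.unpair.2 i y else 1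
    with hΦ'
  set B₁ : ℕ → ℝ := fun l => ∑ i ∈ Finset.range (l + 1),
      l.choose i * B i * (|Be u₀ (l - i)| * A ^ (l - i)) with hB₁
  set B' : ℕ → ℝ := fun l => max (B l) (B₁ l) with hB'
  set F' : ℕ → (u : G.inner) → Set (DyadicBox (G.Son u.1)) := fun ν => F ν.unpair.1 with hF'
  set scale' : ℕ → (u : G.inner) → DyadicBox (G.Son u.1) → ℤ := fun ν => scale ν.unpair.1
    with hscale'
  have hD' : IsData A c B' F' scale' Φ' := by
    refine ⟨fun ν u => hD.sparse _ u, fun ν u Q hQ => ?_⟩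
    obtain ⟨h1, h2, h3, h4⟩ := hD.cond ν.unpair.1 u Q hQ
    refine ⟨h1, h2, h3, fun i => ?_⟩
    by_cases hu : u = u₀
    · have h5 : Q ∈ F ν.unpair.1 u ∧ u = u₀ := ⟨hQ, hu⟩
      simp only [hΦ', h5, dif_pos, and_self]
      refine IsBump.mono (B := B₁) ?_ (by norm_num) fun l => le_max_right _ _
      subst hu
      exact IsBump.mul_smooth (h4 i) (hSe u ⟨(ν.unpair.1, Q), hQ⟩ ν.unpair.2 i) (by positivity)
        (h3 i).2
    · simp only [hΦ', hu, and_false, dif_neg, not_false_eq_true, mul_one]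
      exact (h4 i).mono (by norm_num) fun l => le_max_left _ _
  have hHe : ∀ u, UnifExp (𝓠 := {q : ℕ × DyadicBox (G.Son u.1) // q.2 ∈ F q.1 u})
      (fun q => (2 : ℝ) ^ scale q.1.1 u q.1.2) (fun q => {x | ∀ i, x i ∈ (q.1.2 i).toSet})
      (fun q => H u q.1.1 q.1.2) := fun u => ⟨Be u, Ce u, e u, hCe u, hSe u, hse u⟩
  have hH' : ∀ u, UnifExp (𝓠 := {q : ℕ × DyadicBox (G.Son u.1) // q.2 ∈ F' q.1 u})
      (fun q => (2 : ℝ) ^ scale' q.1.1 u q.1.2) (fun q => {x | ∀ i, x i ∈ (q.1.2 i).toSet})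
      (fun q => H u q.1.1.unpair.1 q.1.2) := fun u =>
    (hHe u).comap fun q : {q : ℕ × DyadicBox (G.Son u.1) // q.2 ∈ F' q.1 u} =>
      ⟨(q.1.1.unpair.1, q.1.2), q.2⟩
  refine ih (hC.pair (hCe u₀)) hD' (fun u ν => H u ν.unpair.1) hH' fun ξ => ?_
  set x : (u : G.inner) → G.Son u.1 → ℝ := fun u => G.sonSums u.1 ξ with hx
  set 𝒬 : (u : G.inner) → Finset (DyadicBox (G.Son u.1)) := fun u => boxesAt u hA (x u) with h𝒬
  -- the terms of the double series
  set Ψ : ℕ → (u : G.inner) → DyadicBox (G.Son u.1) → ℂ := fun ν u Q =>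
    (∏ i, Φ' ν u Q i (x u i)) * if u ∈ s then H u ν.unpair.1 Q (x u) else 1 with hΨ
  have hmem : ∀ ν u, ∀ Q ∈ F' ν u, Ψ ν u Q ≠ 0 → Q ∈ 𝒬 u := fun ν u Q hQ h =>
    hD'.mem_boxesAt hA hQ (left_ne_zero_of_mul h)
  choose b hb using fun u => (hHe u).bounded
  have hΨb : ∀ ν u, ∀ Q ∈ F' ν u, Q ∈ 𝒬 u →
      ‖Ψ ν u Q‖ ≤ |B' 0| ^ Fintype.card (G.Son u.1) * max 1 (b u) := by
    intro ν u Q hQ hQ'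
    rw [hΨ]
    simp only
    rw [norm_mul, norm_prod]
    refine mul_le_mul ?_ ?_ (norm_nonneg _) (by positivity)
    · refine (Finset.prod_le_prod (g := fun _ => |B' 0|) (fun _ _ => norm_nonneg _)
        fun i _ => ?_).trans (by simp)
      have := ((hD'.cond ν u Q hQ).2.2.2 i).2.2 0 (x u i)
      simp only [iteratedDeriv_zero, pow_zero, inv_one, mul_one] at this
      exact this.trans (le_abs_self _)
    · split_ifs
      · exact (hb u ⟨(ν.unpair.1, Q), hQ⟩ (x u) (mem_of_mem_boxesAt hQ')).trans (le_max_right _ _)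
      · simp
  set M : ℝ := ∑ _P ∈ Fintype.piFinset 𝒬,
    ∏ u, (|B' 0| ^ Fintype.card (G.Son u.1) * max 1 (b u)) with hM
  have hTb : ∀ ν, ‖treeSum (G.scaleTuples K) (F' ν) (scale' ν) (Ψ ν)‖ ≤ M := fun ν =>
    norm_treeSum_le (hmem ν) (fun u => by positivity) (hΨb ν)
  -- expansion of the factor that belongs to `u₀`
  have hfib : ∀ ν, HasSum (fun μ => (C ν * Ce u₀ μ) *
      treeSum (G.scaleTuples K) (F ν) (scale ν) (Ψ (Nat.pair ν μ)))
      (C ν * treeSum (G.scaleTuples K) (F ν) (scale ν) fun u Q =>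
        (∏ i, Φ ν u Q i (x u i)) * if u ∈ insert u₀ s then H u ν Q (x u) else 1) := by
    intro ν
    simp only [mul_assoc]
    refine HasSum.mul_left _ (hasSum_treeSum (𝒬 := 𝒬) (u₀ := u₀)
      (fun u Q hQ h => hD.mem_boxesAt hA hQ (left_ne_zero_of_mul h)) ?_ ?_ ?_)
    · intro μ u Q hQ
      exact hmem (Nat.pair ν μ) u Q (by simpa [hF'] using hQ)
    · intro μ u hu Q hQ
      simp [hΨ, hΦ', hu]
    · intro Q hQ hQ'
      have h1 := (hse u₀ ⟨(ν, Q), hQ⟩ (x u₀) (mem_of_mem_boxesAt hQ')).mul_left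
        (∏ i, Φ ν u₀ Q i (x u₀ i))
      rw [if_pos (Finset.mem_insert_self _ _)]
      refine hasSum_of_eq h1 fun μ => ?_
      have h5 : Ψ (Nat.pair ν μ) u₀ Q = (∏ i, Φ ν u₀ Q i (x u₀ i)) *
          ∏ i, e u₀ ⟨(ν, Q), hQ⟩ μ i (x u₀ i) := by
        simp only [hΨ, hΦ', Nat.unpair_pair, hu₀, if_false, mul_one, and_true]
        rw [← Finset.prod_mul_distrib]
        exact Finset.prod_congr rfl fun i _ => by rw [dif_pos hQ]
      rw [h5]
      ring
  -- summability of the double series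
  have hsum : Summable fun p : ℕ × ℕ => (C p.1 * Ce u₀ p.2) *
      treeSum (G.scaleTuples K) (F p.1) (scale p.1) (Ψ (Nat.pair p.1 p.2)) := by
    refine Summable.of_norm_bounded (g := fun p : ℕ × ℕ => ‖C p.1‖ * ‖Ce u₀ p.2‖ * M) ?_ ?_
    · exact (Summable.mul_of_nonneg hC.summable_norm (hCe u₀).summable_norm
        (fun _ => norm_nonneg _) fun _ => norm_nonneg _).mul_right M
    · rintro ⟨ν, μ⟩
      rw [norm_mul, norm_mul]
      have := hTb (Nat.pair ν μ)
      simp only [hF', hscale', Nat.unpair_pair] at this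
      exact mul_le_mul_of_nonneg_left this (by positivity)
  -- Absolute convergence lets the double series be summed first over the new index, which gives
  -- back the given symbol, and also along the pairing.
  have htot := hsum.hasSum.prod_fiberwise hfib
  rw [(hm ξ).unique htot]
  have h6 := Nat.pairEquiv.symm.hasSum_iff.2 hsum.hasSum
  refine hasSum_of_eq h6 fun ν => ?_
  simp only [Function.comp, Nat.pairEquiv_symm_apply, Nat.pair_unpair, hF', hscale', hΨ]
  rfl

/-- Symbols that are obtained from a standard one by inserting, at each vertex, functions that can
be expanded into tensor products. -/
theorem std_of_unifExp (hA : 1 ≤ A) {m : (Fin n → ℝ) → ℂ}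
    (hC : RapidlyDecreasing C) (hD : IsData A c B F scale Φ)
    (H : (u : G.inner) → ℕ → DyadicBox (G.Son u.1) → (G.Son u.1 → ℝ) → ℂ)
    (hH : ∀ u, UnifExp (𝓠 := {q : ℕ × DyadicBox (G.Son u.1) // q.2 ∈ F q.1 u})
      (fun q => (2 : ℝ) ^ scale q.1.1 u q.1.2) (fun q => {x | ∀ i, x i ∈ (q.1.2 i).toSet})
      (fun q => H u q.1.1 q.1.2))
    (hm : ∀ ξ, HasSum (fun ν => C ν * treeSum (G.scaleTuples K) (F ν) (scale ν)
      fun u Q => (∏ i, Φ ν u Q i (G.sonSums u.1 ξ i)) * H u ν Q (G.sonSums u.1 ξ)) (m ξ)) :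
    G.Std A K c m :=
  std_of_unifExp_aux hA Finset.univ hC hD H hH (by simpa using hm)

end Expansion

end PlaneTree
end

/-! ### Coordinates of the points in the support, and comparison of two trees -/

noncomputable section

/-- Telescoping over neighbours. One step already gives the lower bound because the others are
non-negative; the number of steps is at most the cardinality. -/
theorem sub_bounds_of_covBy {ι : Type} [Fintype ι] [LinearOrder ι] {g : ι → ℝ} {lo hi : ℝ}
    (hlo : 0 ≤ lo) (h : ∀ i j, i ⋖ j → lo ≤ g j - g i ∧ g j - g i ≤ hi) {i j : ι} (hij : i < j) :
    lo ≤ g j - g i ∧ g j - g i ≤ Fintype.card ι * hi := by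
  classical
  have key : ∀ (m : ℕ) (i : ι), (Finset.univ.filter fun x => i < x ∧ x ≤ j).card = m → i < j →
      lo ≤ g j - g i ∧ g j - g i ≤ m * hi := by
    intro m
    induction m with
    | zero =>
      intro i hm hij
      rw [Finset.card_eq_zero, Finset.filter_eq_empty_iff] at hm
      exact absurd ⟨hij, le_rfl⟩ (hm (Finset.mem_univ j))
    | succ m ih =>
      intro i hm hij
      obtain ⟨b, hb⟩ := exists_covBy_of_wellFoundedLT (not_isMax_of_lt hij)
      have hbj : b ≤ j := by
        by_contra hlt
        exact hb.2 hij (not_le.1 hlt)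
      have h1 := h i b hb
      rcases hbj.eq_or_lt with rfl | hlt
      · refine ⟨h1.1, h1.2.trans ?_⟩
        push_cast
        nlinarith [h1.1.trans h1.2, (Nat.cast_nonneg m : (0 : ℝ) ≤ m)]
      · have hc : (Finset.univ.filter fun x => i < x ∧ x ≤ j) =
            insert b (Finset.univ.filter fun x => b < x ∧ x ≤ j) := by
          ext x
          simp only [Finset.mem_filter, Finset.mem_univ, true_and, Finset.mem_insert]
          constructor
          · rintro ⟨h2, h3⟩
            rcases lt_trichotomy b x with h4 | h4 | h4
            · exact Or.inr ⟨h4, h3⟩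
            · exact Or.inl h4.symm
            · exact absurd h4 (hb.2 h2)
          · rintro (rfl | ⟨h2, h3⟩)
            · exact ⟨hb.1, hbj⟩
            · exact ⟨hb.1.trans h2, h3⟩
        rw [hc, Finset.card_insert_of_notMem (by simp)] at hm
        have h2 := ih b (by omega) hlt
        push_cast
        constructor <;> linarith [h1.1, h1.2, h2.1, h2.2]
  obtain ⟨h1, h2⟩ := key _ i rfl hij
  refine ⟨h1, h2.trans ?_⟩
  have hhi : 0 ≤ hi := by
    obtain ⟨b, hb⟩ := exists_covBy_of_wellFoundedLT (not_isMax_of_lt hij)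
    have := h i b hb
    linarith [this.1, this.2]
  gcongr
  exact Finset.card_le_univ _

namespace PlaneTree

variable {n : ℕ} {G : PlaneTree n}

/-- The averages over the sons of `u` are separated by about `2 ^ k u`, for every vertex `u`. -/
def Located (G : PlaneTree n) (M : ℝ) (k : G.inner → ℤ) (ξ : Fin n → ℝ) : Prop :=
  ∀ (u : G.inner) (i j : G.Son u.1), i ⋖ j →
    M⁻¹ * 2 ^ k u ≤ G.weight u.1 j * G.sonSums u.1 ξ j - G.weight u.1 i * G.sonSums u.1 ξ i ∧
    G.weight u.1 j * G.sonSums u.1 ξ j - G.weight u.1 i * G.sonSums u.1 ξ i ≤ M * 2 ^ k u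

/-- `|ξ_i - ξ_j|` is about `2 ^ k u` if `i` and `j` are below different sons of `u`. -/
structure PairEst (G : PlaneTree n) (E : ℝ) (k : G.inner → ℤ) (ξ : Fin n → ℝ) : Prop where
  upper : ∀ (u : G.inner) (i j : Fin n), i ∈ u.1 → j ∈ u.1 → |ξ i - ξ j| ≤ E * 2 ^ k u
  lower : ∀ (u : G.inner) (w w' : G.Son u.1) (i j : Fin n), w < w' → i ∈ w.1 → j ∈ w'.1 →
    E⁻¹ * 2 ^ k u ≤ ξ j - ξ i

theorem PairEst.mono {E E' : ℝ} {k : G.inner → ℤ} {ξ : Fin n → ℝ} (h : G.PairEst E k ξ)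
    (hE : 0 < E) (hE' : E ≤ E') : G.PairEst E' k ξ := by
  have hinv : E'⁻¹ ≤ E⁻¹ := inv_anti₀ hE hE'
  exact ⟨fun u i j hi hj => (h.upper u i j hi hj).trans (by gcongr),
    fun u w w' i j hw hi hj => le_trans (by gcongr) (h.lower u w w' i j hw hi hj)⟩

theorem abs_sub_weight_mul_le {u : Finset (Fin n)} (w : G.Son u) {ξ : Fin n → ℝ} {i : Fin n}
    {d : ℝ} (h : ∀ l ∈ w.1, |ξ i - ξ l| ≤ d) : |ξ i - G.weight u w * G.sonSums u ξ w| ≤ d := by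
  have hc : (0 : ℝ) < w.1.card := by exact_mod_cast w.nonempty.card_pos
  have h1 : ξ i - G.weight u w * G.sonSums u ξ w = (∑ l ∈ w.1, (ξ i - ξ l)) / w.1.card := by
    rw [Finset.sum_sub_distrib, Finset.sum_const, nsmul_eq_mul]
    unfold weight sonSums
    field_simp
  rw [h1, abs_div, abs_of_pos hc, div_le_iff₀ hc]
  refine (Finset.abs_sum_le_sum_abs _ _).trans ((Finset.sum_le_sum h).trans ?_)
  rw [Finset.sum_const, nsmul_eq_mul, mul_comm]

/-- Induction on the size of the vertex. If the cluster below a son v has diameter at most 2nM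
2^{k_v}, then 8nM² ≤ 2^K puts each of its coordinates within 2^{k_u}/(4M) of their average. The
averages over different sons are at least 2^{k_u}/M apart, so at least half of this distance
survives for the coordinates; the upper bound comes from adding at most n gaps between averages. -/
theorem Located.pairEst {M : ℝ} (hM : 1 ≤ M) {k : G.inner → ℤ} {ξ : Fin n → ℝ} {K : ℕ}
    (hk : k ∈ G.scaleTuples K) (hK : 8 * n * M ^ 2 ≤ 2 ^ K) (h : G.Located M k ξ) :
    G.PairEst (4 * n * M) k ξ := by
  have hM0 : 0 < M := by linarith
  -- distance to the average over a son
  have hson : ∀ (u : G.inner), (∀ v : G.inner, v.1.card < u.1.card → ∀ i j : Fin n, i ∈ v.1 →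
      j ∈ v.1 → |ξ i - ξ j| ≤ 2 * n * M * 2 ^ k v) → ∀ (w : G.Son u.1) (i : Fin n), i ∈ w.1 →
      |ξ i - G.weight u.1 w * G.sonSums u.1 ξ w| ≤ (4 * M)⁻¹ * 2 ^ k u := by
    intro u ih w i hi
    have hn : (1 : ℝ) ≤ n := by exact_mod_cast pos_of_son w
    refine abs_sub_weight_mul_le w fun l hl => ?_
    by_cases hw : w.1 ∈ G.inner
    · have h1 := ih ⟨w.1, hw⟩ (Finset.card_lt_card w.ssubset) i l hi hl
      have h2 := hk u ⟨w.1, hw⟩ w.2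
      have h3 : (2 : ℝ) ^ k ⟨w.1, hw⟩ * 2 ^ K ≤ 2 ^ k u := by
        rw [← zpow_natCast, ← zpow_add₀ (by norm_num)]
        exact zpow_le_zpow_right₀ (by norm_num) h2
      have h4 : (2 : ℝ) ^ k ⟨w.1, hw⟩ * (8 * n * M ^ 2) ≤ 2 ^ k u :=
        le_trans (by gcongr) h3
      refine h1.trans ?_
      rw [le_inv_mul_iff₀ (by positivity)]
      calc 4 * M * (2 * n * M * 2 ^ k ⟨w.1, hw⟩) = (2 : ℝ) ^ k ⟨w.1, hw⟩ * (8 * n * M ^ 2) := by ring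
        _ ≤ _ := h4
    · have hcard : w.1.card ≤ 1 := by
        by_contra hlt
        exact hw (mem_inner.2 ⟨w.mem_verts, not_le.1 hlt⟩)
      rw [Finset.card_le_one.1 hcard i hi l hl, sub_self, abs_zero]
      positivity
  have hup : ∀ (c : ℕ) (u : G.inner), u.1.card = c → ∀ i j : Fin n, i ∈ u.1 → j ∈ u.1 →
      |ξ i - ξ j| ≤ 2 * n * M * 2 ^ k u := by
    intro c
    induction c using Nat.strong_induction_on with
    | _ c ih =>
    intro u hc i j hi hj
    have hs := hson u fun v hv => ih _ (hc ▸ hv) v rfl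
    obtain ⟨w, hw⟩ := exists_son_of_mem u.2 hi
    obtain ⟨w', hw'⟩ := exists_son_of_mem u.2 hj
    have h1 := hs w i hw
    have h2 := hs w' j hw'
    have hn : (1 : ℝ) ≤ n := by exact_mod_cast pos_of_son w
    have hcard : (Fintype.card (G.Son u.1) : ℝ) ≤ n := by exact_mod_cast G.card_son_le u.1
    have hk0 : (0 : ℝ) < 2 ^ k u := by positivity
    have hinv : (4 * M)⁻¹ ≤ 1 / 4 := by
      rw [mul_inv]
      have := inv_le_one_of_one_le₀ hM
      linarith
    have h3 : |G.weight u.1 w * G.sonSums u.1 ξ w - G.weight u.1 w' * G.sonSums u.1 ξ w'| ≤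
        n * (M * 2 ^ k u) := by
      rcases lt_trichotomy w w' with hlt | rfl | hlt
      · have h4 := sub_bounds_of_covBy (g := fun w => G.weight u.1 w * G.sonSums u.1 ξ w)
          (by positivity) (h u) hlt
        rw [abs_sub_comm, abs_of_nonneg (le_trans (by positivity) h4.1)]
        exact h4.2.trans (by gcongr)
      · rw [sub_self, abs_zero]
        positivity
      · have h4 := sub_bounds_of_covBy (g := fun w => G.weight u.1 w * G.sonSums u.1 ξ w)
          (by positivity) (h u) hlt
        rw [abs_of_nonneg (le_trans (by positivity) h4.1)]
        exact h4.2.trans (by gcongr)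
    have h5 : (4 * M)⁻¹ * 2 ^ k u ≤ 1 / 4 * 2 ^ k u := by gcongr
    have h6 : (1 : ℝ) * 2 ^ k u ≤ n * M * 2 ^ k u := by
      gcongr
      nlinarith
    rw [abs_le] at *
    constructor <;> linarith [h1.1, h1.2, h2.1, h2.2, h3.1, h3.2]
  refine ⟨fun u i j hi hj => (hup _ u rfl i j hi hj).trans ?_, fun u w w' i j hlt hi hj => ?_⟩
  · gcongr
    norm_num
  · have hs := hson u fun v hv => hup _ v rfl
    have h1 := hs w i hi
    have h2 := hs w' j hj
    have hn : (1 : ℝ) ≤ n := by exact_mod_cast pos_of_son w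
    have h4 := (sub_bounds_of_covBy (g := fun w => G.weight u.1 w * G.sonSums u.1 ξ w)
          (by positivity) (h u) hlt).1
    have h5 : (4 * n * M)⁻¹ * 2 ^ k u ≤ (4 * M)⁻¹ * 2 ^ k u := by
      gcongr
      nlinarith
    have h6 : (4 * M)⁻¹ * 2 ^ k u = 1 / 4 * (M⁻¹ * 2 ^ k u) := by rw [mul_inv]; ring
    have h7 : 0 ≤ M⁻¹ * 2 ^ k u := by positivity
    rw [abs_le] at h1 h2
    linarith [h1.1, h1.2, h2.1, h2.2]

section Compare

variable {G₁ G₂ : PlaneTree n} {E : ℝ} {k₁ : G₁.inner → ℤ} {k₂ : G₂.inner → ℤ} {ξ : Fin n → ℝ}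

/-- The tree with the larger separation is coarser. -/
theorem verts_subset_of_pairEst (hE : 0 < E) (h₁ : G₁.PairEst E k₁ ξ) (h₂ : G₂.PairEst E k₂ ξ)
    {K : ℕ} (hk : k₂ ∈ G₂.scaleTuples K) (hK : E ^ 4 < 2 ^ K) : G₂.verts ⊆ G₁.verts := by
  intro u hu
  by_contra hu₁
  have hcard : 1 < u.card := by
    by_contra hlt
    obtain ⟨i, hi⟩ := Finset.card_eq_one.1
      (le_antisymm (not_lt.1 hlt) (nonempty_of_mem hu).card_pos)
    exact hu₁ (hi ▸ G₁.leaf_mem i)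
  obtain ⟨w, w', i, j, hlt, hi, hj, hiu, hju, -⟩ := G₁.exists_sons_of_hull hcard
  have hspec := G₁.hull_spec (nonempty_of_mem hu)
  set v : G₁.inner := ⟨G₁.hull u, G₁.hull_mem_inner hcard⟩
  have hssub : u ⊂ v.1 := hspec.2.1.ssubset_of_ne fun h => hu₁ (h ▸ hspec.1)
  obtain ⟨x, hxv, hxu⟩ := Finset.exists_of_ssubset hssub
  -- In `G₁` the point x is no farther from i than a constant times ξ_j - ξ_i, since i and j lie
  -- below different sons of v. In `G₂` both i and j belong to u while x does not, so the distance
  -- from x to i is larger by the factor 2^K up to constants. Four comparisons are chained, whence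
  -- `E ^ 4`.
  have a1 := h₁.lower v w w' i j hlt hi hj
  have a2 := h₁.upper v x i hxv (hspec.2.1 hiu)
  have a3 := h₂.upper ⟨u, mem_inner.2 ⟨hu, hcard⟩⟩ j i hju hiu
  -- the hull of `x` and `i` in the coarser tree
  have hxi : x ≠ i := fun h => hxu (h ▸ hiu)
  have hc2 : 1 < ({x, i} : Finset (Fin n)).card := by rw [Finset.card_pair hxi]; norm_num
  have hspec2 := G₂.hull_spec (S := {x, i}) ⟨x, by simp⟩
  obtain ⟨s, s', y, z, hss, hy, hz, hym, hzm, hyz⟩ := G₂.exists_sons_of_hull hc2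
  set v₂ : G₂.inner := ⟨G₂.hull {x, i}, G₂.hull_mem_inner hc2⟩
  have a4 := h₂.lower v₂ s s' y z hss hy hz
  have a5 : ξ z - ξ y ≤ |ξ x - ξ i| := by
    simp only [Finset.mem_insert, Finset.mem_singleton] at hym hzm
    rcases hym with rfl | rfl <;> rcases hzm with rfl | rfl
    · exact absurd hyz (lt_irrefl _)
    · rw [abs_sub_comm]; exact le_abs_self _
    · exact le_abs_self _
    · exact absurd hyz (lt_irrefl _)
  have hxv₂ : x ∈ v₂.1 := hspec2.2.1 (by simp)
  have hiv₂ : i ∈ v₂.1 := hspec2.2.1 (by simp)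
  have hu2 : u ⊂ v₂.1 := by
    rcases comparable hu (inner_mem_verts v₂) hiu hiv₂ with h | h
    · exact h.ssubset_of_ne fun h' => hxu (h' ▸ hxv₂)
    · exact absurd (h hxv₂) hxu
  have hkk := scaleTuples_of_ssubset hk ⟨u, mem_inner.2 ⟨hu, hcard⟩⟩ v₂ hu2
  have a6 : (2 : ℝ) ^ k₂ ⟨u, mem_inner.2 ⟨hu, hcard⟩⟩ * 2 ^ K ≤ 2 ^ k₂ v₂ := by
    rw [← zpow_natCast, ← zpow_add₀ (by norm_num)]
    exact zpow_le_zpow_right₀ (by norm_num) hkk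
  set t := (2 : ℝ) ^ k₂ ⟨u, mem_inner.2 ⟨hu, hcard⟩⟩
  have ht : 0 < t := by positivity
  rw [inv_mul_le_iff₀ hE] at a1 a4
  have a7 := (le_abs_self _).trans a3
  have : t * 2 ^ K ≤ t * E ^ 4 := by
    calc t * 2 ^ K ≤ 2 ^ k₂ v₂ := a6
      _ ≤ E * (ξ z - ξ y) := a4
      _ ≤ E * (E * 2 ^ k₁ v) := by gcongr; exact a5.trans a2
      _ ≤ E * (E * (E * (ξ j - ξ i))) := by gcongr
      _ ≤ E * (E * (E * (E * t))) := by gcongr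
      _ = t * E ^ 4 := by ring
  exact absurd (le_of_mul_le_mul_left this ht) (not_le.2 hK)

/-- Leaves i and j below different sons of u also lie below different sons of the hull of u, since a
son of the hull that meets a son of u is contained in it. Thus ξ_j - ξ_i is comparable to both
powers of 2. -/
theorem scales_close (hE : 0 < E) (h₁ : G₁.PairEst E k₁ ξ) (h₂ : G₂.PairEst E k₂ ξ)
    (hG : G₂.verts ⊆ G₁.verts) {D : ℕ} (hD : E ^ 2 ≤ 2 ^ D) (u : G₁.inner) :
    k₁ u - k₂ (coarsen G₁ G₂ u) ∈ Finset.Icc (-(D : ℤ)) D := by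
  obtain ⟨w, w', i, j, hlt, hi, hj, -⟩ := exists_lt_of_inner u
  have hiu := w.ssubset.1 hi
  have hju := w'.ssubset.1 hj
  have a1 := h₁.lower u w w' i j hlt hi hj
  have a2 := h₁.upper u j i hju hiu
  have hsub := (coarsen_spec (G₂ := G₂) u).1
  have b2 := h₂.upper (coarsen G₁ G₂ u) j i (hsub hju) (hsub hiu)
  obtain ⟨s, hs⟩ := exists_son_of_mem (coarsen G₁ G₂ u).2 (hsub hiu)
  obtain ⟨s', hs'⟩ := exists_son_of_mem (coarsen G₁ G₂ u).2 (hsub hju)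
  have hij := Son.lt_of_lt hlt hi hj
  have hne : s ≠ s' := by
    rintro rfl
    have h1 : s.1 ⊆ w.1 := son_subset_of_mem hG hi hs
    exact hlt.ne (Son.eq_of_mem (h1 hs') hj)
  have b1 := h₂.lower _ s s' i j (Son.lt_of_mem_lt hne hs hs' hij) hs hs'
  rw [inv_mul_le_iff₀ hE] at a1 b1
  have a3 := (le_abs_self _).trans a2
  have b3 := (le_abs_self _).trans b2
  have c1 : (2 : ℝ) ^ k₁ u ≤ 2 ^ (k₂ (coarsen G₁ G₂ u) + D) := by
    rw [zpow_add₀ (by norm_num), zpow_natCast]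
    calc (2 : ℝ) ^ k₁ u ≤ E * (ξ j - ξ i) := a1
      _ ≤ E * (E * 2 ^ k₂ (coarsen G₁ G₂ u)) := by gcongr
      _ = 2 ^ k₂ (coarsen G₁ G₂ u) * E ^ 2 := by ring
      _ ≤ _ := by gcongr
  have c2 : (2 : ℝ) ^ k₂ (coarsen G₁ G₂ u) ≤ 2 ^ (k₁ u + D) := by
    rw [zpow_add₀ (by norm_num), zpow_natCast]
    calc (2 : ℝ) ^ k₂ (coarsen G₁ G₂ u) ≤ E * (ξ j - ξ i) := b1
      _ ≤ E * (E * 2 ^ k₁ u) := by gcongr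
      _ = 2 ^ k₁ u * E ^ 2 := by ring
      _ ≤ _ := by gcongr
  rw [zpow_le_zpow_iff_right₀ (by norm_num)] at c1 c2
  rw [Finset.mem_Icc]
  omega

/-- A vertex of the coarser tree as a vertex of the finer one. -/
def refine (hG : G₂.verts ⊆ G₁.verts) (v : G₂.inner) : G₁.inner :=
  ⟨v.1, mem_inner.2 ⟨hG (inner_mem_verts v), (mem_inner.1 v.2).2⟩⟩

theorem coarsen_refine (hG : G₂.verts ⊆ G₁.verts) (v : G₂.inner) :
    coarsen G₁ G₂ (refine hG v) = v :=
  Subtype.ext (coarsen_of_mem (u := refine hG v) (inner_mem_verts v))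

/-- Conditions on the scales of the finer tree amount to shifts of the scales. -/
theorem exists_scale_shift (hG : G₂.verts ⊆ G₁.verts) (K₁ K₂ D : ℕ) (δ : G₁.inner → ℤ)
    (hδ : ∀ u, δ u ∈ Finset.Icc (-(D : ℤ)) D) :
    (∃ s : G₂.inner → ℤ, (∀ w, |s w| ≤ 2 ^ n * (2 * D)) ∧ ∀ k : G₂.inner → ℤ,
      (k ∈ G₂.scaleTuples K₂ ∧ (fun u => k (coarsen G₁ G₂ u) + δ u) ∈ G₁.scaleTuples K₁) ↔
        (fun w => k w + s w) ∈ G₂.scaleTuples (max K₁ K₂)) ∨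
    ∀ k : G₂.inner → ℤ, ¬ (k ∈ G₂.scaleTuples K₂ ∧
      (fun u => k (coarsen G₁ G₂ u) + δ u) ∈ G₁.scaleTuples K₁) := by
  classical
  -- On a contracted edge both scales come from the same k, and the condition concerns δ alone. If
  -- it fails, no k is admissible and the second alternative holds.
  by_cases hint : ∀ u v : G₁.inner, v.1 ∈ G₁.sons u.1 → coarsen G₁ G₂ v = coarsen G₁ G₂ u →
      δ v + K₁ ≤ δ u
  swap
  · right
    rintro k ⟨-, hk⟩
    apply hint
    intro u v huv he
    have := hk u v huv
    simp only [he] at this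
    omega
  left
  -- The parent of v in `G₁` has the parent of v in `G₂` as its hull. The two conditions on this
  -- edge therefore merge into one with separation max(K₂, K₁ + δ_v - δ_parent); `e v` is its
  -- deviation from max(K₁, K₂).
  let e : G₂.inner → ℤ := fun v =>
    max (K₂ : ℤ) (K₁ + δ (refine hG v) - δ (G₁.parent (refine hG v))) - max (K₁ : ℤ) K₂
  have he : ∀ v, |e v| ≤ 2 * D := by
    intro v
    have h1 := Finset.mem_Icc.1 (hδ (refine hG v))
    have h2 := Finset.mem_Icc.1 (hδ (G₁.parent (refine hG v)))
    simp only [e]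
    rw [abs_le]
    constructor
    · rcases le_total (K₁ : ℤ) K₂ with h | h
      · have := le_max_left (K₂ : ℤ) (K₁ + δ (refine hG v) - δ (G₁.parent (refine hG v)))
        rw [max_eq_right h]
        omega
      · have := le_max_right (K₂ : ℤ) (K₁ + δ (refine hG v) - δ (G₁.parent (refine hG v)))
        rw [max_eq_left h]
        omega
    · have h3 := le_max_left (K₁ : ℤ) K₂
      have h4 := le_max_right (K₁ : ℤ) K₂
      have : max (K₂ : ℤ) (K₁ + δ (refine hG v) - δ (G₁.parent (refine hG v))) ≤
          max (K₁ : ℤ) K₂ + 2 * D := max_le (by omega) (by omega)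
      omega
  -- Summing `e` over the path from w up to, but not including, the root makes `s` change by exactly
  -- `e v` along the edge above v.
  let s : G₂.inner → ℤ := fun w =>
    ∑ v ∈ Finset.univ.filter (fun v : G₂.inner => w.1 ⊆ v.1 ∧ v.1 ≠ Finset.univ), e v
  have hs : ∀ w v : G₂.inner, v.1 ∈ G₂.sons w.1 → s v = e v + s w := by
    intro w v hv
    have hv' := mem_sons.1 hv
    have h1 : Finset.univ.filter (fun x : G₂.inner => v.1 ⊆ x.1 ∧ x.1 ≠ Finset.univ) =
        insert v (Finset.univ.filter fun x : G₂.inner => w.1 ⊆ x.1 ∧ x.1 ≠ Finset.univ) := by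
      ext x
      simp only [Finset.mem_filter, Finset.mem_univ, true_and, Finset.mem_insert]
      constructor
      · rintro ⟨h2, h3⟩
        by_cases hvx : x = v
        · exact Or.inl hvx
        refine Or.inr ⟨?_, h3⟩
        obtain ⟨i, hi⟩ := nonempty_of_mem hv'.1
        have hss : v.1 ⊂ x.1 := h2.ssubset_of_ne fun h => hvx (Subtype.ext h.symm)
        rcases comparable (inner_mem_verts w) (inner_mem_verts x) (hv'.2.1.1 hi) (h2 hi) with h4 | h4
        · exact h4
        · by_cases hwx : x.1 = w.1
          · exact hwx.symm.subset
          · exact absurd (h4.ssubset_of_ne hwx) (hv'.2.2 _ (inner_mem_verts x) hss)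
      · rintro (rfl | ⟨h2, h3⟩)
        · exact ⟨subset_rfl, son_ne_univ hv⟩
        · exact ⟨hv'.2.1.1.trans h2, h3⟩
    simp only [s]
    rw [h1, Finset.sum_insert]
    simp only [Finset.mem_filter, Finset.mem_univ, true_and, not_and]
    exact fun h => absurd h hv'.2.1.2
  refine ⟨s, fun w => ?_, fun k => ?_⟩
  · refine (Finset.abs_sum_le_sum_abs _ _).trans ((Finset.sum_le_sum fun v _ => he v).trans ?_)
    rw [Finset.sum_const, nsmul_eq_mul]
    refine mul_le_mul_of_nonneg_right ?_ (by positivity)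
    have h1 : (Finset.univ.filter (fun v : G₂.inner => w.1 ⊆ v.1 ∧ v.1 ≠ Finset.univ)).card ≤
        2 ^ n := by
      refine (Finset.card_le_univ _).trans ?_
      rw [Fintype.card_coe]
      exact (Finset.card_le_univ _).trans (by simp)
    exact_mod_cast h1
  · have hpar : ∀ w v : G₂.inner, v.1 ∈ G₂.sons w.1 →
        (refine hG v).1 ∈ G₁.sons (G₁.parent (refine hG v)).1 ∧
          coarsen G₁ G₂ (G₁.parent (refine hG v)) = w := by
      intro w v hv
      have h1 := mem_sons_parent (G := G₁) (v := refine hG v) (son_ne_univ hv)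
      refine ⟨h1, ?_⟩
      rcases coarsen_eq_or_mem (G₂ := G₂) hG h1 with h2 | ⟨h2, h3, h4⟩
      · exfalso
        rw [coarsen_refine] at h2
        have h5 := (coarsen_spec (G₂ := G₂) (G₁.parent (refine hG v))).1
        rw [← h2] at h5
        exact (mem_sons.1 h1).2.1.2 h5
      · exact Subtype.ext (eq_of_common_son (inner_mem_verts _) (inner_mem_verts _) h4 hv)
    have key : (fun w => k w + s w) ∈ G₂.scaleTuples (max K₁ K₂) ↔
        ∀ w v : G₂.inner, v.1 ∈ G₂.sons w.1 →
          k v + max (K₂ : ℤ) (K₁ + δ (refine hG v) - δ (G₁.parent (refine hG v))) ≤ k w := by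
      refine forall₃_congr fun w v hv => ?_
      simp only [hs w v hv, e]
      push_cast
      constructor <;> intro h <;> omega
    rw [key]
    constructor
    · rintro ⟨h1, h2⟩ w v hv
      have h3 := h1 w v hv
      obtain ⟨h4, h5⟩ := hpar w v hv
      have h6 := h2 _ _ h4
      simp only [h5, coarsen_refine] at h6
      rcases max_cases (K₂ : ℤ) (K₁ + δ (refine hG v) - δ (G₁.parent (refine hG v))) with h | h <;>
        omega
    · intro h
      refine ⟨fun w v hv => ?_, fun u v huv => ?_⟩
      · have h1 := h w v hv
        have := le_max_left (K₂ : ℤ) (K₁ + δ (refine hG v) - δ (G₁.parent (refine hG v)))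
        omega
      · rcases coarsen_eq_or_mem (G₂ := G₂) hG huv with h2 | ⟨h2, h3, h4⟩
        · have := hint u v huv h2
          simp only [h2]
          omega
        · set v₂ : G₂.inner := ⟨v.1, mem_inner.2 ⟨h2, (mem_inner.1 v.2).2⟩⟩ with hv₂
          have hr : refine hG v₂ = v := rfl
          have hc : coarsen G₁ G₂ v = v₂ := Subtype.ext h3
          have h5 := h (coarsen G₁ G₂ u) v₂ h4
          rw [hr, parent_eq huv] at h5
          have := le_max_right (K₂ : ℤ) (K₁ + δ v - δ u)
          simp only [hc]
          omega

end Compare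

end PlaneTree
end

/-! ### Level sums as smooth factors, and control of the constants -/

noncomputable section

namespace ShiftedDyadic

/-- The interval with given position relative to the scale `k` and the point `p`. -/
def near (k : ℤ) (p : ℝ) (ρ : ℤ × ℤ × Fin 3) : ShiftedDyadic :=
  ⟨k + ρ.1, ⌊p / 2 ^ (k + ρ.1)⌋ + ρ.2.1, ρ.2.2⟩

theorem near_injective (k : ℤ) (p : ℝ) : Function.Injective (near k p) := by
  rintro ⟨a, b, s⟩ ⟨a', b', s'⟩ h
  simp only [near, ShiftedDyadic.mk.injEq] at h
  obtain ⟨h1, h2, h3⟩ := h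
  obtain rfl : a = a' := by omega
  obtain rfl : b = b' := by omega
  rw [h3]

theorem near_sub (I : ShiftedDyadic) (k : ℤ) (p : ℝ) :
    near k p (I.scale - k, I.pos - ⌊p / 2 ^ I.scale⌋, I.shift) = I := by
  simp [near]

end ShiftedDyadic

namespace PlaneTree

variable {n : ℕ} {G G₁ G₂ : PlaneTree n}

section LevelSum

variable {A c : ℝ} {B : ℕ → ℝ}
  {F : ℕ → (u : G.inner) → Set (DyadicBox (G.Son u.1))}
  {scale : ℕ → (u : G.inner) → DyadicBox (G.Son u.1) → ℤ}
  {Φ : ℕ → (u : G.inner) → DyadicBox (G.Son u.1) → G.Son u.1 → ℝ → ℂ}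

open Classical in
/-- Sums over the boxes of a given scale can be expanded into tensor products on sets of at most
that size. -/
theorem IsData.unifExp_levelSum (hD : IsData A c B F scale Φ) (hA : 1 ≤ A) (u : G.inner)
    {S 𝓠 : Type} [Fintype S] [Nonempty S] (τ : 𝓠 → ℤ) (d : ℤ) (ν : 𝓠 → ℕ) (R : 𝓠 → Set (S → ℝ))
    (a : G.Son u.1 → S → ℝ) (p : 𝓠 → G.Son u.1 → ℝ) {r : ℝ} (hr : 0 < r)
    (hR : ∀ q, ∀ x ∈ R q, ∀ i, |∑ s, a i s * x s - p q i| ≤ r * 2 ^ τ q) :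
    UnifExp (fun q => (2 : ℝ) ^ τ q) R fun q x => levelSum (F (ν q) u) (scale (ν q) u)
      (fun Q => ∏ i, Φ (ν q) u Q i (∑ s, a i s * x s)) (τ q + d) := by
  have hA0 : 0 < A := by linarith
  obtain ⟨t, ht⟩ := ShiftedDyadic.exists_relative_bound hA (r := r * 2 ^ (-d)) (by positivity)
  have h2 : ∀ q, r * (2 : ℝ) ^ τ q = r * 2 ^ (-d) * 2 ^ (τ q + d) := fun q => by
    rw [mul_assoc, ← zpow_add₀ two_ne_zero]; congr 2; ring
  set box : 𝓠 → (G.Son u.1 → ℤ × ℤ × Fin 3) → DyadicBox (G.Son u.1) := fun q ρ i =>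
    ShiftedDyadic.near (τ q + d) (p q i) (ρ i) with hbox
  have hinj : ∀ q, Function.Injective (box q) := fun q ρ ρ' h => funext fun i =>
    ShiftedDyadic.near_injective _ _ (congrFun h i)
  set 𝓡 : Finset (G.Son u.1 → ℤ × ℤ × Fin 3) := Fintype.piFinset fun _ =>
    Finset.Icc (-(t : ℤ)) t ×ˢ (Finset.Icc (-(t : ℤ)) t ×ˢ Finset.univ) with h𝓡
  -- Boxes are indexed by their offsets from the reference scale and point, so that the finite index
  -- set is the same for all `q`. An offset whose box is not in the family at this scale contributes
  -- the zero function.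
  set f : (G.Son u.1 → ℤ × ℤ × Fin 3) → G.Son u.1 → 𝓠 → ℝ → ℂ := fun ρ i q =>
    if box q ρ ∈ F (ν q) u ∧ scale (ν q) u (box q ρ) = τ q + d then Φ (ν q) u (box q ρ) i
    else fun _ => 0 with hf
  have hT : ∀ q, (0 : ℝ) < 2 ^ τ q := fun q => by positivity
  have hfs : ∀ ρ i q,
      SmoothBdd (fun l => |B l| * (10 / 9 * A * 2 ^ (-d)) ^ l) (2 ^ τ q) (f ρ i q) := by
    intro ρ i q
    by_cases h : box q ρ ∈ F (ν q) u ∧ scale (ν q) u (box q ρ) = τ q + d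
    · simp only [hf, if_pos h]
      obtain ⟨-, -, h3, h4⟩ := hD.cond _ _ _ h.1
      have hl := (box q ρ i).length_pos
      refine (isBump_iff.1 (h4 i)).1.rescale (by positivity) (hT q) ?_
      have h5 := (h3 i).1
      rw [h.2, inv_mul_le_iff₀ hA0] at h5
      have h6 : (2 : ℝ) ^ τ q = 2 ^ (-d) * 2 ^ (τ q + d) := by
        rw [← zpow_add₀ two_ne_zero]; congr 1; ring
      rw [h6]
      have h7 : (0 : ℝ) < 2 ^ (-d) := by positivity
      nlinarith
    · simp only [hf, if_neg h]
      refine (SmoothBdd.const 0 _).mono (hT q).le fun l => ?_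
      simp only [norm_zero, ite_self]
      positivity
  have key : UnifExp (fun q => (2 : ℝ) ^ τ q) R fun q x =>
      ∑ ρ ∈ 𝓡, ∏ i, f ρ i q (∑ s, a i s * x s) :=
    UnifExp.sum 𝓡 hT fun ρ _ => UnifExp.prod Finset.univ hT fun i _ =>
      UnifExp.comp_linear hT (hfs ρ i) (a i) (fun q => p q i) hr fun q x hx => hR q x hx i
  refine key.congr fun q x hx => ?_
  rw [levelSum_eq (𝒬 := 𝓡.image (box q)), Finset.sum_image fun _ _ _ _ h => hinj q h]
  · refine Finset.sum_congr rfl fun ρ _ => ?_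
    by_cases h : box q ρ ∈ F (ν q) u ∧ scale (ν q) u (box q ρ) = τ q + d
    · simp only [hf, if_pos h]
    · simp only [hf, if_neg h]
      simp
  · intro Q hQ hs hne
    refine Finset.mem_image.2 ⟨fun i => ((Q i).scale - (τ q + d),
      (Q i).pos - ⌊p q i / 2 ^ (Q i).scale⌋, (Q i).shift), ?_, funext fun i =>
        ShiftedDyadic.near_sub _ _ _⟩
    refine Fintype.mem_piFinset.2 fun i => ?_
    have h3 := (hD.cond _ _ _ hQ).2.2.1 i
    rw [hs] at h3
    have h4 := ht (Q i) (τ q + d) (p q i) _ h3.1 h3.2 (hD.mem_toSet hQ hne i)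
      (by rw [← h2]; exact hR q x hx i)
    simpa only [Finset.mem_product, Finset.mem_univ, and_true] using h4

/-- The position of a point at which the bumps do not vanish. -/
theorem IsData.located (hD : IsData A c B F scale Φ) (hA : 1 ≤ A) {ν : ℕ}
    {P : (u : G.inner) → DyadicBox (G.Son u.1)} (hP : ∀ u, P u ∈ F ν u) {ξ : Fin n → ℝ}
    (h : ∀ u, ∏ i, Φ ν u (P u) i (G.sonSums u.1 ξ i) ≠ 0) :
    G.Located (6 * n * A ^ 2) (fun u => scale ν u (P u)) ξ := by
  have hA0 : 0 < A := by linarith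
  intro u i j hij
  obtain ⟨h1, h2, h3, h4⟩ := hD.cond ν u _ (hP u)
  have hg := (h2 i j hij).gap hA0 (weight_pos _ i) (weight_le_one _ i) (weight_pos _ j)
    (weight_le_one _ j) (hD.mem_toSet (hP u) (h u) i) (hD.mem_toSet (hP u) (h u) j)
  have hn : (1 : ℝ) ≤ n := by exact_mod_cast pos_of_son i
  have h2k : (0 : ℝ) < 2 ^ scale ν u (P u) := by positivity
  refine ⟨le_trans ?_ hg.1, hg.2.trans ?_⟩
  · have hw := le_weight u.1 j
    have h5 := (h3 i).1
    have h6 : (6 * n * A ^ 2)⁻¹ * (2 : ℝ) ^ scale ν u (P u) ≤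
        1 / n * A⁻¹ * (A⁻¹ * 2 ^ scale ν u (P u)) / 2 := by
      have : 1 / n * A⁻¹ * (A⁻¹ * 2 ^ scale ν u (P u)) / 2 =
          3 * ((6 * n * A ^ 2)⁻¹ * (2 : ℝ) ^ scale ν u (P u)) := by field_simp; norm_num
      rw [this]
      have : 0 < (6 * n * A ^ 2)⁻¹ * (2 : ℝ) ^ scale ν u (P u) := by positivity
      linarith
    refine h6.trans ?_
    have h7 := weight_pos u.1 j
    gcongr
  · have h5 := (h3 i).2
    have h6 := (h3 j).2
    calc (2 * A + 1) * ((P u i).length + (P u j).length)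
        ≤ (3 * A) * (A * 2 ^ scale ν u (P u) + A * 2 ^ scale ν u (P u)) := by
          have l1 := (P u i).length_pos
          have l2 := (P u j).length_pos
          exact mul_le_mul (by linarith) (add_le_add h5 h6) (by positivity) (by positivity)
      _ = 6 * 1 * A ^ 2 * 2 ^ scale ν u (P u) := by ring
      _ ≤ 6 * n * A ^ 2 * 2 ^ scale ν u (P u) := by gcongr

end LevelSum


/-- The constant in the estimates for differences of coordinates. -/
def sepConst (n : ℕ) (A : ℝ) : ℝ := 4 * n * (6 * n * A ^ 2)

/-- The separation of scales that is needed in the estimates for differences of coordinates. -/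
def sepExp (n : ℕ) (A : ℝ) : ℕ := ⌈sepConst n A ^ 4⌉₊

/-- A bound for the differences of the scales of two trees at the same point. -/
def scaleDiff (n : ℕ) (A : ℝ) : ℕ := ⌈sepConst n A ^ 2⌉₊

/-- The constant of a product of two symbols. -/
def prodConst (n : ℕ) (A : ℝ) : ℝ := A * 2 ^ (2 ^ n * (2 * scaleDiff n A))

theorem sepConst_pos (hn : 1 ≤ n) {A : ℝ} (hA : 1 ≤ A) : 0 < sepConst n A := by
  have : (0 : ℝ) < n := by exact_mod_cast hn
  unfold sepConst; positivity

theorem sepConst_mono {A A' : ℝ} (hA : 1 ≤ A) (h : A ≤ A') : sepConst n A ≤ sepConst n A' := by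
  unfold sepConst; gcongr

theorem le_two_pow_ceil (x : ℝ) : x < 2 ^ ⌈x⌉₊ :=
  (Nat.le_ceil x).trans_lt (by exact_mod_cast Nat.lt_two_pow_self)

theorem le_prodConst {A : ℝ} (hA : 1 ≤ A) : A ≤ prodConst n A := by
  unfold prodConst
  exact le_mul_of_one_le_right (by linarith) (one_le_pow₀ one_le_two)

section Data

variable {A c : ℝ} {B : ℕ → ℝ} {C : ℕ → ℂ} {K : ℕ}
  {F : ℕ → (u : G.inner) → Set (DyadicBox (G.Son u.1))}
  {scale : ℕ → (u : G.inner) → DyadicBox (G.Son u.1) → ℤ}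
  {Φ : ℕ → (u : G.inner) → DyadicBox (G.Son u.1) → G.Son u.1 → ℝ → ℂ}

theorem IsData.pairEst (hn : 1 ≤ n) (hD : IsData A c B F scale Φ) (hA : 1 ≤ A)
    (hK : sepExp n A ≤ K) {ν : ℕ} {P : (u : G.inner) → DyadicBox (G.Son u.1)}
    (hP : ∀ u, P u ∈ F ν u) {ξ : Fin n → ℝ}
    (h : ∀ u, ∏ i, Φ ν u (P u) i (G.sonSums u.1 ξ i) ≠ 0)
    (hS : (fun u => scale ν u (P u)) ∈ G.scaleTuples K) :
    G.PairEst (sepConst n A) (fun u => scale ν u (P u)) ξ := by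
  have hn' : (1 : ℝ) ≤ n := by exact_mod_cast hn
  have hA2 : 1 ≤ A ^ 2 := one_le_pow₀ hA
  have hM : 1 ≤ 6 * n * A ^ 2 := by nlinarith
  refine Located.pairEst hM hS ?_ (hD.located hA hP h)
  have h1 : sepConst n A ^ 4 ≤ 2 ^ K :=
    (le_two_pow_ceil _).le.trans (pow_le_pow_right₀ one_le_two hK)
  refine le_trans ?_ h1
  unfold sepConst
  set M := 6 * n * A ^ 2
  have h2 : (n : ℝ) ≤ n ^ 4 := le_self_pow₀ hn' (by norm_num)
  have h3 : M ^ 2 ≤ M ^ 4 := pow_le_pow_right₀ hM (by norm_num)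
  calc 8 * n * M ^ 2 ≤ 256 * n ^ 4 * M ^ 4 := by gcongr; norm_num
    _ = (4 * n * M) ^ 4 := by ring

/-- Changing the labels of the scales by at most N weakens only the relation between box and label,
by 2^N. This is how bounded shifts of the scales are paid for by the constant A. -/
theorem IsData.shift (hD : IsData A c B F scale Φ) (hA : 1 ≤ A) {N : ℕ} (s : G.inner → ℤ)
    (hs : ∀ u, |s u| ≤ N) :
    IsData (A * 2 ^ N) c B F (fun ν u Q => scale ν u Q + s u) Φ := by
  have hA0 : 0 < A := by linarith
  have hA' : A ≤ A * 2 ^ N := le_mul_of_one_le_right hA0.le (one_le_pow₀ one_le_two)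
  have hinv : (A * 2 ^ N)⁻¹ ≤ A⁻¹ := inv_anti₀ hA0 hA'
  refine ⟨hD.sparse, fun ν u Q hQ => ?_⟩
  obtain ⟨h1, h2, h3, h4⟩ := hD.cond ν u Q hQ
  have h2N : (0 : ℝ) < 2 ^ N := by positivity
  have hk : (0 : ℝ) < 2 ^ scale ν u Q := by positivity
  have hs1 : (2 : ℝ) ^ s u ≤ 2 ^ N := by
    rw [← zpow_natCast]; exact zpow_le_zpow_right₀ one_le_two (abs_le.1 (hs u)).2
  have hs2 : 1 ≤ (2 : ℝ) ^ N * 2 ^ s u := by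
    rw [← zpow_natCast, ← zpow_add₀ two_ne_zero]
    exact one_le_zpow₀ one_le_two (by have := (abs_le.1 (hs u)).1; omega)
  refine ⟨fun i j => (h1 i j).trans ?_, fun i j hij => ?_, fun i => ⟨?_, ?_⟩, h4⟩
  · have := (Q j).length_pos
    gcongr
  · obtain ⟨h5, h6, p, hp, q, hq, h7⟩ := h2 i j hij
    have hd := Metric.diam_nonneg (s := DyadicBox.planeBox (Q i) (Q j))
    refine ⟨h5, fun p hp q hq => le_trans (by gcongr) (h6 p hp q hq), p, hp, q, hq,
      h7.trans (by gcongr)⟩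
  · refine le_trans ?_ (h3 i).1
    rw [zpow_add₀ two_ne_zero, mul_inv]
    calc A⁻¹ * (2 ^ N)⁻¹ * (2 ^ scale ν u Q * 2 ^ s u)
        ≤ A⁻¹ * (2 ^ N)⁻¹ * (2 ^ scale ν u Q * 2 ^ N) := by gcongr
      _ = A⁻¹ * 2 ^ scale ν u Q := by field_simp
  · refine (h3 i).2.trans ?_
    rw [zpow_add₀ two_ne_zero]
    calc A * 2 ^ scale ν u Q = A * 2 ^ scale ν u Q * 1 := by ring
      _ ≤ A * 2 ^ scale ν u Q * (2 ^ N * 2 ^ s u) := by gcongr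
      _ = A * 2 ^ N * (2 ^ scale ν u Q * 2 ^ s u) := by ring

theorem IsData.comp (hD : IsData A c B F scale Φ) (g : ℕ → ℕ) :
    IsData A c B (fun ν => F (g ν)) (fun ν => scale (g ν)) (fun ν => Φ (g ν)) :=
  ⟨fun ν => hD.sparse (g ν), fun ν => hD.cond (g ν)⟩

/-- At a fixed point the boxes that matter lie in finite sets independent of ν, and all factors are
bounded uniformly in ν. The series is thus dominated by a multiple of ∑ ‖C ν‖. -/
theorem summable_of_unifExp (hA : 1 ≤ A) (hC : RapidlyDecreasing C) (hD : IsData A c B F scale Φ)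
    (S : Set (G.inner → ℤ)) (H : (u : G.inner) → ℕ → DyadicBox (G.Son u.1) → (G.Son u.1 → ℝ) → ℂ)
    (hH : ∀ u, UnifExp (𝓠 := {q : ℕ × DyadicBox (G.Son u.1) // q.2 ∈ F q.1 u})
      (fun q => (2 : ℝ) ^ scale q.1.1 u q.1.2) (fun q => {x | ∀ i, x i ∈ (q.1.2 i).toSet})
      (fun q => H u q.1.1 q.1.2)) (ξ : Fin n → ℝ) :
    Summable fun ν => C ν * treeSum S (F ν) (scale ν)
      fun u Q => (∏ i, Φ ν u Q i (G.sonSums u.1 ξ i)) * H u ν Q (G.sonSums u.1 ξ) := by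
  set 𝒬 : (u : G.inner) → Finset (DyadicBox (G.Son u.1)) := fun u =>
    boxesAt u hA (G.sonSums u.1 ξ)
  choose b hb using fun u => (hH u).bounded
  refine Summable.of_norm_bounded (g := fun ν => ‖C ν‖ * ∑ _P ∈ Fintype.piFinset 𝒬,
    ∏ u : G.inner, (|B 0| ^ Fintype.card (G.Son u.1) * |b u|))
    (hC.summable_norm.mul_right _) fun ν => ?_
  rw [norm_mul]
  refine mul_le_mul_of_nonneg_left (norm_treeSum_le (𝒬 := 𝒬)
    (fun u Q hQ h => hD.mem_boxesAt hA hQ (left_ne_zero_of_mul h))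
    (fun u => by positivity) fun u Q hQ hQ' => ?_) (norm_nonneg _)
  rw [norm_mul, norm_prod]
  refine mul_le_mul ?_ ?_ (norm_nonneg _) (by positivity)
  · refine (Finset.prod_le_prod (g := fun _ => |B 0|) (fun _ _ => norm_nonneg _)
      fun i _ => ?_).trans (by simp)
    have := ((hD.cond ν u Q hQ).2.2.2 i).2.2 0 (G.sonSums u.1 ξ i)
    simp only [iteratedDeriv_zero, pow_zero, inv_one, mul_one] at this
    exact this.trans (le_abs_self _)
  · exact (hb u ⟨(ν, Q), hQ⟩ _ (mem_of_mem_boxesAt hQ')).trans (le_abs_self _)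

-- The labels of the scales matter only through the admissibility of tuples, so they may be shifted
-- together with the set of admissible tuples.
open Classical in
theorem treeSum_congr {S S' : Set (G.inner → ℤ)} {F : (u : G.inner) → Set (DyadicBox (G.Son u.1))}
    {scale scale' : (u : G.inner) → DyadicBox (G.Son u.1) → ℤ}
    {Ψ : (u : G.inner) → DyadicBox (G.Son u.1) → ℂ}
    {𝒬 : (u : G.inner) → Finset (DyadicBox (G.Son u.1))}
    (h : ∀ u, ∀ Q ∈ F u, Ψ u Q ≠ 0 → Q ∈ 𝒬 u)
    (hS : ∀ P : (u : G.inner) → DyadicBox (G.Son u.1),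
      (fun u => scale u (P u)) ∈ S ↔ (fun u => scale' u (P u)) ∈ S') :
    treeSum S F scale Ψ = treeSum S' F scale' Ψ := by
  rw [treeSum_eq h, treeSum_eq h]
  simp only [hS]

open Classical in
/-- The scales of one tree, in terms of those of another one at the same point. -/
theorem IsData.treeSum_eq_sum_shifts (hn : 1 ≤ n) {G' : PlaneTree n} (hG : G'.verts ⊆ G.verts)
    (hD : IsData A c B F scale Φ) (hA : 1 ≤ A) (hK : sepExp n A ≤ K) {A' : ℝ} (hA' : A ≤ A')
    {k' : G'.inner → ℤ} {ξ : Fin n → ℝ} (h' : G'.PairEst (sepConst n A') k' ξ) (ν : ℕ) :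
    (treeSum (G.scaleTuples K) (F ν) (scale ν) fun u Q =>
      ∏ i, Φ ν u Q i (G.sonSums u.1 ξ i)) =
    ∑ δ ∈ Fintype.piFinset fun _ => Finset.Icc (-(scaleDiff n A' : ℤ)) (scaleDiff n A'),
      if (fun u => k' (coarsen G G' u) + δ u) ∈ G.scaleTuples K then
        ∏ u, levelSum (F ν u) (scale ν u) (fun Q => ∏ i, Φ ν u Q i (G.sonSums u.1 ξ i))
          (k' (coarsen G G' u) + δ u) else 0 := by
  set Δ : Finset (G.inner → ℤ) :=
    Fintype.piFinset fun _ => Finset.Icc (-(scaleDiff n A' : ℤ)) (scaleDiff n A')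
  set sh : (G.inner → ℤ) → G.inner → ℤ := fun δ u => k' (coarsen G G' u) + δ u with hsh
  have hinj : Function.Injective sh := fun δ δ' h => funext fun u => by
    simpa [hsh] using congrFun h u
  unfold treeSum
  rw [← Finset.sum_filter, ← Finset.sum_image (s := Δ.filter fun δ => sh δ ∈ G.scaleTuples K)
    (g := sh) (f := fun k => ∏ u, levelSum (F ν u) (scale ν u)
      (fun Q => ∏ i, Φ ν u Q i (G.sonSums u.1 ξ i)) (k u)) fun _ _ _ _ h => hinj h]
  refine finsum_mem_eq_sum_of_inter_support_eq _ (Set.ext fun k => ?_)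
  simp only [Set.mem_inter_iff, Function.mem_support, Finset.coe_image, Finset.coe_filter]
  constructor
  · rintro ⟨hk, hne⟩
    refine ⟨⟨fun u => k u - k' (coarsen G G' u), ⟨?_, ?_⟩, ?_⟩, hne⟩
    · have h1 : ∀ u, ∃ Q ∈ F ν u, scale ν u Q = k u ∧
          ∏ i, Φ ν u Q i (G.sonSums u.1 ξ i) ≠ 0 := by
        intro u
        have h2 := Finset.prod_ne_zero_iff.1 hne u (Finset.mem_univ u)
        unfold levelSum at h2
        obtain ⟨Q, hQ, h3⟩ := exists_ne_zero_of_finsum_mem_ne_zero h2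
        exact ⟨Q, hQ.1, hQ.2, h3⟩
      choose P hP hs h3 using h1
      obtain rfl : (fun u => scale ν u (P u)) = k := funext hs
      have h4 := (hD.pairEst hn hA hK hP h3 hk).mono (sepConst_pos hn hA) (sepConst_mono hA hA')
      exact Fintype.mem_piFinset.2 fun u => scales_close (sepConst_pos hn (hA.trans hA')) h4 h' hG
        (le_two_pow_ceil _).le u
    · simpa [hsh] using hk
    · simp [hsh]
  · rintro ⟨⟨δ, ⟨-, h2⟩, rfl⟩, hne⟩
    exact ⟨h2, hne⟩

end Data

end PlaneTree
end

/-! ### Products of standard symbols -/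

noncomputable section

namespace PlaneTree

variable {n : ℕ} {G₁ G₂ : PlaneTree n}

section Product

variable {A₁ A₂ c : ℝ} {K₁ K₂ : ℕ} {B₁ B₂ : ℕ → ℝ} {C₁ C₂ : ℕ → ℂ}
  {F₁ : ℕ → (u : G₁.inner) → Set (DyadicBox (G₁.Son u.1))}
  {F₂ : ℕ → (u : G₂.inner) → Set (DyadicBox (G₂.Son u.1))}
  {scale₁ : ℕ → (u : G₁.inner) → DyadicBox (G₁.Son u.1) → ℤ}
  {scale₂ : ℕ → (u : G₂.inner) → DyadicBox (G₂.Son u.1) → ℤ}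
  {Φ₁ : ℕ → (u : G₁.inner) → DyadicBox (G₁.Son u.1) → G₁.Son u.1 → ℝ → ℂ}
  {Φ₂ : ℕ → (u : G₂.inner) → DyadicBox (G₂.Son u.1) → G₂.Son u.1 → ℝ → ℂ}

open Classical in
/-- The factor at a vertex of the coarser tree that comes from the finer tree, if the scales differ
by `δ`. -/
def mergedFactor (F₁ : ℕ → (u : G₁.inner) → Set (DyadicBox (G₁.Son u.1)))
    (scale₁ : ℕ → (u : G₁.inner) → DyadicBox (G₁.Son u.1) → ℤ)
    (Φ₁ : ℕ → (u : G₁.inner) → DyadicBox (G₁.Son u.1) → G₁.Son u.1 → ℝ → ℂ)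
    (scale₂ : ℕ → (u : G₂.inner) → DyadicBox (G₂.Son u.1) → ℤ) (δ : G₁.inner → ℤ)
    (w : G₂.inner) (ν : ℕ) (Q : DyadicBox (G₂.Son w.1)) (x : G₂.Son w.1 → ℝ) : ℂ :=
  ∏ u ∈ Finset.univ.filter fun u => coarsen G₁ G₂ u = w,
    levelSum (F₁ ν.unpair.1 u) (scale₁ ν.unpair.1 u)
      (fun Q₁ => ∏ i, Φ₁ ν.unpair.1 u Q₁ i (∑ s, groupCoeff G₁ G₂ u w i s * x s))
      (scale₂ ν.unpair.2 w Q + δ u)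

theorem abs_groupCoeff_le (u : G₁.inner) (w : G₂.inner) (i : G₁.Son u.1) (s : G₂.Son w.1) :
    |groupCoeff G₁ G₂ u w i s| ≤ 1 := by
  unfold groupCoeff; split_ifs <;> simp

/-- The vertices of the finer tree are grouped by their hulls, and the sums over their sons are
rewritten in the variables of the hull. -/
theorem prod_mergedFactor (hG : G₂.verts ⊆ G₁.verts) (δ : G₁.inner → ℤ) (ν : ℕ)
    (P : (w : G₂.inner) → DyadicBox (G₂.Son w.1)) (ξ : Fin n → ℝ) :
    ∏ w, mergedFactor F₁ scale₁ Φ₁ scale₂ δ w ν (P w) (G₂.sonSums w.1 ξ) =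
      ∏ u, levelSum (F₁ ν.unpair.1 u) (scale₁ ν.unpair.1 u)
        (fun Q₁ => ∏ i, Φ₁ ν.unpair.1 u Q₁ i (G₁.sonSums u.1 ξ i))
        (scale₂ ν.unpair.2 (coarsen G₁ G₂ u) (P (coarsen G₁ G₂ u)) + δ u) := by
  classical
  rw [← Finset.prod_fiberwise Finset.univ (coarsen G₁ G₂)]
  refine Finset.prod_congr rfl fun w _ => ?_
  unfold mergedFactor
  refine Finset.prod_congr (by ext; simp) fun u hu => ?_
  obtain rfl := (Finset.mem_filter.1 hu).2
  simp only [← sonSums_coarsen hG]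

/-- On a box Q of the coarser tree the arguments of the finer bumps stay within `card * A₂ * 2 ^
scale` of their values at the centre of Q. The level sums at boundedly shifted scales then have
uniform expansions; `s` allows for relabelled scales. -/
theorem unifExp_mergedFactor (hD₁ : IsData A₁ c B₁ F₁ scale₁ Φ₁) (hA₁ : 1 ≤ A₁)
    (hD₂ : IsData A₂ c B₂ F₂ scale₂ Φ₂) (hA₂ : 1 ≤ A₂) (δ : G₁.inner → ℤ) (s : G₂.inner → ℤ)
    (w : G₂.inner) :
    UnifExp (𝓠 := {q : ℕ × DyadicBox (G₂.Son w.1) // q.2 ∈ F₂ q.1.unpair.2 w})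
      (fun q => (2 : ℝ) ^ (scale₂ q.1.1.unpair.2 w q.1.2 + s w))
      (fun q => {x | ∀ i, x i ∈ (q.1.2 i).toSet})
      (fun q => mergedFactor F₁ scale₁ Φ₁ scale₂ δ w q.1.1 q.1.2) := by
  classical
  unfold mergedFactor
  refine UnifExp.prod _ (fun q => by positivity) fun u _ => ?_
  have hA0 : 0 < A₂ := by linarith
  have := hD₁.unifExp_levelSum hA₁ u
    (𝓠 := {q : ℕ × DyadicBox (G₂.Son w.1) // q.2 ∈ F₂ q.1.unpair.2 w})
    (fun q => scale₂ q.1.1.unpair.2 w q.1.2 + s w) (δ u - s w) (fun q => q.1.1.unpair.1)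
    (fun q => {x | ∀ i, x i ∈ (q.1.2 i).toSet}) (groupCoeff G₁ G₂ u w)
    (fun q i => ∑ t, groupCoeff G₁ G₂ u w i t * (q.1.2 t).center)
    (r := Fintype.card (G₂.Son w.1) * A₂ * 2 ^ (-s w)) (by positivity) ?_
  · refine this.congr fun q x _ => ?_
    congr 1
    ring
  · intro q x hx i
    rw [← Finset.sum_sub_distrib]
    refine (Finset.abs_sum_le_sum_abs _ _).trans
      ((Finset.sum_le_card_nsmul _ _ (A₂ * 2 ^ scale₂ q.1.1.unpair.2 w q.1.2)
        fun t _ => ?_).trans ?_)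
    · rw [← mul_sub, abs_mul]
      have h1 : |x t - (q.1.2 t).center| ≤ (q.1.2 t).length := by
        refine ShiftedDyadic.abs_sub_le (hx t) ?_
        have := (q.1.2 t).length_pos
        simp only [ShiftedDyadic.toSet, ShiftedDyadic.center, Set.mem_Ioo]
        constructor <;> linarith
      have h2 := ((hD₂.cond _ _ _ q.2).2.2.1 t).2
      have h3 := abs_groupCoeff_le (G₁ := G₁) u w i t
      calc |groupCoeff G₁ G₂ u w i t| * |x t - (q.1.2 t).center| ≤ 1 * (q.1.2 t).length := by
            gcongr
        _ ≤ _ := by rw [one_mul]; exact h2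
    · rw [zpow_add₀ two_ne_zero, zpow_neg, nsmul_eq_mul, Finset.card_univ]
      have : (2 : ℝ) ^ s w ≠ 0 := by positivity
      apply le_of_eq
      field_simp

-- Only the sum for `G₂` is multiplied out into choices of boxes. A choice with a non-zero term pins
-- down the distances of the coordinates, and these confine the scales of `G₁` to finitely many
-- shifts of those of the chosen boxes.
open Classical in
theorem treeSum_mul_treeSum (hn : 1 ≤ n) (hG : G₂.verts ⊆ G₁.verts)
    (hD₁ : IsData A₁ c B₁ F₁ scale₁ Φ₁) (hA₁ : 1 ≤ A₁) (hK₁ : sepExp n A₁ ≤ K₁)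
    (hD₂ : IsData A₂ c B₂ F₂ scale₂ Φ₂) (hA : A₁ ≤ A₂) (hK₂ : sepExp n A₂ ≤ K₂)
    (ξ : Fin n → ℝ) (ν : ℕ) :
    (treeSum (G₁.scaleTuples K₁) (F₁ ν.unpair.1) (scale₁ ν.unpair.1) fun u Q =>
      ∏ i, Φ₁ ν.unpair.1 u Q i (G₁.sonSums u.1 ξ i)) *
    (treeSum (G₂.scaleTuples K₂) (F₂ ν.unpair.2) (scale₂ ν.unpair.2) fun u Q =>
      ∏ i, Φ₂ ν.unpair.2 u Q i (G₂.sonSums u.1 ξ i)) =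
    ∑ δ ∈ Fintype.piFinset fun _ => Finset.Icc (-(scaleDiff n A₂ : ℤ)) (scaleDiff n A₂),
      treeSum {k | k ∈ G₂.scaleTuples K₂ ∧
          (fun u => k (coarsen G₁ G₂ u) + δ u) ∈ G₁.scaleTuples K₁}
        (F₂ ν.unpair.2) (scale₂ ν.unpair.2) fun u Q =>
        (∏ i, Φ₂ ν.unpair.2 u Q i (G₂.sonSums u.1 ξ i)) *
          mergedFactor F₁ scale₁ Φ₁ scale₂ δ u ν Q (G₂.sonSums u.1 ξ) := by
  have hA₂ := hA₁.trans hA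
  set 𝒬 : (u : G₂.inner) → Finset (DyadicBox (G₂.Son u.1)) := fun u =>
    boxesAt u hA₂ (G₂.sonSums u.1 ξ)
  have hsup : ∀ u, ∀ Q ∈ F₂ ν.unpair.2 u,
      ∏ i, Φ₂ ν.unpair.2 u Q i (G₂.sonSums u.1 ξ i) ≠ 0 → Q ∈ 𝒬 u := fun u Q hQ h =>
    hD₂.mem_boxesAt hA₂ hQ h
  rw [treeSum_eq (𝒬 := 𝒬) hsup]
  simp only [fun δ S => treeSum_eq (S := S) (scale := scale₂ ν.unpair.2) (𝒬 := 𝒬)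
    (F := F₂ ν.unpair.2) (Ψ := fun u Q => (∏ i, Φ₂ ν.unpair.2 u Q i (G₂.sonSums u.1 ξ i)) *
      mergedFactor F₁ scale₁ Φ₁ scale₂ δ u ν Q (G₂.sonSums u.1 ξ))
    fun u Q hQ h => hsup u Q hQ (left_ne_zero_of_mul h)]
  rw [Finset.sum_comm, Finset.mul_sum]
  refine Finset.sum_congr rfl fun P _ => ?_
  by_cases hP : (∀ u, P u ∈ F₂ ν.unpair.2 u) ∧
    (fun u => scale₂ ν.unpair.2 u (P u)) ∈ G₂.scaleTuples K₂
  swap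
  · rw [if_neg hP, mul_zero, Finset.sum_eq_zero]
    intro δ _
    rw [if_neg fun h => hP ⟨h.1, h.2.1⟩]
  rw [if_pos hP]
  by_cases h0 : ∏ u, ∏ i, Φ₂ ν.unpair.2 u (P u) i (G₂.sonSums u.1 ξ i) = 0
  · rw [h0, mul_zero, Finset.sum_eq_zero]
    intro δ _
    rw [Finset.prod_mul_distrib, h0, zero_mul, ite_self]
  have hE := hD₂.pairEst hn hA₂ hK₂ hP.1
    (fun u => Finset.prod_ne_zero_iff.1 h0 u (Finset.mem_univ u)) hP.2
  rw [hD₁.treeSum_eq_sum_shifts hn hG hA₁ hK₁ hA hE, Finset.sum_mul]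
  refine Finset.sum_congr rfl fun δ _ => ?_
  rw [Finset.prod_mul_distrib, prod_mergedFactor hG]
  simp only [Set.mem_ofPred_eq, hP.1, hP.2, implies_true, true_and]
  split_ifs
  · exact mul_comm _ _
  · exact zero_mul _

/-- A standard symbol times one whose constant is not smaller: the latter determines the type. -/
theorem Std.mul_of_le (hn : 1 ≤ n) {m₁ m₂ : (Fin n → ℝ) → ℂ} (h₁ : G₁.Std A₁ K₁ c m₁)
    (h₂ : G₂.Std A₂ K₂ c m₂) (hA₁ : 1 ≤ A₁) (hA : A₁ ≤ A₂) (hK₁ : sepExp n A₁ ≤ K₁)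
    (hK₂ : sepExp n A₂ ≤ K₂) :
    G₂.Std (prodConst n A₂) (max K₁ K₂) c fun ξ => m₁ ξ * m₂ ξ := by
  classical
  obtain ⟨B₁, C₁, F₁, scale₁, Φ₁, hC₁, hD₁, hm₁⟩ := h₁
  obtain ⟨B₂, C₂, F₂, scale₂, Φ₂, hC₂, hD₂, hm₂⟩ := h₂
  have hA₂ := hA₁.trans hA
  have hm := fun ξ => hasSum_unpair_mul (hm₁ ξ) (hm₂ ξ)
  simp only [mul_mul_mul_comm] at hm
  -- If the inclusion fails, no point lies in the supports of two summands, and the product is zero.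
  by_cases hG : G₂.verts ⊆ G₁.verts
  swap
  · refine (Std.zero _ _ _ _).congr fun ξ => ?_
    refine hasSum_zero.unique (hasSum_of_eq (hm ξ) fun ν => ?_)
    rw [treeSum_eq (𝒬 := fun u => boxesAt u hA₁ (G₁.sonSums u.1 ξ))
        fun u Q hQ h => hD₁.mem_boxesAt hA₁ hQ h,
      treeSum_eq (𝒬 := fun u => boxesAt u hA₂ (G₂.sonSums u.1 ξ))
        fun u Q hQ h => hD₂.mem_boxesAt hA₂ hQ h, Finset.sum_mul_sum]
    symm
    refine mul_eq_zero_of_right _ (Finset.sum_eq_zero fun P₁ _ =>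
      Finset.sum_eq_zero fun P₂ _ => ?_)
    by_contra hne
    have h1 := left_ne_zero_of_mul hne
    have h2 := right_ne_zero_of_mul hne
    rw [ne_eq, ite_eq_right_iff, Classical.not_imp] at h1 h2
    have e1 := (hD₁.pairEst hn hA₁ hK₁ h1.1.1
      (fun u => Finset.prod_ne_zero_iff.1 h1.2 u (Finset.mem_univ u)) h1.1.2).mono
        (sepConst_pos hn hA₁) (sepConst_mono hA₁ hA)
    have e2 := hD₂.pairEst hn hA₂ hK₂ h2.1.1
      (fun u => Finset.prod_ne_zero_iff.1 h2.2 u (Finset.mem_univ u)) h2.1.2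
    exact hG (verts_subset_of_pairEst (sepConst_pos hn hA₂) e1 e2 h2.1.2
      ((le_two_pow_ceil _).trans_le (pow_le_pow_right₀ one_le_two hK₂)))
  set Δ : Finset (G₁.inner → ℤ) :=
    Fintype.piFinset fun _ => Finset.Icc (-(scaleDiff n A₂ : ℤ)) (scaleDiff n A₂)
  set T : (G₁.inner → ℤ) → ℕ → (Fin n → ℝ) → ℂ := fun δ ν ξ =>
    treeSum {k | k ∈ G₂.scaleTuples K₂ ∧
          (fun u => k (coarsen G₁ G₂ u) + δ u) ∈ G₁.scaleTuples K₁}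
        (F₂ ν.unpair.2) (scale₂ ν.unpair.2) fun u Q =>
        (∏ i, Φ₂ ν.unpair.2 u Q i (G₂.sonSums u.1 ξ i)) *
          mergedFactor F₁ scale₁ Φ₁ scale₂ δ u ν Q (G₂.sonSums u.1 ξ) with hT
  have hC := hC₁.pair hC₂
  have hD := hD₂.comp fun ν => ν.unpair.2
  have hsum : ∀ δ ξ, Summable fun ν : ℕ => (C₁ ν.unpair.1 * C₂ ν.unpair.2) * T δ ν ξ :=
    fun δ ξ => summable_of_unifExp hA₂ hC hD _
      (fun u ν => mergedFactor F₁ scale₁ Φ₁ scale₂ δ u ν)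
      (fun w => by simpa using unifExp_mergedFactor hD₁ hA₁ hD₂ hA₂ δ (fun _ => 0) w) ξ
  have key : ∀ δ ∈ Δ, G₂.Std (prodConst n A₂) (max K₁ K₂) c fun ξ =>
      ∑' ν : ℕ, (C₁ ν.unpair.1 * C₂ ν.unpair.2) * T δ ν ξ := by
    intro δ hδ
    rcases exists_scale_shift hG K₁ K₂ (scaleDiff n A₂) δ (Fintype.mem_piFinset.1 hδ) with
      ⟨s, hs, hS⟩ | hS
    · refine std_of_unifExp (hA₂.trans (le_prodConst hA₂)) hC
        (hD.shift hA₂ s (N := 2 ^ n * (2 * scaleDiff n A₂)) (by exact_mod_cast hs))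
        (fun u ν => mergedFactor F₁ scale₁ Φ₁ scale₂ δ u ν)
        (fun w => unifExp_mergedFactor hD₁ hA₁ hD₂ hA₂ δ s w) fun ξ => ?_
      refine hasSum_of_eq (hsum δ ξ).hasSum fun ν => ?_
      congr 1
      symm
      refine treeSum_congr (𝒬 := fun u => boxesAt u hA₂ (G₂.sonSums u.1 ξ))
        (fun u Q hQ h => hD₂.mem_boxesAt hA₂ hQ (left_ne_zero_of_mul h)) fun P => ?_
      exact hS _
    · refine (Std.zero _ _ _ _).congr fun ξ => ?_
      have : ∀ ν, T δ ν ξ = 0 := fun ν => by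
        simp only [hT, hS]
        simp [treeSum]
      simp [this]
  refine (Std.sum Δ key).congr fun ξ => ?_
  refine HasSum.unique (hasSum_sum fun δ _ => (hsum δ ξ).hasSum) ?_
  refine hasSum_of_eq (hm ξ) fun ν => ?_
  rw [← Finset.mul_sum]
  congr 1
  exact (treeSum_mul_treeSum hn hG hD₁ hA₁ hK₁ hD₂ hA hK₂ ξ ν).symm

end Product

/-- The product of two standard symbols is a standard symbol. -/
theorem exists_isStandardSymbol_mul (hn : 1 ≤ n) (κ' : ℝ → ℕ) : ∃ κ : ℝ → ℕ,
    ∀ (c : ℝ) (G₁ G₂ : PlaneTree n) (m₁ m₂ : (Fin n → ℝ) → ℂ),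
      G₁.IsStandardSymbol κ c m₁ → G₂.IsStandardSymbol κ c m₂ →
        ∃ G : PlaneTree n, G.IsStandardSymbol κ' c (fun ξ => m₁ ξ * m₂ ξ) := by
  -- The constant of the product is `prodConst` of the larger of the two constants, and its
  -- separation is at least that of the corresponding factor. Hence it suffices to test κ' at
  -- `prodConst n A`.
  refine ⟨fun A => max (κ' (prodConst n A)) (sepExp n A), fun c G₁ G₂ m₁ m₂ h₁ h₂ => ?_⟩
  obtain ⟨A₁, K₁, hA₁, hK₁, h₁⟩ := isStandardSymbol_iff.1 h₁
  obtain ⟨A₂, K₂, hA₂, hK₂, h₂⟩ := isStandardSymbol_iff.1 h₂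
  rcases le_total A₁ A₂ with hA | hA
  · exact ⟨G₂, isStandardSymbol_iff.2 ⟨_, _, hA₂.trans (le_prodConst hA₂),
      (le_of_max_le_left hK₂).trans (le_max_right _ _),
      h₁.mul_of_le hn h₂ hA₁ hA (le_of_max_le_right hK₁) (le_of_max_le_right hK₂)⟩⟩
  · refine ⟨G₁, isStandardSymbol_iff.2 ⟨_, _, hA₁.trans (le_prodConst hA₁),
      (le_of_max_le_left hK₁).trans (le_max_right _ _),
      (h₂.mul_of_le hn h₁ hA₂ hA (le_of_max_le_right hK₂) (le_of_max_le_right hK₁)).congr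
        fun ξ => mul_comm _ _⟩⟩

end PlaneTree
end

/-! ### Every increasing point is clustered according to some tree -/

noncomputable section

namespace PlaneTree

variable {n : ℕ} {G : PlaneTree n}

section Cover

variable {ξ : Fin n → ℝ} {L : ℝ}

/-- The distances from the points `ξ_l, …, ξ_r` to the other ones are at least `L` times their
diameter. -/
def Isolated (L : ℝ) (ξ : Fin n → ℝ) (l r : Fin n) : Prop :=
  (∀ x < l, L * (ξ r - ξ l) ≤ ξ l - ξ x) ∧ ∀ x > r, L * (ξ r - ξ l) ≤ ξ x - ξ r

theorem Isolated.anti {L' : ℝ} {l r : Fin n} (h : Isolated L' ξ l r) (hL : L ≤ L')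
    (hlr : ξ l ≤ ξ r) : Isolated L ξ l r := by
  have : L * (ξ r - ξ l) ≤ L' * (ξ r - ξ l) := by
    have := sub_nonneg.2 hlr
    gcongr
  exact ⟨fun x hx => this.trans (h.1 x hx), fun x hx => this.trans (h.2 x hx)⟩

/-- In an overlap the gap outside each interval is part of the other interval. Each diameter would
then be at least L > 1 times the other one. -/
theorem Isolated.not_overlap {l r l' r' : Fin n} (hξ : StrictMono ξ) (hL : 1 < L)
    (h : Isolated L ξ l r) (h' : Isolated L ξ l' r') (h1 : l < l') (h2 : l' ≤ r) : ¬ r < r' := by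
  intro h3
  have a1 := h'.1 l h1
  have a2 := h.2 r' h3
  have b1 := hξ (h1.trans_le h2)
  have b2 := hξ (h2.trans_lt h3)
  have b3 := hξ.monotone h2
  nlinarith

open Classical in
/-- The tree whose vertices are the isolated intervals. -/
def isolatedTree (hn : 1 ≤ n) (hξ : StrictMono ξ) (hL : 1 < L) : PlaneTree n where
  verts := Finset.univ.filter fun u => ∃ l r, l ≤ r ∧ u = Finset.Icc l r ∧ Isolated L ξ l r
  interval u hu := by
    obtain ⟨l, r, h1, h2, -⟩ := (Finset.mem_filter.1 hu).2
    exact ⟨l, r, h1, h2⟩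
  root_mem := by
    refine Finset.mem_filter.2 ⟨Finset.mem_univ _, ⟨0, hn⟩, ⟨n - 1, by omega⟩, ?_, ?_, ?_, ?_⟩
    · exact Fin.mk_le_mk.2 (Nat.zero_le _)
    · ext x
      have := x.2
      simp only [Finset.mem_univ, Finset.mem_Icc, Fin.le_def, true_iff]
      omega
    · intro x hx
      simp [Fin.lt_def] at hx
    · intro x hx
      have := x.2
      simp only [gt_iff_lt, Fin.lt_def] at hx
      omega
  leaf_mem i := by
    refine Finset.mem_filter.2 ⟨Finset.mem_univ _, i, i, le_rfl, by simp, fun x hx => ?_,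
      fun x hx => ?_⟩
    · simpa using (hξ hx).le
    · simpa using (hξ hx).le
  laminar u hu v hv := by
    obtain ⟨l, r, h1, rfl, h3⟩ := (Finset.mem_filter.1 hu).2
    obtain ⟨l', r', h1', rfl, h3'⟩ := (Finset.mem_filter.1 hv).2
    rcases lt_or_ge r l' with h4 | h4
    · exact Or.inr (Or.inr (Finset.disjoint_left.2 fun x hx hx' =>
        absurd ((Finset.mem_Icc.1 hx').1.trans (Finset.mem_Icc.1 hx).2) (not_le.2 h4)))
    rcases lt_or_ge r' l with h5 | h5
    · exact Or.inr (Or.inr (Finset.disjoint_left.2 fun x hx hx' =>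
        absurd ((Finset.mem_Icc.1 hx).1.trans (Finset.mem_Icc.1 hx').2) (not_le.2 h5)))
    rcases lt_trichotomy l l' with h6 | h6 | h6
    · exact Or.inr (Or.inl (Finset.Icc_subset_Icc h6.le
        (not_lt.1 (h3.not_overlap hξ hL h3' h6 h4))))
    · rcases le_total r r' with h7 | h7
      · exact Or.inl (Finset.Icc_subset_Icc h6.ge h7)
      · exact Or.inr (Or.inl (Finset.Icc_subset_Icc h6.le h7))
    · exact Or.inl (Finset.Icc_subset_Icc h6.le
        (not_lt.1 (h3'.not_overlap hξ hL h3 h6 h5)))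

theorem mem_isolatedTree {hn : 1 ≤ n} {hξ : StrictMono ξ} {hL : 1 < L} {u : Finset (Fin n)} :
    u ∈ (isolatedTree hn hξ hL).verts ↔
      ∃ l r, l ≤ r ∧ u = Finset.Icc l r ∧ Isolated L ξ l r := by
  simp [isolatedTree]

theorem isolatedTree_anti {hn : 1 ≤ n} {hξ : StrictMono ξ} {hL : 1 < L} {L' : ℝ} {hL' : 1 < L'}
    (h : L ≤ L') : (isolatedTree hn hξ hL').verts ⊆ (isolatedTree hn hξ hL).verts := by
  intro u hu
  obtain ⟨l, r, h1, h2, h3⟩ := mem_isolatedTree.1 hu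
  exact mem_isolatedTree.2 ⟨l, r, h1, h2, h3.anti h (hξ.monotone h1)⟩

theorem inner_subset_inner {G₁ G₂ : PlaneTree n} (h : G₂.verts ⊆ G₁.verts) :
    G₂.inner ⊆ G₁.inner := Finset.filter_subset_filter _ h

theorem eq_of_inner_eq {G₁ G₂ : PlaneTree n} (h : G₁.inner = G₂.inner) : G₁ = G₂ := by
  have key : ∀ {G₁ G₂ : PlaneTree n}, G₁.inner = G₂.inner → G₁.verts ⊆ G₂.verts := by
    intro G₁ G₂ h u hu
    by_cases hc : 1 < u.card
    · exact inner_mem_verts ⟨u, h ▸ mem_inner.2 ⟨hu, hc⟩⟩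
    · obtain ⟨i, hi⟩ := Finset.card_eq_one.1
        (le_antisymm (not_lt.1 hc) (nonempty_of_mem hu).card_pos)
      exact hi ▸ G₂.leaf_mem i
  exact PlaneTree.ext ((key h).antisymm (key h.symm))

theorem card_inner_le (G : PlaneTree n) : G.inner.card ≤ 2 ^ n := by
  have := Finset.card_le_univ G.inner
  rwa [Fintype.card_finset, Fintype.card_fin] at this

/-- The distance of points below different sons is not much smaller than the diameter. -/
theorem sub_le_pow_mul_of_isolated (hξ : StrictMono ξ) (hL : 1 < L)
    (hG : ∀ l r, l ≤ r → Isolated L ξ l r → Finset.Icc l r ∈ G.verts)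
    {u : Finset (Fin n)} {l r : Fin n} (hu : u = Finset.Icc l r) (hiso : Isolated L ξ l r)
    {w w' : G.Son u} (hw : w ≠ w') {p q : Fin n} (hp : p ∈ w.1) (hq : q ∈ w'.1)
    (hpq : p < q) : ξ r - ξ l ≤ (1 + L) ^ n * (ξ q - ξ p) := by
  subst hu
  -- The interval [p, q] is enlarged until it is [l, r]. As long as it is smaller it cannot be
  -- isolated, since it would be a vertex meeting two sons. Some further point therefore lies within
  -- L times its diameter; adding it multiplies the diameter by at most 1 + L. Isolation of [l, r]
  -- keeps the new point inside, and there are at most n steps.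
  have key : ∀ (m : ℕ) (p' q' : Fin n), l ≤ p' → p' ≤ p → q ≤ q' → q' ≤ r →
      (p' - l : ℕ) + (r - q' : ℕ) ≤ m → ξ r - ξ l ≤ (1 + L) ^ m * (ξ q' - ξ p') := by
    intro m
    induction m with
    | zero =>
      intro p' q' h1 h2 h3 h4 h5
      obtain rfl : p' = l := by rw [Fin.ext_iff]; rw [Fin.le_def] at h1; omega
      obtain rfl : q' = r := by rw [Fin.ext_iff]; rw [Fin.le_def] at h4; omega
      simp
    | succ m ih =>
      intro p' q' h1 h2 h3 h4 h5
      have hlt : p' < q' := h2.trans_lt (hpq.trans_le h3)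
      have hpos := sub_pos.2 (hξ hlt)
      by_cases he : p' = l ∧ q' = r
      · obtain ⟨rfl, rfl⟩ := he
        exact le_mul_of_one_le_left hpos.le (one_le_pow₀ (by linarith))
      have hmem : ¬ Isolated L ξ p' q' := by
        intro h
        have hv := hG p' q' hlt.le h
        have hss : Finset.Icc p' q' ⊂ Finset.Icc l r := by
          refine (Finset.Icc_subset_Icc h1 h4).ssubset_of_ne fun h6 => he ?_
          have h7 : l ∈ Finset.Icc p' q' := h6 ▸ Finset.left_mem_Icc.2 (h1.trans (hlt.le.trans h4))
          have h8 : r ∈ Finset.Icc p' q' := h6 ▸ Finset.right_mem_Icc.2 (h1.trans (hlt.le.trans h4))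
          exact ⟨le_antisymm (Finset.mem_Icc.1 h7).1 h1, le_antisymm h4 (Finset.mem_Icc.1 h8).2⟩
        obtain ⟨v, hv', hvs⟩ := exists_son_of_ssubset hv hss
        have e1 : (⟨v, hv'⟩ : G.Son (Finset.Icc l r)) = w :=
          Son.eq_of_mem (i := p) (hvs (Finset.mem_Icc.2 ⟨h2, hpq.le.trans h3⟩)) hp
        have e2 : (⟨v, hv'⟩ : G.Son (Finset.Icc l r)) = w' :=
          Son.eq_of_mem (i := q) (hvs (Finset.mem_Icc.2 ⟨h2.trans hpq.le, h3⟩)) hq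
        exact hw (e1.symm.trans e2)
      have hdiam : ξ q' - ξ p' ≤ ξ r - ξ l := sub_le_sub (hξ.monotone h4) (hξ.monotone h1)
      have hLd : L * (ξ q' - ξ p') ≤ L * (ξ r - ξ l) := by gcongr
      rw [Isolated, not_and_or] at hmem
      rcases hmem with hx | hx
      · push Not at hx
        obtain ⟨x, hx, hx'⟩ := hx
        have hlx : l ≤ x := by
          by_contra hc
          have := hiso.1 x (not_le.1 hc)
          have := hξ.monotone h1
          linarith
        have := ih x q' hlx (hx.le.trans h2) h3 h4 (by
          rw [Fin.lt_def] at hx; rw [Fin.le_def] at hlx; omega)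
        refine this.trans ?_
        rw [pow_succ, mul_assoc]
        gcongr
        linarith
      · push Not at hx
        obtain ⟨x, hx, hx'⟩ := hx
        have hxr : x ≤ r := by
          by_contra hc
          have := hiso.2 x (not_le.1 hc)
          have := hξ.monotone h4
          linarith
        have := ih p' x h1 h2 (h3.trans hx.le) hxr (by
          rw [gt_iff_lt, Fin.lt_def] at hx; rw [Fin.le_def] at hxr; omega)
        refine this.trans ?_
        rw [pow_succ, mul_assoc]
        gcongr
        linarith
  have hp' := Finset.mem_Icc.1 (w.ssubset.1 hp)
  have hq' := Finset.mem_Icc.1 (w'.ssubset.1 hq)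
  refine key n p q hp'.1 le_rfl le_rfl hq'.2 ?_
  have h1 := hp'.1
  have h2 := hq'.2
  rw [Fin.le_def] at h1 h2
  rw [Fin.lt_def] at hpq
  have := r.2
  omega

theorem exists_le_weight_mul {u : Finset (Fin n)} (w : G.Son u) (ξ : Fin n → ℝ) :
    (∃ i ∈ w.1, ξ i ≤ G.weight u w * G.sonSums u ξ w) ∧
      ∃ i ∈ w.1, G.weight u w * G.sonSums u ξ w ≤ ξ i := by
  have hc : (0 : ℝ) < w.1.card := by exact_mod_cast w.nonempty.card_pos
  have h1 : ∑ _i ∈ w.1, G.weight u w * G.sonSums u ξ w = ∑ i ∈ w.1, ξ i := by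
    rw [Finset.sum_const, nsmul_eq_mul]
    unfold weight sonSums
    field_simp
  exact ⟨Finset.exists_le_of_sum_le w.nonempty h1.ge, Finset.exists_le_of_sum_le w.nonempty h1.le⟩

/-- The vertices of the tree are separated clusters of coordinates of `ξ`, of size `D`. -/
structure Clustered (G : PlaneTree n) (a L : ℝ) (ξ : Fin n → ℝ) (D : G.inner → ℝ) : Prop where
  pos : ∀ u, 0 < D u
  gap : ∀ (u : G.inner) (i j : G.Son u.1), i < j →
    D u ≤ a * (G.weight u.1 j * G.sonSums u.1 ξ j - G.weight u.1 i * G.sonSums u.1 ξ i) ∧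
      G.weight u.1 j * G.sonSums u.1 ξ j - G.weight u.1 i * G.sonSums u.1 ξ i ≤ D u
  sep : ∀ u v : G.inner, v.1 ∈ G.sons u.1 → L * D v ≤ D u

/-- The tree T_t of the intervals isolated with threshold L_t shrinks as t grows. For the greatest t
with card T_t + t ≤ 2^n, cardinalities of non-leaf vertices force T_{t+1} = T_t and equality.
Vertices of this tree are isolated with the large constant L_{t+1}, whereas all other intervals fail
to be isolated already with L_t, which bounds the ratios of gaps. The equality lets G determine t,
so parameters can be assigned to G beforehand. -/
theorem exists_clustered (hn : 1 ≤ n) (hξ : StrictMono ξ) {L : ℕ → ℝ} (hL : ∀ t, 1 < L t)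
    (hmono : Monotone L) : ∃ t, ∃ G : PlaneTree n, G.inner.card + t = 2 ^ n ∧
      ∃ D, G.Clustered ((1 + L t) ^ n) (L (t + 1)) ξ D := by
  classical
  set T : ℕ → PlaneTree n := fun t => isolatedTree hn hξ (hL t) with hT
  set P : ℕ → Prop := fun t => (T t).inner.card + t ≤ 2 ^ n with hP
  have hP0 : P 0 := by simpa [hP] using card_inner_le (T 0)
  set t := Nat.findGreatest P (2 ^ n) with ht
  have hPt : P t := Nat.findGreatest_spec (Nat.zero_le _) hP0
  have hPt' : ¬ P (t + 1) := by
    intro h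
    have : t + 1 ≤ 2 ^ n := le_trans (Nat.le_add_left _ _) h
    exact absurd (Nat.le_findGreatest this h) (by omega)
  have hsub : (T (t + 1)).verts ⊆ (T t).verts := isolatedTree_anti (hmono (Nat.le_succ t))
  have hsub' := inner_subset_inner hsub
  have hcard := Finset.card_le_card hsub'
  simp only [hP, not_le] at hPt hPt'
  have heq : T (t + 1) = T t :=
    eq_of_inner_eq (Finset.eq_of_subset_of_card_le hsub' (by omega))
  set G := T (t + 1) with hG
  have hmem : ∀ u : G.inner, ∃ l r, l ≤ r ∧ u.1 = Finset.Icc l r ∧ Isolated (L (t + 1)) ξ l r :=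
    fun u => mem_isolatedTree.1 (inner_mem_verts u)
  choose l r hlr hu hiso using hmem
  have hlt : ∀ u, l u < r u := fun u => by
    refine lt_of_le_of_ne (hlr u) fun h => ?_
    have := (mem_inner.1 u.2).2
    rw [hu u, h] at this
    simp at this
  refine ⟨t, G, by omega, fun u => ξ (r u) - ξ (l u), fun u => sub_pos.2 (hξ (hlt u)),
    fun u i j hij => ?_, fun u v hv => ?_⟩
  · obtain ⟨⟨p₁, hp₁, e₁⟩, p₂, hp₂, e₂⟩ := exists_le_weight_mul i ξ
    obtain ⟨⟨q₁, hq₁, f₁⟩, q₂, hq₂, f₂⟩ := exists_le_weight_mul j ξ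
    constructor
    · have hlt' := Son.lt_of_lt hij hp₂ hq₁
      have hGL : ∀ l r, l ≤ r → Isolated (L t) ξ l r → Finset.Icc l r ∈ G.verts := by
        intro l r h1 h2
        rw [heq]
        exact mem_isolatedTree.2 ⟨l, r, h1, rfl, h2⟩
      have hisot := (hiso u).anti (hmono (Nat.le_succ t)) (hξ.monotone (hlr u))
      have h1 := sub_le_pow_mul_of_isolated hξ (hL t) hGL (hu u) hisot hij.ne hp₂ hq₁ hlt'
      refine h1.trans ?_
      have := hL t
      gcongr
    · have hq := (hu u) ▸ j.ssubset.1 hq₂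
      have hp := (hu u) ▸ i.ssubset.1 hp₁
      have h1 := hξ.monotone (Finset.mem_Icc.1 hq).2
      have h2 := hξ.monotone (Finset.mem_Icc.1 hp).1
      linarith
  · have hss := (mem_sons.1 hv).2.1
    rw [hu u, hu v] at hss
    have h1 := Finset.mem_Icc.1 (hss.1 (Finset.left_mem_Icc.2 (hlr v)))
    have h2 := Finset.mem_Icc.1 (hss.1 (Finset.right_mem_Icc.2 (hlr v)))
    rcases h1.1.lt_or_eq with h3 | h3
    · have := (hiso v).1 _ h3
      have := hξ.monotone h1.2
      linarith
    · rcases h2.2.lt_or_eq with h4 | h4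
      · have := (hiso v).2 _ h4
        have := hξ.monotone h2.1
        linarith
      · exact absurd (h3 ▸ h4 ▸ subset_rfl) hss.2

end Cover

end PlaneTree
end

/-! ### Partitions of unity in space and in scale -/

noncomputable section

/-- A smooth function that is supported in `[1/4, 5/6]` and whose translates by multiples of `1/3`
add up to `1`. -/
def bumpProfile (x : ℝ) : ℂ :=
  ((Real.smoothTransition (4 * x - 1) - Real.smoothTransition (4 * (x - 1 / 3) - 1) : ℝ) : ℂ)

theorem contDiff_bumpProfile : ContDiff ℝ ∞ bumpProfile := by
  refine Complex.ofRealCLM.contDiff.comp (ContDiff.sub ?_ ?_)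
  · exact Real.smoothTransition.contDiff.comp (by fun_prop)
  · exact Real.smoothTransition.contDiff.comp (by fun_prop)

theorem bumpProfile_ne_zero {x : ℝ} (h : bumpProfile x ≠ 0) : 1 / 4 < x ∧ x < 5 / 6 := by
  refine ⟨lt_of_not_ge fun hx => h ?_, lt_of_not_ge fun hx => h ?_⟩
  · rw [bumpProfile, Real.smoothTransition.zero_of_nonpos (by linarith),
      Real.smoothTransition.zero_of_nonpos (by linarith)]
    simp
  · rw [bumpProfile, Real.smoothTransition.one_of_one_le (by linarith),
      Real.smoothTransition.one_of_one_le (by linarith)]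
    simp

theorem exists_smoothBdd_bumpProfile : ∃ B, SmoothBdd B 1 bumpProfile := by
  refine SmoothBdd.exists_of_hasCompactSupport contDiff_bumpProfile ?_
  refine HasCompactSupport.intro (isCompact_Icc (a := (1 / 4 : ℝ)) (b := 5 / 6)) fun x hx => ?_
  by_contra h
  exact hx ⟨(bumpProfile_ne_zero h).1.le, (bumpProfile_ne_zero h).2.le⟩

theorem sum_Ico_sub_int {f : ℤ → ℝ} {a b : ℤ} (h : a ≤ b) :
    ∑ t ∈ Finset.Ico a b, (f t - f (t + 1)) = f a - f b := by
  induction b, h using Int.leInduction with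
  | base => simp
  | succ b hb ih =>
    rw [← Finset.insert_Ico_right_eq_Ico_add_one hb, Finset.sum_insert (by simp), ih]
    ring

/-- The sum telescopes, because the profile is a difference of two translates of one smooth step;
the range is wide enough that the step is 1 at one end and 0 at the other. -/
theorem sum_bumpProfile (y : ℝ) :
    ∑ t ∈ Finset.Ico (⌊3 * y⌋ - 3) (⌊3 * y⌋ + 1), bumpProfile (y - t / 3) = 1 := by
  have h1 := Int.floor_le (3 * y)
  have h2 := Int.lt_floor_add_one (3 * y)
  have key := sum_Ico_sub_int (f := fun t : ℤ => Real.smoothTransition (4 * (y - t / 3) - 1))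
    (a := ⌊3 * y⌋ - 3) (b := ⌊3 * y⌋ + 1) (by omega)
  rw [Real.smoothTransition.one_of_one_le (x := 4 * (y - ((⌊3 * y⌋ - 3 : ℤ) : ℝ) / 3) - 1)
      (by push_cast; linarith),
    Real.smoothTransition.zero_of_nonpos (x := 4 * (y - ((⌊3 * y⌋ + 1 : ℤ) : ℝ) / 3) - 1)
      (by push_cast; linarith), sub_zero] at key
  rw [← Complex.ofReal_one, ← key, Complex.ofReal_sum]
  refine Finset.sum_congr rfl fun t _ => ?_
  rw [bumpProfile]
  congr 4
  push_cast
  ring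

theorem mem_Ico_of_bumpProfile_ne_zero {y : ℝ} {t : ℤ} (h : bumpProfile (y - t / 3) ≠ 0) :
    t ∈ Finset.Ico (⌊3 * y⌋ - 3) (⌊3 * y⌋ + 1) := by
  have h1 := Int.floor_le (3 * y)
  have h2 := Int.lt_floor_add_one (3 * y)
  obtain ⟨h3, h4⟩ := bumpProfile_ne_zero h
  rw [Finset.mem_Ico]
  constructor
  · have : ((⌊3 * y⌋ - 3 : ℤ) : ℝ) < t := by push_cast; linarith
    exact (by exact_mod_cast this : ⌊3 * y⌋ - 3 < t).le
  · have : (t : ℝ) < ((⌊3 * y⌋ + 1 : ℤ) : ℝ) := by push_cast; linarith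
    exact_mod_cast this

namespace ShiftedDyadic

/-- The bump that belongs to a shifted dyadic interval. -/
def bump (I : ShiftedDyadic) (x : ℝ) : ℂ := bumpProfile (-I.left / I.length + 1 / I.length * x)

/-- In the coordinates of the interval, [1/4, 5/6] lies well inside (1/20, 19/20). -/
theorem mem_dilate_of_bump_ne_zero {I : ShiftedDyadic} {x : ℝ} (h : I.bump x ≠ 0) :
    x ∈ I.dilate (9 / 10) := by
  have hl := I.length_pos
  obtain ⟨h1, h2⟩ := bumpProfile_ne_zero h
  rw [show -I.left / I.length + 1 / I.length * x = (x - I.left) / I.length by ring] at h1 h2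
  rw [lt_div_iff₀ hl] at h1
  rw [div_lt_iff₀ hl] at h2
  simp only [dilate, center, Set.mem_Ioo]
  constructor <;> linarith

theorem exists_isBump_bump : ∃ B, ∀ I : ShiftedDyadic, IsBump B (9 / 10) I I.bump := by
  obtain ⟨B, hB⟩ := exists_smoothBdd_bumpProfile
  refine ⟨fun l => |B l| * 1 ^ l, fun I => isBump_iff.2 ⟨?_, fun x hx => ?_⟩⟩
  · have hl := I.length_pos
    refine (hB.comp_affine one_pos (-I.left / I.length) (a := 1 / I.length)
      (by positivity)).rescale (by positivity) (by positivity) ?_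
    rw [one_div_one_div]
    linarith
  · by_contra h
    exact hx (mem_dilate_of_bump_ne_zero h)

/-- The left endpoints at scale j are exactly the multiples of 2^j / 3, each occurring once: the
sign (-1)^j only changes the representation modulo 3. -/
theorem exists_left_eq (I : ShiftedDyadic) : ∃ t : ℤ, I.left = 2 ^ I.scale * (t / 3 : ℝ) := by
  rcases Int.even_or_odd I.scale with h | h
  · refine ⟨3 * I.pos + (I.shift : ℕ), ?_⟩
    rw [left, h.neg_one_zpow]
    push_cast
    ring
  · refine ⟨3 * I.pos - (I.shift : ℕ), ?_⟩
    rw [left, h.neg_one_zpow]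
    push_cast
    ring

theorem exists_of_left (j t : ℤ) :
    ∃ I : ShiftedDyadic, I.scale = j ∧ I.left = 2 ^ j * (t / 3 : ℝ) := by
  have hmod : ∀ t : ℤ, ∃ (p : ℤ) (s : Fin 3), t = 3 * p + (s : ℕ) := fun t =>
    ⟨t / 3, ⟨(t % 3).toNat, by omega⟩, by simp only; omega⟩
  rcases Int.even_or_odd j with h | h
  · obtain ⟨p, s, rfl⟩ := hmod t
    refine ⟨⟨j, p, s⟩, rfl, ?_⟩
    simp only [left]
    rw [h.neg_one_zpow]
    push_cast
    ring
  · obtain ⟨p, s, hp⟩ := hmod (-t)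
    obtain rfl : t = -(3 * p + (s : ℕ)) := by omega
    refine ⟨⟨j, -p, s⟩, rfl, ?_⟩
    simp only [left]
    rw [h.neg_one_zpow]
    push_cast
    ring

theorem eq_of_left {I J : ShiftedDyadic} (hs : I.scale = J.scale) (h : I.left = J.left) :
    I = J := by
  have h0 : (2 : ℝ) ^ J.scale ≠ 0 := by positivity
  have hI := I.shift.2
  have hJ := J.shift.2
  rw [left, left, hs, mul_right_inj' h0] at h
  have key : I.pos = J.pos ∧ (I.shift : ℕ) = (J.shift : ℕ) := by
    rcases Int.even_or_odd J.scale with he | he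
    · rw [he.neg_one_zpow] at h
      have : 3 * I.pos + (I.shift : ℕ) = 3 * J.pos + (J.shift : ℕ) := by
        have : (3 * I.pos + (I.shift : ℕ) : ℝ) = 3 * J.pos + (J.shift : ℕ) := by linarith
        exact_mod_cast this
      omega
    · rw [he.neg_one_zpow] at h
      have : 3 * I.pos - (I.shift : ℕ) = 3 * J.pos - (J.shift : ℕ) := by
        have : (3 * I.pos - (I.shift : ℕ) : ℝ) = 3 * J.pos - (J.shift : ℕ) := by linarith
        exact_mod_cast this
      omega
  exact ext' hs key.1 (Fin.ext key.2)

/-- The bumps of a given scale form a partition of unity. -/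
theorem exists_sum_bump (j : ℤ) (x : ℝ) : ∃ ℐ : Finset ShiftedDyadic, (∀ I ∈ ℐ, I.scale = j) ∧
    (∀ I : ShiftedDyadic, I.scale = j → I.bump x ≠ 0 → I ∈ ℐ) ∧ ∑ I ∈ ℐ, I.bump x = 1 := by
  classical
  choose f hf hf' using exists_of_left j
  have h0 : (2 : ℝ) ^ j ≠ 0 := by positivity
  have hinj : Function.Injective f := fun t t' h => by
    have := hf' t
    rw [h, hf' t', mul_right_inj' h0] at this
    have h3 : (t' : ℝ) = t := by linarith
    exact_mod_cast h3.symm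
  have hb : ∀ t, (f t).bump x = bumpProfile (x / 2 ^ j - t / 3) := fun t => by
    rw [bump, length, hf, hf']
    congr 1
    field_simp
    ring
  refine ⟨(Finset.Ico (⌊3 * (x / 2 ^ j)⌋ - 3) (⌊3 * (x / 2 ^ j)⌋ + 1)).image f, ?_, ?_, ?_⟩
  · intro I hI
    obtain ⟨t, -, rfl⟩ := Finset.mem_image.1 hI
    exact hf t
  · intro I hI hne
    obtain ⟨t, ht⟩ := I.exists_left_eq
    obtain rfl : f t = I := eq_of_left ((hf t).trans hI.symm) (by rw [hf', ht, hI])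
    rw [hb] at hne
    exact Finset.mem_image_of_mem _ (mem_Ico_of_bumpProfile_ne_zero hne)
  · rw [Finset.sum_image fun _ _ _ _ h => hinj h]
    simp only [hb]
    exact sum_bumpProfile _

end ShiftedDyadic

/-- A smooth function on the half-line whose dyadic dilates add up to `1`. -/
def dyadicProfile (y : ℝ) : ℂ :=
  ((Real.smoothTransition (y - 1) - Real.smoothTransition (y / 2 - 1) : ℝ) : ℂ)

theorem dyadicProfile_ne_zero {y : ℝ} (h : dyadicProfile y ≠ 0) : 1 < y ∧ y < 4 := by
  refine ⟨lt_of_not_ge fun hx => h ?_, lt_of_not_ge fun hx => h ?_⟩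
  · rw [dyadicProfile, Real.smoothTransition.zero_of_nonpos (by linarith),
      Real.smoothTransition.zero_of_nonpos (by linarith)]
    simp
  · rw [dyadicProfile, Real.smoothTransition.one_of_one_le (by linarith),
      Real.smoothTransition.one_of_one_le (by linarith)]
    simp

theorem exists_smoothBdd_dyadicProfile : ∃ B, SmoothBdd B 1 dyadicProfile := by
  refine SmoothBdd.exists_of_hasCompactSupport ?_ ?_
  · refine Complex.ofRealCLM.contDiff.comp (ContDiff.sub ?_ ?_)
    · exact Real.smoothTransition.contDiff.comp (by fun_prop)
    · exact Real.smoothTransition.contDiff.comp (by fun_prop)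
  refine HasCompactSupport.intro (isCompact_Icc (a := (1 : ℝ)) (b := 4)) fun x hx => ?_
  by_contra h
  exact hx ⟨(dyadicProfile_ne_zero h).1.le, (dyadicProfile_ne_zero h).2.le⟩

/-- If 2^m ≤ g < 2^{m+1}, only k = m - 1 and k = m can contribute, and their two terms telescope to
1. -/
theorem exists_sum_dyadicProfile {g : ℝ} (hg : 0 < g) : ∃ Z : Finset ℤ,
    (∀ k : ℤ, dyadicProfile (2 ^ (-k) * g) ≠ 0 → k ∈ Z) ∧
      ∑ k ∈ Z, dyadicProfile (2 ^ (-k) * g) = 1 := by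
  obtain ⟨m, hm1, hm2⟩ := exists_mem_Ico_zpow hg one_lt_two
  refine ⟨{m - 1, m}, fun k hk => ?_, ?_⟩
  · obtain ⟨h1, h2⟩ := dyadicProfile_ne_zero hk
    have h2k : (0 : ℝ) < 2 ^ k := by positivity
    rw [zpow_neg, ← div_eq_inv_mul] at h1 h2
    rw [lt_div_iff₀ h2k, one_mul] at h1
    rw [div_lt_iff₀ h2k] at h2
    have h3 : k < m + 1 := (zpow_lt_zpow_iff_right₀ (one_lt_two (α := ℝ))).1 (h1.trans hm2)
    have h4 : m < 2 + k := by
      refine (zpow_lt_zpow_iff_right₀ (one_lt_two (α := ℝ))).1 (hm1.trans_lt (h2.trans_eq ?_))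
      rw [zpow_add₀ two_ne_zero]
      norm_num
    simp only [Finset.mem_insert, Finset.mem_singleton]
    omega
  · rw [Finset.sum_pair (by omega)]
    have h2m : (0 : ℝ) < 2 ^ m := by positivity
    have e1 : (2 : ℝ) ^ (-(m - 1)) * g = 2 * (g / 2 ^ m) := by
      rw [neg_sub, zpow_sub₀ two_ne_zero, zpow_one]; ring
    have e2 : (2 : ℝ) ^ (-m) * g = g / 2 ^ m := by rw [zpow_neg]; ring
    rw [e1, e2]
    have y1 : 1 ≤ g / 2 ^ m := by rwa [le_div_iff₀ h2m, one_mul]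
    have y2 : g / 2 ^ m < 2 := by
      rw [div_lt_iff₀ h2m]
      rwa [zpow_add₀ two_ne_zero, zpow_one, mul_comm] at hm2
    set y := g / 2 ^ m
    rw [dyadicProfile, dyadicProfile, ← Complex.ofReal_add,
      Real.smoothTransition.one_of_one_le (x := 2 * y - 1) (by linarith),
      Real.smoothTransition.zero_of_nonpos (x := y / 2 - 1) (by linarith),
      show 2 * y / 2 - 1 = y - 1 by ring]
    simp
end

/-! ### The model symbols are standard -/

noncomputable section

namespace PlaneTree

variable {n : ℕ} {G : PlaneTree n}

/-- A son that is not the last one. -/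
def firstSon (u : G.inner) : G.Son u.1 := (exists_covBy u).choose

/-- The son after `firstSon`. -/
def nextSon (u : G.inner) : G.Son u.1 := (exists_covBy u).choose_spec.choose

theorem firstSon_covBy (u : G.inner) : firstSon u ⋖ nextSon u :=
  (exists_covBy u).choose_spec.choose_spec

/-- The gap between two neighbouring sons. -/
def gapForm (u : G.inner) (x : G.Son u.1 → ℝ) : ℝ :=
  G.weight u.1 (nextSon u) * x (nextSon u) - G.weight u.1 (firstSon u) * x (firstSon u)

/-- The adapted cubes. -/
def modelBoxes (A : ℝ) (u : G.inner) : Set (DyadicBox (G.Son u.1)) :=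
  {Q | (∀ i j, (Q i).scale = (Q j).scale) ∧ Q.Adapted A (G.weight u.1)}

/-- The scale of the gaps that belongs to a cube. -/
def modelScale (r : ℕ) (u : G.inner) (Q : DyadicBox (G.Son u.1)) : ℤ :=
  (Q (firstSon u)).scale + r

/-- The cut-off to points with gaps of a given scale. -/
def modelCutoff (r : ℕ) (u : G.inner) (Q : DyadicBox (G.Son u.1)) (x : G.Son u.1 → ℝ) : ℂ :=
  dyadicProfile (2 ^ (-modelScale r u Q) * gapForm u x)

/-- The model symbol of type `G`. -/
def model (G : PlaneTree n) (A : ℝ) (r K : ℕ) (ξ : Fin n → ℝ) : ℂ :=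
  treeSum (G.scaleTuples K) (modelBoxes A) (modelScale r) fun u Q =>
    (∏ i, (Q i).bump (G.sonSums u.1 ξ i)) * modelCutoff r u Q (G.sonSums u.1 ξ)

theorem scale_eq_of_mem {A : ℝ} {u : G.inner} {Q : DyadicBox (G.Son u.1)} {r : ℕ}
    (hQ : Q ∈ modelBoxes A u) (i : G.Son u.1) : (Q i).scale = modelScale r u Q - r := by
  rw [modelScale, hQ.1 i (firstSon u)]
  ring

section Classes

/-- Residue classes of the data of cubes. -/
def BoxClass (p : ℕ) (u : G.inner) : Type := ZMod (p + 1) × (G.Son u.1 → ZMod (p + 1) × Fin 3)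

instance (p : ℕ) (u : G.inner) : Fintype (BoxClass p u) :=
  @instFintypeProd _ _ (ZMod.fintype (p + 1))
    (@Pi.instFintype _ _ _ _ fun _ => @instFintypeProd _ _ (ZMod.fintype (p + 1)) _)

/-- The residue class of a cube. -/
def boxClass (p : ℕ) (u : G.inner) (Q : DyadicBox (G.Son u.1)) : BoxClass p u :=
  (((Q (firstSon u)).scale : ZMod (p + 1)), fun i => (((Q i).pos : ZMod (p + 1)), (Q i).shift))

/-- Two different cubes of a class either have scales that differ by at least p + 1 or have equal
scale, equal shifts, and in some direction positions that differ by at least p + 1 > |c|. -/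
theorem sparse_boxClass {c : ℝ} {p : ℕ} (hp : |c| ≤ p) (A : ℝ) (u : G.inner)
    (χ : BoxClass p u) :
    DyadicBox.Sparse c {Q | Q ∈ modelBoxes A u ∧ boxClass p u Q = χ} := by
  rintro Q ⟨hQ, rfl⟩ Q' ⟨hQ', hcl⟩ hne
  have hlen : ∀ {Q : DyadicBox (G.Son u.1)}, Q ∈ modelBoxes A u →
      ∀ i, (Q i).length = 2 ^ (Q (firstSon u)).scale := fun hQ i => by
    rw [ShiftedDyadic.length, hQ.1 i (firstSon u)]
  have hvol : ∀ {Q : DyadicBox (G.Son u.1)}, Q ∈ modelBoxes A u → ∀ a : ℝ,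
      Q.volume a = (a * 2 ^ (Q (firstSon u)).scale) ^ Fintype.card (G.Son u.1) := fun hQ a => by
    simp [DyadicBox.volume, hlen hQ, Finset.prod_const]
  have hd : Fintype.card (G.Son u.1) ≠ 0 := Fintype.card_ne_zero
  rw [hvol hQ, hvol hQ, hvol hQ', one_mul, one_mul]
  set j := (Q (firstSon u)).scale with hj
  set j' := (Q' (firstSon u)).scale with hj'
  have h2j : (0 : ℝ) < 2 ^ j := by positivity
  have h2j' : (0 : ℝ) < 2 ^ j' := by positivity
  replace hcl := Prod.ext_iff.1 hcl
  constructor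
  · intro h
    have h1 : j < j' := (zpow_lt_zpow_iff_right₀ (one_lt_two (α := ℝ))).1
      (lt_of_pow_lt_pow_left₀ _ h2j'.le h)
    have h2 : ((p + 1 : ℕ) : ℤ) ∣ j' - j :=
      (ZMod.intCast_eq_intCast_iff_dvd_sub j j' (p + 1)).1 hcl.1.symm
    have h3 := Int.le_of_dvd (by omega) h2
    have h4 : |c| * 2 ^ j < 2 ^ j' := by
      calc |c| * 2 ^ j ≤ p * 2 ^ j := by gcongr
        _ < 2 ^ (p : ℤ) * 2 ^ j := by
          rw [zpow_natCast]
          have : (p : ℝ) < 2 ^ p := by exact_mod_cast Nat.lt_two_pow_self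
          gcongr
        _ = 2 ^ (p + j : ℤ) := (zpow_add₀ two_ne_zero _ _).symm
        _ ≤ 2 ^ j' := zpow_le_zpow_right₀ one_le_two (by omega)
    calc (c * 2 ^ j) ^ Fintype.card (G.Son u.1)
        ≤ |(c * 2 ^ j) ^ Fintype.card (G.Son u.1)| := le_abs_self _
      _ = (|c| * 2 ^ j) ^ Fintype.card (G.Son u.1) := by rw [abs_pow, abs_mul, abs_of_pos h2j]
      _ < _ := pow_lt_pow_left₀ h4 (by positivity) hd
  · intro h
    have h1 : j = j' := zpow_right_injective₀ two_pos (by norm_num)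
      ((pow_left_inj₀ h2j.le h2j'.le hd).1 h)
    refine Set.disjoint_left.2 fun x hx hx' => hne (funext fun i => ?_)
    have e1 : (Q i).scale = j := hQ.1 i _
    have e2 : (Q' i).scale = j := (hQ'.1 i _).trans h1.symm
    have h3 := congrFun hcl.2 i
    simp only [boxClass, Prod.mk.injEq] at h3
    have h4 : ((p + 1 : ℕ) : ℤ) ∣ (Q i).pos - (Q' i).pos :=
      (ZMod.intCast_eq_intCast_iff_dvd_sub _ _ (p + 1)).1 h3.1
    refine ShiftedDyadic.ext' (e1.trans e2.symm) ?_ h3.2.symm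
    have h5 := hx i
    have h6 := hx' i
    simp only [ShiftedDyadic.dilate, ShiftedDyadic.center, ShiftedDyadic.left,
      ShiftedDyadic.length, e1, e2, Set.mem_Ioo, h3.2] at h5 h6
    have h7 : |((Q i).pos - (Q' i).pos : ℝ)| < p + 1 := by
      have : 2 ^ j * |((Q i).pos - (Q' i).pos : ℝ)| < 2 ^ j * (p + 1) := by
        rw [← abs_of_pos h2j, ← abs_mul, abs_of_pos h2j]
        have hc : c * 2 ^ j ≤ p * 2 ^ j := by
          have := (le_abs_self c).trans hp
          gcongr
        rw [abs_lt]
        constructor <;> nlinarith [h5.1, h5.2, h6.1, h6.2]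
      exact lt_of_mul_lt_mul_left this h2j.le
    have h8 : |(Q i).pos - (Q' i).pos| < ((p + 1 : ℕ) : ℤ) := by exact_mod_cast h7
    exact sub_eq_zero.1 (Int.eq_zero_of_abs_lt_dvd h4 h8)

-- Each choice of boxes belongs to exactly one tuple of classes. This cuts the model symbol into
-- finitely many pieces with sparse families.
open Classical in
theorem treeSum_eq_sum_classes {S : Set (G.inner → ℤ)}
    {F : (u : G.inner) → Set (DyadicBox (G.Son u.1))}
    {scale : (u : G.inner) → DyadicBox (G.Son u.1) → ℤ}
    {Ψ : (u : G.inner) → DyadicBox (G.Son u.1) → ℂ}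
    {𝒬 : (u : G.inner) → Finset (DyadicBox (G.Son u.1))}
    (h : ∀ u, ∀ Q ∈ F u, Ψ u Q ≠ 0 → Q ∈ 𝒬 u) {Cl : G.inner → Type} [∀ u, Fintype (Cl u)]
    (cl : (u : G.inner) → DyadicBox (G.Son u.1) → Cl u) :
    treeSum S F scale Ψ =
      ∑ χ : (u : G.inner) → Cl u, treeSum S (fun u => {Q | Q ∈ F u ∧ cl u Q = χ u}) scale Ψ := by
  rw [treeSum_eq h]
  simp only [fun χ : (u : G.inner) → Cl u => treeSum_eq (S := S) (scale := scale)
    (F := fun u => {Q | Q ∈ F u ∧ cl u Q = χ u}) (Ψ := Ψ) (𝒬 := 𝒬) fun u Q hQ => h u Q hQ.1]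
  rw [Finset.sum_comm]
  refine Finset.sum_congr rfl fun P _ => ?_
  by_cases hP : (∀ u, P u ∈ F u) ∧ (fun u => scale u (P u)) ∈ S
  · rw [if_pos hP, Finset.sum_eq_single (fun u => cl u (P u))]
    · rw [if_pos ⟨fun u => ⟨hP.1 u, rfl⟩, hP.2⟩]
    · intro χ _ hχ
      rw [if_neg]
      exact fun h => hχ (funext fun u => (h.1 u).2.symm)
    · simp
  · rw [if_neg hP, Finset.sum_eq_zero]
    intro χ _
    rw [if_neg]
    exact fun h => hP ⟨fun u => (h.1 u).1, h.2⟩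

end Classes

theorem isData_model {c : ℝ} {p : ℕ} (hp : |c| ≤ p) {A : ℝ} (hA : 1 ≤ A) {r : ℕ}
    (hr : 2 ^ r ≤ A) {B : ℕ → ℝ} (hB : ∀ I : ShiftedDyadic, IsBump B (9 / 10) I I.bump)
    (χ : (u : G.inner) → BoxClass p u) :
    IsData A c B (fun _ u => {Q | Q ∈ modelBoxes A u ∧ boxClass p u Q = χ u})
      (fun _ => modelScale r) (fun _ _ Q i => (Q i).bump) := by
  refine ⟨fun _ u => sparse_boxClass hp A u (χ u), fun _ _ Q hQ => ⟨fun i j => ?_, hQ.1.2,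
    fun i => ?_, fun i => hB _⟩⟩
  · have := (Q j).length_pos
    rw [show (Q i).length = (Q j).length by
      rw [ShiftedDyadic.length, ShiftedDyadic.length, hQ.1.1 i j]]
    exact le_mul_of_one_le_left this.le hA
  · have hA0 : 0 < A := by linarith
    have h0 : (0 : ℝ) < 2 ^ modelScale r _ Q := by positivity
    rw [ShiftedDyadic.length, scale_eq_of_mem (r := r) hQ.1 i, zpow_sub₀ two_ne_zero,
      zpow_natCast, div_eq_inv_mul]
    constructor
    · have : A⁻¹ ≤ (2 ^ r : ℝ)⁻¹ := inv_anti₀ (by positivity) hr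
      gcongr
    · have : (2 ^ r : ℝ)⁻¹ ≤ 1 := inv_le_one_of_one_le₀ (one_le_pow₀ one_le_two)
      have h1 : (2 ^ r : ℝ)⁻¹ ≤ A := this.trans hA
      gcongr

/-- The cut-off is a function of the single linear form `gapForm`, smooth at the scale of the gaps.
That scale is at least the size of the cube, so the form varies by a bounded multiple of it on the
cube. -/
theorem unifExp_modelCutoff {A : ℝ} (r : ℕ) (u : G.inner)
    {F : Set (DyadicBox (G.Son u.1))} (hF : F ⊆ modelBoxes A u) :
    UnifExp (𝓠 := {q : ℕ × DyadicBox (G.Son u.1) // q.2 ∈ F})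
      (fun q => (2 : ℝ) ^ modelScale r u q.1.2) (fun q => {x | ∀ i, x i ∈ (q.1.2 i).toSet})
      (fun q => modelCutoff r u q.1.2) := by
  classical
  obtain ⟨B, hB⟩ := exists_smoothBdd_dyadicProfile
  set a : G.Son u.1 → ℝ := fun s => (if s = nextSon u then G.weight u.1 (nextSon u) else 0) -
    if s = firstSon u then G.weight u.1 (firstSon u) else 0 with ha
  have hform : ∀ x, ∑ s, a s * x s = gapForm u x := fun x => by
    simp [ha, gapForm, sub_mul, Finset.sum_sub_distrib]
  have ha2 : ∀ s, |a s| ≤ 2 := fun s => by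
    have h1 := weight_pos u.1 (nextSon u)
    have h2 := weight_pos u.1 (firstSon u)
    have h3 := weight_le_one u.1 (nextSon u)
    have h4 := weight_le_one u.1 (firstSon u)
    rw [ha, abs_le]
    simp only
    split_ifs <;> constructor <;> linarith
  have hT : ∀ q : {q : ℕ × DyadicBox (G.Son u.1) // q.2 ∈ F},
      (0 : ℝ) < 2 ^ modelScale r u q.1.2 := fun q => by positivity
  have := UnifExp.comp_linear (𝓠 := {q : ℕ × DyadicBox (G.Son u.1) // q.2 ∈ F})
    (T := fun q => (2 : ℝ) ^ modelScale r u q.1.2)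
    (R := fun q => {x | ∀ i, x i ∈ (q.1.2 i).toSet}) hT
    (f := fun q y => dyadicProfile (0 + 2 ^ (-modelScale r u q.1.2) * y)) (B := B) (fun q => ?_) a
    (fun q => ∑ s, a s * (q.1.2 s).center) (r := Fintype.card (G.Son u.1) * 2) (by positivity) ?_
  · refine this.congr fun q x _ => ?_
    rw [zero_add, hform, modelCutoff]
  · have := hB.comp_affine one_pos 0 (a := 2 ^ (-modelScale r u q.1.2)) (by positivity)
    rwa [one_div, ← zpow_neg, neg_neg] at this
  · intro q x hx
    rw [← Finset.sum_sub_distrib]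
    refine (Finset.abs_sum_le_sum_abs _ _).trans
      ((Finset.sum_le_card_nsmul _ _ (2 * 2 ^ modelScale r u q.1.2) fun s _ => ?_).trans ?_)
    · rw [← mul_sub, abs_mul]
      have h0 := (q.1.2 s).length_pos
      have h1 : |x s - (q.1.2 s).center| ≤ (q.1.2 s).length := by
        refine ShiftedDyadic.abs_sub_le (hx s) ?_
        simp only [ShiftedDyadic.toSet, ShiftedDyadic.center, Set.mem_Ioo]
        constructor <;> linarith
      have h2 : (q.1.2 s).length ≤ 2 ^ modelScale r u q.1.2 := by
        rw [ShiftedDyadic.length, scale_eq_of_mem (r := r) (hF q.2) s]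
        exact zpow_le_zpow_right₀ one_le_two (by omega)
      have := ha2 s
      gcongr
      exact h1.trans h2
    · rw [nsmul_eq_mul, Finset.card_univ, mul_assoc]

theorem mem_boxesAt_of_model {A : ℝ} (hA : 1 ≤ A) {u : G.inner} {Q : DyadicBox (G.Son u.1)}
    (hQ : Q ∈ modelBoxes A u) {x : G.Son u.1 → ℝ} (h : ∏ i, (Q i).bump (x i) ≠ 0) :
    Q ∈ boxesAt u hA x := by
  refine (finite_boxes u hA x).mem_toFinset.2 ⟨fun i j => ?_, hQ.2, fun i =>
    ShiftedDyadic.dilate_subset _ (ShiftedDyadic.mem_dilate_of_bump_ne_zero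
      (Finset.prod_ne_zero_iff.1 h i (Finset.mem_univ i)))⟩
  have := (Q j).length_pos
  rw [show (Q i).length = (Q j).length by
    rw [ShiftedDyadic.length, ShiftedDyadic.length, hQ.1 i j]]
  exact le_mul_of_one_le_left this.le hA

theorem std_model_class (G : PlaneTree n) {c : ℝ} {p : ℕ} (hp : |c| ≤ p) {A : ℝ} (hA : 1 ≤ A)
    {r : ℕ} (hr : 2 ^ r ≤ A) (K : ℕ) (χ : (u : G.inner) → BoxClass p u) :
    G.Std A K c fun ξ =>
      treeSum (G.scaleTuples K) (fun u => {Q | Q ∈ modelBoxes A u ∧ boxClass p u Q = χ u})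
        (modelScale r) fun u Q =>
        (∏ i, (Q i).bump (G.sonSums u.1 ξ i)) * modelCutoff r u Q (G.sonSums u.1 ξ) := by
  obtain ⟨B, hB⟩ := ShiftedDyadic.exists_isBump_bump
  refine std_of_unifExp hA RapidlyDecreasing.single (isData_model hp hA hr hB χ)
    (fun u _ => modelCutoff r u) (fun u => unifExp_modelCutoff r u fun Q hQ => hQ.1) fun ξ => ?_
  refine hasSum_of_eq (hasSum_ite_eq (0 : ℕ) _) fun ν => ?_
  rw [ite_mul, one_mul, zero_mul]

theorem std_model (G : PlaneTree n) (c : ℝ) {A : ℝ} (hA : 1 ≤ A) {r : ℕ} (hr : 2 ^ r ≤ A) (K : ℕ) :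
    G.Std A K c (G.model A r K) := by
  classical
  obtain ⟨p, hp⟩ := exists_nat_ge |c|
  refine (Std.sum Finset.univ fun χ _ => std_model_class G hp hA hr K χ).congr fun ξ => ?_
  exact (treeSum_eq_sum_classes (𝒬 := fun u => boxesAt u hA (G.sonSums u.1 ξ))
    (fun u Q hQ h => mem_boxesAt_of_model hA hQ (left_ne_zero_of_mul h)) (boxClass p)).symm

end PlaneTree
end

/-! ### Support and values of the model symbols -/

noncomputable section

namespace PlaneTree

variable {n : ℕ} {G : PlaneTree n}

/-- Symbols vanish off the set of the points with increasing coordinates. -/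
theorem Std.strictMono_of_ne_zero (hn : 1 ≤ n) {A c : ℝ} {K : ℕ} {m : (Fin n → ℝ) → ℂ}
    (h : G.Std A K c m) (hA : 1 ≤ A) (hK : sepExp n A ≤ K) {ξ : Fin n → ℝ} (hne : m ξ ≠ 0) :
    StrictMono ξ := by
  classical
  obtain ⟨B, C, F, scale, Φ, hC, hD, hm⟩ := h
  by_contra hξ
  refine hne ((hm ξ).unique (hasSum_of_eq hasSum_zero fun ν => ?_))
  refine mul_eq_zero_of_right _ ?_
  rw [treeSum_eq (𝒬 := fun u => boxesAt u hA (G.sonSums u.1 ξ))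
    fun u Q hQ h => hD.mem_boxesAt hA hQ h]
  refine Finset.sum_eq_zero fun P _ => ?_
  by_contra h1
  rw [ite_eq_right_iff, Classical.not_imp] at h1
  have hE := hD.pairEst hn hA hK h1.1.1
    (fun u => Finset.prod_ne_zero_iff.1 h1.2 u (Finset.mem_univ u)) h1.1.2
  refine hξ fun i j hij => ?_
  have hc : 1 < ({i, j} : Finset (Fin n)).card := by
    rw [Finset.card_pair hij.ne]; exact one_lt_two
  obtain ⟨w, w', i', j', hlt, hi, hj, hi', hj', hij'⟩ := G.exists_sons_of_hull hc
  have h2 := hE.lower ⟨_, G.hull_mem_inner hc⟩ w w' i' j' hlt hi hj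
  have hpos := sepConst_pos hn hA
  have h3 : 0 < ξ j' - ξ i' := lt_of_lt_of_le (by positivity) h2
  simp only [Finset.mem_insert, Finset.mem_singleton] at hi' hj'
  rcases hi' with rfl | rfl <;> rcases hj' with rfl | rfl
  · exact absurd hij' (lt_irrefl _)
  · linarith
  · exact absurd (hij.trans hij') (lt_irrefl _)
  · exact absurd hij' (lt_irrefl _)

/-- The constant of the model symbol. -/
def modelConst (n α : ℕ) : ℝ := n * 2 ^ (2 * α + 5)

theorem one_le_modelConst (hn : 1 ≤ n) (α : ℕ) : 1 ≤ modelConst n α := by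
  have : (1 : ℝ) ≤ n := by exact_mod_cast hn
  exact one_le_mul_of_one_le_of_one_le this (one_le_pow₀ one_le_two)

theorem pow_le_modelConst (hn : 1 ≤ n) (α : ℕ) : 2 ^ (α + 2) ≤ modelConst n α := by
  have : (1 : ℝ) ≤ n := by exact_mod_cast hn
  calc (2 : ℝ) ^ (α + 2) ≤ 1 * 2 ^ (2 * α + 5) := by
        rw [one_mul]; exact pow_le_pow_right₀ one_le_two (by omega)
    _ ≤ _ := by unfold modelConst; gcongr

/-- Where all gaps at u are comparable, the cut-off to gaps of size 2^k forces every cube of the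
right size around x to be adapted. The adaptedness condition can then be dropped, and the bumps add
up to 1. -/
theorem levelSum_model (hn : 1 ≤ n) {α : ℕ} {u : G.inner} {x : G.Son u.1 → ℝ} {D : ℝ}
    (hgap : ∀ i j : G.Son u.1, i ⋖ j →
      D ≤ 2 ^ α * (G.weight u.1 j * x j - G.weight u.1 i * x i) ∧
        G.weight u.1 j * x j - G.weight u.1 i * x i ≤ D) (k : ℤ) :
    levelSum (modelBoxes (modelConst n α) u) (modelScale (α + 2) u)
      (fun Q => (∏ i, (Q i).bump (x i)) * modelCutoff (α + 2) u Q x) k =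
      dyadicProfile (2 ^ (-k) * gapForm u x) := by
  classical
  have hn' : (1 : ℝ) ≤ n := by exact_mod_cast hn
  choose ℐ h1 h2 h3 using fun i => ShiftedDyadic.exists_sum_bump (k - (α + 2 : ℕ)) (x i)
  rw [levelSum_eq (𝒬 := Fintype.piFinset ℐ)]
  · trans ∑ Q ∈ Fintype.piFinset ℐ,
      (∏ i, (Q i).bump (x i)) * dyadicProfile (2 ^ (-k) * gapForm u x)
    · refine Finset.sum_congr rfl fun Q hQ => ?_
      have hsc : ∀ i, (Q i).scale = k - (α + 2 : ℕ) := fun i =>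
        h1 i _ (Fintype.mem_piFinset.1 hQ i)
      have hk : modelScale (α + 2) u Q = k := by rw [modelScale, hsc]; ring
      rw [modelCutoff, hk]
      by_cases h0 : (∏ i, (Q i).bump (x i)) * dyadicProfile (2 ^ (-k) * gapForm u x) = 0
      · rw [h0, ite_self]
      refine if_pos ⟨⟨fun i j => (hsc i).trans (hsc j).symm, fun i j hij => ?_⟩, rfl⟩
      have hmem : ∀ i, x i ∈ (Q i).toSet := fun i => ShiftedDyadic.dilate_subset _
        (ShiftedDyadic.mem_dilate_of_bump_ne_zero
          (Finset.prod_ne_zero_iff.1 (left_ne_zero_of_mul h0) i (Finset.mem_univ i)))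
      obtain ⟨g1, g2⟩ := dyadicProfile_ne_zero (right_ne_zero_of_mul h0)
      have h2k : (0 : ℝ) < 2 ^ k := by positivity
      rw [zpow_neg, ← div_eq_inv_mul] at g1 g2
      rw [lt_div_iff₀ h2k, one_mul] at g1
      rw [div_lt_iff₀ h2k] at g2
      obtain ⟨d1, d2⟩ := hgap _ _ (firstSon_covBy u)
      obtain ⟨e1, e2⟩ := hgap i j hij
      change D ≤ 2 ^ α * gapForm u x at d1
      change gapForm u x ≤ D at d2
      have hlen : ∀ i, (Q i).length = 2 ^ k / (4 * 2 ^ α) := fun i => by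
        rw [ShiftedDyadic.length, hsc, zpow_sub₀ two_ne_zero, zpow_natCast, pow_add]
        ring
      have h2α : (0 : ℝ) < 2 ^ α := by positivity
      -- All gaps lie between 2^k / 2^α and 4 · 2^α 2^k. The sides are a quarter of the lower bound,
      -- which explains the offset α + 2, and the upper bound dictates the constant n 2^{2α+5}.
      refine DyadicBox.pairAdapted_of_gap (δ := 1 / n) (g := 2 ^ k / 2 ^ α)
        (g' := 4 * 2 ^ α * 2 ^ k) (by positivity) (le_weight _ _) (weight_le_one _ _)
        (le_weight _ _) (weight_le_one _ _) ((hlen i).trans (hlen j).symm) ?_ ?_ ?_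
        (hmem i) (hmem j) ?_ ?_
      · rw [hlen]
        apply le_of_eq
        field_simp
      · calc (2 : ℝ) = 1 * 2 ^ 1 := by norm_num
          _ ≤ n * 2 ^ (2 * α + 5) := by
            gcongr
            · norm_num
            · omega
      · rw [hlen, modelConst, show 2 * α + 5 = α + α + 5 by ring, pow_add, pow_add]
        apply le_of_eq
        field_simp
        norm_num
      · rw [div_le_iff₀ h2α]
        linarith
      · have : 2 ^ α * gapForm u x ≤ 2 ^ α * (4 * 2 ^ k) := by gcongr
        linarith
    · rw [← Finset.sum_mul,
        ← Finset.prod_univ_sum (t := ℐ) (f := fun i I => I.bump (x i)), Finset.prod_congr rfl fun i _ => h3 i]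
      simp
  · intro Q hQ hk hne
    refine Fintype.mem_piFinset.2 fun i => h2 i _ ?_
      (Finset.prod_ne_zero_iff.1 (left_ne_zero_of_mul hne) i (Finset.mem_univ i))
    rw [scale_eq_of_mem (r := α + 2) hQ i, hk]

/-- The model symbol is `1` where the vertices are well separated clusters. -/
theorem model_eq_one (hn : 1 ≤ n) {α K : ℕ} {a L : ℝ} {ξ : Fin n → ℝ} {D : G.inner → ℝ}
    (h : G.Clustered a L ξ D) (ha : 0 < a) (ha' : a ≤ 2 ^ α) (hL : 2 ^ (α + K + 2) ≤ L) :
    G.model (modelConst n α) (α + 2) K ξ = 1 := by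
  classical
  have hgap : ∀ (u : G.inner) (i j : G.Son u.1), i ⋖ j →
      D u ≤ 2 ^ α * (G.weight u.1 j * G.sonSums u.1 ξ j - G.weight u.1 i * G.sonSums u.1 ξ i) ∧
        G.weight u.1 j * G.sonSums u.1 ξ j - G.weight u.1 i * G.sonSums u.1 ξ i ≤ D u := by
    intro u i j hij
    obtain ⟨h1, h2⟩ := h.gap u i j hij.lt
    refine ⟨h1.trans (mul_le_mul_of_nonneg_right ha' ?_), h2⟩
    exact (pos_of_mul_pos_right ((h.pos u).trans_le h1) ha.le).le
  unfold model treeSum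
  simp only [fun (k : G.inner → ℤ) u => levelSum_model hn (hgap u) (k u)]
  have hg : ∀ u, 0 < gapForm u (G.sonSums u.1 ξ) := fun u =>
    pos_of_mul_pos_right ((h.pos u).trans_le (hgap u _ _ (firstSon_covBy u)).1) (by positivity)
  choose Z hZ hZ1 using fun u => exists_sum_dyadicProfile (hg u)
  rw [finsum_mem_eq_sum_of_inter_support_eq (t := Fintype.piFinset Z),
    ← Finset.prod_univ_sum (t := Z)
      (f := fun u k => dyadicProfile (2 ^ (-k) * gapForm u (G.sonSums u.1 ξ)))]
  · exact Finset.prod_eq_one fun u _ => hZ1 u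
  · ext k
    simp only [Set.mem_inter_iff, Function.mem_support, Finset.mem_coe, Fintype.mem_piFinset]
    refine and_congr_left fun hk => ⟨fun _ u => hZ u _
      (Finset.prod_ne_zero_iff.1 hk u (Finset.mem_univ u)), fun _ u v hv => ?_⟩
    have hp : ∀ u, (2 : ℝ) ^ k u < gapForm u (G.sonSums u.1 ξ) ∧
        gapForm u (G.sonSums u.1 ξ) < 4 * 2 ^ k u := fun u => by
      obtain ⟨g1, g2⟩ := dyadicProfile_ne_zero (Finset.prod_ne_zero_iff.1 hk u (Finset.mem_univ u))
      have h2k : (0 : ℝ) < 2 ^ k u := by positivity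
      rw [zpow_neg, ← div_eq_inv_mul] at g1 g2
      rw [lt_div_iff₀ h2k, one_mul] at g1
      rw [div_lt_iff₀ h2k] at g2
      exact ⟨g1, g2⟩
    have d1 : D u ≤ 2 ^ α * gapForm u (G.sonSums u.1 ξ) := (hgap u _ _ (firstSon_covBy u)).1
    have d2 : gapForm v (G.sonSums v.1 ξ) ≤ D v := (hgap v _ _ (firstSon_covBy v)).2
    -- Separation of the clusters makes the condition on the scales automatic: wherever the profiles
    -- do not vanish, k_v + K < k_u. The sum over admissible tuples is therefore the full product of
    -- the partitions of unity.
    have h3 : (2 : ℝ) ^ (α + K + 2) * 2 ^ k v < 2 ^ α * (4 * 2 ^ k u) := by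
      calc (2 : ℝ) ^ (α + K + 2) * 2 ^ k v ≤ L * D v :=
            mul_le_mul hL ((hp v).1.le.trans d2) (by positivity) (le_trans (by positivity) hL)
        _ ≤ D u := h.sep u v hv
        _ ≤ 2 ^ α * gapForm u (G.sonSums u.1 ξ) := d1
        _ < 2 ^ α * (4 * 2 ^ k u) := by have := (hp u).2; gcongr
    have h4 : (2 : ℝ) ^ (α + K + 2 + k v : ℤ) < 2 ^ (α + 2 + k u : ℤ) := by
      rw [zpow_add₀ two_ne_zero, zpow_add₀ (two_ne_zero) (α + 2 : ℤ), zpow_add₀ two_ne_zero (α : ℤ)]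
      have e1 : (2 : ℝ) ^ (α + K + 2 : ℤ) = 2 ^ (α + K + 2) := by exact_mod_cast rfl
      rw [e1, zpow_natCast]
      refine h3.trans_eq ?_
      norm_num
      ring
    have h5 := (zpow_lt_zpow_iff_right₀ (one_lt_two (α := ℝ))).1 h4
    omega

end PlaneTree
end

/-! ### Choice of parameters and decomposition of the indicator function -/

noncomputable section

namespace PlaneTree

variable {n : ℕ} {G : PlaneTree n}

theorem le_iterate_prodConst {A : ℝ} (hA : 1 ≤ A) (p : ℕ) : A ≤ (prodConst n)^[p] A := by
  induction p with
  | zero => exact le_rfl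
  | succ p ih =>
    rw [Function.iterate_succ_apply']
    exact ih.trans (le_prodConst (hA.trans ih))

/-- The factors 1 - M are multiplied in one at a time, and the accumulated product always has the
larger constant, so the type stays G. The constant passes through iterates of `prodConst` while K
does not change; this is why K must be large for every iterate. -/
theorem Std.mul_prod_one_sub (hn : 1 ≤ n) {A c : ℝ} {K : ℕ} {X : (Fin n → ℝ) → ℂ}
    (h : G.Std A K c X) (hA : 1 ≤ A) {ι : Type*} (s : Finset ι) {G' : ι → PlaneTree n}
    {A' : ι → ℝ} {K' : ι → ℕ} {M : ι → (Fin n → ℝ) → ℂ}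
    (hM : ∀ i ∈ s, (G' i).Std (A' i) (K' i) c (M i)) (hA' : ∀ i ∈ s, 1 ≤ A' i ∧ A' i ≤ A)
    (hK' : ∀ i ∈ s, sepExp n (A' i) ≤ K' i ∧ K' i ≤ K)
    (hK : ∀ p ≤ s.card, sepExp n ((prodConst n)^[p] A) ≤ K) :
    G.Std ((prodConst n)^[s.card] A) K c fun ξ => X ξ * ∏ i ∈ s, (1 - M i ξ) := by
  classical
  induction s using Finset.induction_on with
  | empty => simpa using h
  | insert a s ha ih =>
    rw [Finset.card_insert_of_notMem ha] at hK ⊢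
    have ih := ih (fun i hi => hM i (Finset.mem_insert_of_mem hi))
      (fun i hi => hA' i (Finset.mem_insert_of_mem hi))
      (fun i hi => hK' i (Finset.mem_insert_of_mem hi)) fun p hp => hK p (hp.trans (Nat.le_succ _))
    obtain ⟨a1, a2⟩ := hA' a (Finset.mem_insert_self _ _)
    obtain ⟨k1, k2⟩ := hK' a (Finset.mem_insert_self _ _)
    have hAp := le_iterate_prodConst (n := n) hA s.card
    have h1 := (hM a (Finset.mem_insert_self _ _)).mul_of_le hn ih a1 (a2.trans hAp) k1
      (hK _ (Nat.le_succ _))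
    rw [max_eq_right k2] at h1
    rw [Function.iterate_succ_apply']
    have h2 := ih.mono (by linarith) (le_prodConst (n := n) (hA.trans hAp))
    refine (h2.add (h1.const_mul (-1))).congr fun ξ => ?_
    rw [Finset.prod_insert ha]
    ring

/-- Parameters of the model symbols: a bound for the separation of clusters and for the separation
of scales. They are defined recursively, with decreasing number of vertices. -/
def modelSeq (n M : ℕ) (κ' : ℝ → ℕ) : ℕ → ℝ × ℕ
  | 0 => (2, 0)
  | t + 1 =>
    -- The threshold at level t bounds the ratios of gaps by 2^α, which fixes the constant A of the
    -- model; K is then chosen large for all iterates of A, and the next threshold is large enough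
    -- to separate the scales by K.
    let α := ⌈(1 + (modelSeq n M κ' t).1) ^ n⌉₊
    let K := max (modelSeq n M κ' t).2 ((Finset.range (M + 1)).sup fun p =>
      max (sepExp n ((prodConst n)^[p] (modelConst n α))) (κ' ((prodConst n)^[p] (modelConst n α))))
    (2 ^ (α + K + 2), K)

section ModelSeq

variable {M : ℕ} {κ' : ℝ → ℕ}

/-- The exponent in the bound for the ratios of gaps. -/
def modelExp (n M : ℕ) (κ' : ℝ → ℕ) (t : ℕ) : ℕ := ⌈(1 + (modelSeq n M κ' t).1) ^ n⌉₊

theorem modelSeq_succ_fst (t : ℕ) : (modelSeq n M κ' (t + 1)).1 =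
    2 ^ (modelExp n M κ' t + (modelSeq n M κ' (t + 1)).2 + 2) := rfl

theorem le_modelSeq_snd {t p : ℕ} (hp : p ≤ M) :
    sepExp n ((prodConst n)^[p] (modelConst n (modelExp n M κ' t))) ≤ (modelSeq n M κ' (t + 1)).2 ∧
      κ' ((prodConst n)^[p] (modelConst n (modelExp n M κ' t))) ≤ (modelSeq n M κ' (t + 1)).2 := by
  have h := Finset.le_sup (f := fun p =>
    max (sepExp n ((prodConst n)^[p] (modelConst n (modelExp n M κ' t))))
      (κ' ((prodConst n)^[p] (modelConst n (modelExp n M κ' t)))))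
    (Finset.mem_range.2 (Nat.lt_succ_of_le hp))
  have h' := h.trans (le_max_right (modelSeq n M κ' t).2 _)
  exact ⟨(le_max_left _ _).trans h', (le_max_right _ _).trans h'⟩

theorem monotone_modelSeq_snd : Monotone fun t => (modelSeq n M κ' t).2 :=
  monotone_nat_of_le_succ fun _ => le_max_left _ _

theorem one_lt_modelSeq_fst (t : ℕ) : 1 < (modelSeq n M κ' t).1 := by
  cases t with
  | zero => exact one_lt_two
  | succ t =>
    rw [modelSeq_succ_fst]
    exact one_lt_pow₀ one_lt_two (by omega)

theorem monotone_modelSeq_fst (hn : 1 ≤ n) : Monotone fun t => (modelSeq n M κ' t).1 := by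
  refine monotone_nat_of_le_succ fun t => ?_
  have h1 := one_lt_modelSeq_fst (n := n) (M := M) (κ' := κ') t
  rw [modelSeq_succ_fst]
  calc (modelSeq n M κ' t).1 ≤ (1 + (modelSeq n M κ' t).1) ^ 1 := by linarith
    _ ≤ (1 + (modelSeq n M κ' t).1) ^ n := pow_le_pow_right₀ (by linarith) hn
    _ ≤ 2 ^ modelExp n M κ' t := (le_two_pow_ceil _).le
    _ ≤ _ := pow_le_pow_right₀ one_le_two (by omega)

theorem monotone_modelConst (hn : 1 ≤ n) :
    Monotone fun t => modelConst n (modelExp n M κ' t) := by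
  intro s t hst
  have h1 := one_lt_modelSeq_fst (n := n) (M := M) (κ' := κ') s
  have h2 : modelExp n M κ' s ≤ modelExp n M κ' t := by
    refine Nat.ceil_mono (pow_le_pow_left₀ (by linarith) ?_ n)
    exact add_le_add_right (monotone_modelSeq_fst hn hst) 1
  change (n : ℝ) * 2 ^ (2 * modelExp n M κ' s + 5) ≤ n * 2 ^ (2 * modelExp n M κ' t + 5)
  gcongr
  exact one_le_two

end ModelSeq

/-- Lexicographic order: first by t, with ties broken by an enumeration. It serves to order the
trees by non-decreasing constants. -/
theorem exists_rank {ι : Type*} [Fintype ι] (t : ι → ℕ) :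
    ∃ rank : ι → ℕ, Function.Injective rank ∧ ∀ i j, rank i < rank j → t i ≤ t j := by
  set e := Fintype.equivFin ι
  have key : ∀ i j, t i < t j → t i * Fintype.card ι + e i < t j * Fintype.card ι + e j := by
    intro i j h
    have h1 : (t i + 1) * Fintype.card ι ≤ t j * Fintype.card ι := Nat.mul_le_mul_right _ h
    have h2 := (e i).2
    rw [add_mul, one_mul] at h1
    omega
  refine ⟨fun i => t i * Fintype.card ι + e i, fun i j h => ?_, fun i j h => ?_⟩
  · rcases lt_trichotomy (t i) (t j) with h1 | h1 | h1
    · exact absurd h (key i j h1).ne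
    · simp only [h1, add_right_inj] at h
      exact e.injective (Fin.ext h)
    · exact absurd h (key j i h1).ne'
  · by_contra hc
    exact absurd h (key j i (not_le.1 hc)).not_gt

/-- The characteristic function of the increasing sequences is a sum of standard symbols. -/
theorem exists_sum_isStandardSymbol (hn : 1 ≤ n) (κ' : ℝ → ℕ) (c : ℝ) :
    ∃ m : PlaneTree n → (Fin n → ℝ) → ℂ, (∀ G : PlaneTree n, G.IsStandardSymbol κ' c (m G)) ∧
      ∀ ξ : Fin n → ℝ,
        Set.indicator {η : Fin n → ℝ | StrictMono η} 1 ξ = ∑ G : PlaneTree n, m G ξ := by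
  classical
  set M := Fintype.card (PlaneTree n) with hM
  set t : PlaneTree n → ℕ := fun G => 2 ^ n - G.inner.card with ht
  obtain ⟨rank, hinj, hrank⟩ := exists_rank t
  let : LinearOrder (PlaneTree n) := LinearOrder.lift' rank hinj
  set α : PlaneTree n → ℕ := fun G => modelExp n M κ' (t G) with hα
  set K : PlaneTree n → ℕ := fun G => (modelSeq n M κ' (t G + 1)).2 with hK
  set X : PlaneTree n → (Fin n → ℝ) → ℂ := fun G => G.model (modelConst n (α G)) (α G + 2) (K G)
    with hX
  have hA1 : ∀ G, 1 ≤ modelConst n (α G) := fun G => one_le_modelConst hn _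
  have hstd : ∀ G : PlaneTree n, G.Std (modelConst n (α G)) (K G) c (X G) := fun G =>
    std_model G c (hA1 G) (pow_le_modelConst hn _) _
  have hsep : ∀ G : PlaneTree n, sepExp n (modelConst n (α G)) ≤ K G := fun G =>
    (le_modelSeq_snd (Nat.zero_le M)).1
  refine ⟨fun G ξ => X G ξ * ∏ G' ∈ Finset.univ with G' < G, (1 - X G' ξ), fun G => ?_,
    fun ξ => ?_⟩
  · have hcard : (Finset.univ.filter fun G' => G' < G).card ≤ M := Finset.card_le_univ _
    have hlt : ∀ G' ∈ Finset.univ.filter fun G' => G' < G, t G' ≤ t G := fun G' hG' =>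
      hrank G' G (Finset.mem_filter.1 hG').2
    exact isStandardSymbol_iff.2 ⟨_, K G, (hA1 G).trans (le_iterate_prodConst (hA1 G) _),
      (le_modelSeq_snd hcard).2, (hstd G).mul_prod_one_sub hn (hA1 G) _ (fun G' _ => hstd G')
        (fun G' hG' => ⟨hA1 G', monotone_modelConst hn (hlt G' hG')⟩)
        (fun G' hG' => ⟨hsep G', monotone_modelSeq_snd (Nat.succ_le_succ (hlt G' hG'))⟩)
        fun p hp => (le_modelSeq_snd (hp.trans hcard)).1⟩
  -- The sum of the symbols telescopes to 1 - ∏(1 - X_G).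
  · have h1 := Finset.prod_one_sub_ordered Finset.univ fun G => X G ξ
    rw [eq_sub_iff_add_eq, ← eq_sub_iff_add_eq'] at h1
    rw [h1]
    by_cases hξ : StrictMono ξ
    · rw [Set.indicator_of_mem (by exact hξ)]
      obtain ⟨s, G, hs, D, hD⟩ := exists_clustered hn hξ
        (fun s => one_lt_modelSeq_fst (n := n) (M := M) (κ' := κ') s) (monotone_modelSeq_fst hn)
      -- The level found by the pigeonhole argument is the one whose parameters were built into X_G.
      obtain rfl : t G = s := by simp only [ht]; omega
      have h2 : X G ξ = 1 := by
        refine model_eq_one hn hD ?_ (le_two_pow_ceil _).le (modelSeq_succ_fst _).ge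
        have := one_lt_modelSeq_fst (n := n) (M := M) (κ' := κ') (t G)
        positivity
      rw [Finset.prod_eq_zero (Finset.mem_univ G) (by rw [h2, sub_self]), sub_zero]
      rfl
    · rw [Set.indicator_of_notMem (by exact hξ), Finset.prod_eq_one, sub_self]
      intro G _
      rw [sub_eq_self]
      by_contra hne
      exact hξ ((hstd G).strictMono_of_ne_zero hn (hA1 G) (hsep G) hne)

end PlaneTree
end

theorem proposition3p5 (n : ℕ) (hn : 1 ≤ n) (κ' : ℝ → ℕ) :
    (∃ κ : ℝ → ℕ, ∀ (c : ℝ) (G₁ G₂ : PlaneTree n) (m₁ m₂ : (Fin n → ℝ) → ℂ),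
      G₁.IsStandardSymbol κ c m₁ → G₂.IsStandardSymbol κ c m₂ →
        ∃ G : PlaneTree n, G.IsStandardSymbol κ' c (fun ξ => m₁ ξ * m₂ ξ)) ∧
    (∀ c : ℝ, ∃ m : PlaneTree n → (Fin n → ℝ) → ℂ,
      (∀ G : PlaneTree n, G.IsStandardSymbol κ' c (m G)) ∧
        ∀ ξ : Fin n → ℝ,
          Set.indicator {η : Fin n → ℝ | StrictMono η} 1 ξ = ∑ G : PlaneTree n, m G ξ) :=
  ⟨PlaneTree.exists_isStandardSymbol_mul hn κ', PlaneTree.exists_sum_isStandardSymbol hn κ'⟩
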